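/- For a nonsingular integer matrix $B\in\mathbb{Z}^{n\times n}$ ($n\ge 1$) let $L(B)\subseteq\mathbb{R}^n$ be the lattice of all integer linear combinations of the columns of $B$, and let $\|\cdot\|$ be the Euclidean norm. An integer matrix $B'\in\mathbb{Z}^{n\times n}$ is in Systematic Normal Form (SysNF) if $B'_{i,i}=1$ for all $i>1$, $B'_{i,j}=0$ for all $i>1$ and $j\neq i$, and $N=B'_{1,1}$ is positive and satisfies $\sum_{i>1}(B'_{1,i})^2+1\not\equiv 0 \pmod N$. There is a single algorithm with the following properties. Given any $n\ge1$, any nonsingular $B\in\mathbb{Z}^{n\times n}$ and any rational $\varepsilon>0$, it computes, in time polynomial in the bit length of the input $(n,B,\varepsilon)$ (time being counted on a random access machine with logarithmic cost), a SysNF matrix $B'\in\mathbb{Z}^{n\times n}$, a positive integer $T$ and a $\mathbb{Z}$-linear bijection $\sigma:L(B)\to L(B')$, the latter being given by the integer matrix whose columns are the images under $\sigma$ of the columns of $B$, such that $$\left\|\frac{\sigma(v)}{T}-v\right\|\le\varepsilon\|v\|\qquad\text{for all } v\in L(B).$$ Moreover $T$ is polynomially bounded in $n$ and $|\det B|/\varepsilon$: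 there are constants $C,k\in\mathbb{N}$, independent of $n$, $B$ and $\varepsilon$, such that $T\le C\,\bigl(n+|\det B|/\varepsilon\bigr)^k$. -/

import Mathlib

/-! ### A random access machine with logarithmic cost

Structured programs over the integers. A program is a finite syntax tree, so that it uses only
finitely many variables and arrays; every number that is read or computed is charged its binary
length. -/

namespace LogRAM

/-- The number of bits of an integer (including one bit for the sign). -/
def bitLen (z : ℤ) : ℕ := z.natAbs.size + 1

/-- The memory: integer variables and two-dimensional integer arrays, each with a number as its
name. -/
structure Store where
  var : ℕ → ℤ
  arr : ℕ → ℤ → ℤ → ℤ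

/-- Change one variable. -/
def Store.setVar (s : Store) (x : ℕ) (v : ℤ) : Store :=
  ⟨Function.update s.var x v, s.arr⟩

/-- Change one array cell. -/
def Store.setArr (s : Store) (a : ℕ) (i j v : ℤ) : Store :=
  ⟨s.var, Function.update s.arr a
    (Function.update (s.arr a) i (Function.update (s.arr a i) j v))⟩

/-- Arithmetic expressions; `get a i j` reads a cell of the array `a`. -/
inductive Expr where
  | const (c : ℤ)
  | var (x : ℕ)
  | get (a : ℕ) (i j : Expr)
  | add (e f : Expr)
  | sub (e f : Expr)
  | mul (e f : Expr)
  | div (e f : Expr)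
  | mod (e f : Expr)

/-- The value of an expression (`div` and `mod` are division with remainder). -/
def Expr.eval (s : Store) : Expr → ℤ
  | .const c => c
  | .var x => s.var x
  | .get a i j => s.arr a (i.eval s) (j.eval s)
  | .add e f => e.eval s + f.eval s
  | .sub e f => e.eval s - f.eval s
  | .mul e f => e.eval s * f.eval s
  | .div e f => e.eval s / f.eval s
  | .mod e f => e.eval s % f.eval s

/-- The logarithmic cost of evaluating an expression: each node of the expression tree is charged
the bit length of its value. An operation is thus charged the lengths of its operands and of its
result, and a memory access the lengths of the address and of the content. -/
def Expr.cost (s : Store) : Expr → ℕ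
  | .const c => bitLen c
  | .var x => bitLen (s.var x)
  | .get a i j => i.cost s + j.cost s + bitLen ((Expr.get a i j).eval s)
  | .add e f => e.cost s + f.cost s + bitLen ((Expr.add e f).eval s)
  | .sub e f => e.cost s + f.cost s + bitLen ((Expr.sub e f).eval s)
  | .mul e f => e.cost s + f.cost s + bitLen ((Expr.mul e f).eval s)
  | .div e f => e.cost s + f.cost s + bitLen ((Expr.div e f).eval s)
  | .mod e f => e.cost s + f.cost s + bitLen ((Expr.mod e f).eval s)

/-- Programs. -/
inductive Program where
  | skip
  | assign (x : ℕ) (e : Expr)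
  | store (a : ℕ) (i j e : Expr)
  | seq (p q : Program)
  /-- if `0 < e` then `p` else `q` -/
  | branch (e : Expr) (p q : Program)
  /-- while `0 < e` do `p` -/
  | loop (e : Expr) (p : Program)

/-- `Exec p s s' t`: started in the memory `s`, the program `p` halts in the memory `s'` after
a computation of total cost `t`. -/
inductive Exec : Program → Store → Store → ℕ → Prop
  | skip (s : Store) : Exec .skip s s 1
  | assign (x : ℕ) (e : Expr) (s : Store) :
      Exec (.assign x e) s (s.setVar x (e.eval s)) (e.cost s + 1)
  | store (a : ℕ) (i j e : Expr) (s : Store) :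
      Exec (.store a i j e) s (s.setArr a (i.eval s) (j.eval s) (e.eval s))
        (i.cost s + j.cost s + e.cost s + 1)
  | seq {p q : Program} {s s' s'' : Store} {t t' : ℕ} :
      Exec p s s' t → Exec q s' s'' t' → Exec (.seq p q) s s'' (t + t' + 1)
  | branchPos {e : Expr} {p q : Program} {s s' : Store} {t : ℕ} :
      0 < e.eval s → Exec p s s' t → Exec (.branch e p q) s s' (e.cost s + t + 1)
  | branchNeg {e : Expr} {p q : Program} {s s' : Store} {t : ℕ} :
      ¬ 0 < e.eval s → Exec q s s' t → Exec (.branch e p q) s s' (e.cost s + t + 1)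
  | loopPos {e : Expr} {p : Program} {s s' s'' : Store} {t t' : ℕ} :
      0 < e.eval s → Exec p s s' t → Exec (.loop e p) s' s'' t' →
        Exec (.loop e p) s s'' (e.cost s + t + t' + 1)
  | loopNeg {e : Expr} {p : Program} {s : Store} :
      ¬ 0 < e.eval s → Exec (.loop e p) s s (e.cost s + 1)

end LogRAM

namespace SysNF

open LogRAM

/-! ### Lattices and the systematic normal form -/

/-- The `j`-th column of an integer matrix, as a vector of Euclidean space. -/
noncomputable def colVec {n : ℕ} (B : Matrix (Fin n) (Fin n) ℤ) (j : Fin n) :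
    EuclideanSpace ℝ (Fin n) :=
  WithLp.toLp 2 (fun i => (B i j : ℝ))

/-- The lattice `L(B)`: all integer linear combinations of the columns of `B`. -/
noncomputable def latticeOf {n : ℕ} (B : Matrix (Fin n) (Fin n) ℤ) :
    Submodule ℤ (EuclideanSpace ℝ (Fin n)) :=
  Submodule.span ℤ (Set.range (colVec B))

theorem colVec_mem {n : ℕ} (B : Matrix (Fin n) (Fin n) ℤ) (j : Fin n) :
    colVec B j ∈ latticeOf B :=
  Submodule.subset_span ⟨j, rfl⟩

/-- Systematic normal form. The first row is `N, b₂, …, bₙ` with `N > 0`, the other rows are those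
of the identity matrix, and `b₂² + ⋯ + bₙ² + 1` is not `0` modulo `N`. -/
structure IsSysNF {n : ℕ} [NeZero n] (B : Matrix (Fin n) (Fin n) ℤ) : Prop where
  pos : 0 < B 0 0
  diag : ∀ i, i ≠ 0 → B i i = 1
  offDiag : ∀ i, i ≠ 0 → ∀ j, j ≠ i → B i j = 0
  cond : ¬ (∑ i ∈ Finset.univ.erase (0 : Fin n), B 0 i ^ 2 + 1 ≡ 0 [ZMOD B 0 0])

/-! ### Input and output of the algorithm -/

/-- The memory that holds the input: the variables `0, 1, 2` contain `n`, the numerator and the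
denominator of `ε`, the array `0` contains `B`, and everything else is zero. -/
def inputStore {n : ℕ} (B : Matrix (Fin n) (Fin n) ℤ) (ε : ℚ) : Store where
  var x := if x = 0 then n else if x = 1 then ε.num else if x = 2 then ε.den else 0
  arr a i j :=
    if h : a = 0 ∧ (0 ≤ i ∧ i < n) ∧ (0 ≤ j ∧ j < n) then
      B ⟨i.toNat, by omega⟩ ⟨j.toNat, by omega⟩
    else 0

/-- The size of the input: the number of bits used to write down `n`, `ε` and `B`. -/
def inputSize {n : ℕ} (B : Matrix (Fin n) (Fin n) ℤ) (ε : ℚ) : ℕ :=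
  bitLen n + bitLen ε.num + bitLen ε.den + ∑ i, ∑ j, bitLen (B i j)

/-- The memory `s` holds the output `(B', A, T)`: the arrays `0` and `1` contain the `n × n`
matrices `B'` and `A`, the variable `0` contains `T`. -/
def IsOutput {n : ℕ} (s : Store) (B' A : Matrix (Fin n) (Fin n) ℤ) (T : ℕ) : Prop :=
  (∀ i j : Fin n, s.arr 0 (i : ℕ) (j : ℕ) = B' i j) ∧
  (∀ i j : Fin n, s.arr 1 (i : ℕ) (j : ℕ) = A i j) ∧
  s.var 0 = T

end SysNF

-- Write D = |det B|. The lattice L(B) has an upper triangular basis H whose entries to the right of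
-- the diagonal are nonnegative and smaller than the diagonal entry of their row. Multiply H by an
-- even T and add the sparse matrix E = `shiftMatrix n δ`, with ones just below the diagonal and δ
-- in the upper right corner. The lattice L(B') of the theorem is generated by the columns of G = T
-- H + E, and σ sends Hz to Gz; the columns of B = H U therefore go to those of G U.
--
-- G has a basis in systematic normal form because of the ones below the diagonal. They allow a
-- vector c to be solved for by c₀ = 1, cⱼ₊₁ = -T ∑ cᵢ Hᵢⱼ, and then c · G = (0, …, 0, δ - cₙ)
-- (`IsDual.vecMul`). So the columns of G satisfy the single congruence c · x ≡ 0 modulo N = |δ -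
-- cₙ|, and they generate all its solutions, as does the matrix with first row N, -c₁, …, -cₙ₋₁
-- (`IsDual.exists_unimodular`). The choice of δ in {0, 2} makes N nonzero. Since T is even, c₁, …,
-- cₙ and N are even, so the sum of squares plus one is odd and not divisible by N
-- (`IsDual.isSysNF`).
--
-- For v = Hz the error σ(v)/T - v equals Ez/T. The coordinates of v satisfy ‖z‖₁ ≤ (∏ Hᵢᵢ) ‖v‖₁
-- with no further factor exponential in n (`sum_abs_le_of_reduced`), the product is at most D, and
-- E at most doubles the 1-norm. The error is thus at most 2nD/T · ‖v‖, and T = 2(⌊nD/ε⌋ + 1) makes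
-- it small enough while staying polynomial in n and D/ε (`exists_latticeEquiv`).
--
-- For the running time it suffices to bound the rounds of each loop by some β and the size of all
-- numbers by some W (`Runs`): the cost is then a polynomial in β, fixed by the program, times the
-- bit length of W. The determinant comes from the Faddeev–LeVerrier recursion, whose coefficients
-- are those of the characteristic polynomial (`flMat_eq_adjCoeff`). H is found by inserting the
-- columns of B one at a time into the basis D · 1; all entries are kept modulo D during Euclid's
-- algorithm, which is legitimate because D ℤⁿ lies in L(B) (`IsTriExt.step`). Back substitution
-- yields U, and the recursion for c has only n steps, each multiplying the size by at most T n D.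

namespace LogRAM

/-! ### Total cost bounds from a bound on the numbers that occur -/

/-- The number of nodes of an expression. -/
def Expr.nodes : Expr → ℕ
  | .const _ => 1
  | .var _ => 1
  | .get _ i j => i.nodes + j.nodes + 1
  | .add e f => e.nodes + f.nodes + 1
  | .sub e f => e.nodes + f.nodes + 1
  | .mul e f => e.nodes + f.nodes + 1
  | .div e f => e.nodes + f.nodes + 1
  | .mod e f => e.nodes + f.nodes + 1

/-- Sufficient conditions for all subexpressions to be bounded by `W`. -/
def Expr.Bdd (W : ℕ) (s : Store) : Expr → Prop
  | .const c => |c| ≤ W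
  | .var x => |s.var x| ≤ W
  | .get a i j => i.Bdd W s ∧ j.Bdd W s ∧ |s.arr a (i.eval s) (j.eval s)| ≤ W
  | .add e f => e.Bdd W s ∧ f.Bdd W s ∧ |e.eval s + f.eval s| ≤ W
  | .sub e f => e.Bdd W s ∧ f.Bdd W s ∧ |e.eval s - f.eval s| ≤ W
  | .mul e f => e.Bdd W s ∧ f.Bdd W s ∧ |e.eval s * f.eval s| ≤ W
  | .div e f => e.Bdd W s ∧ f.Bdd W s
  | .mod e f => e.Bdd W s ∧ f.Bdd W s

theorem abs_ediv_le_abs (a b : ℤ) : |a / b| ≤ |a| := by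
  rw [Int.abs_eq_natAbs, Int.abs_eq_natAbs]
  exact_mod_cast Int.natAbs_ediv_le_natAbs a b

theorem abs_emod_le_max (a b : ℤ) : |a % b| ≤ max |a| |b| := by
  rcases eq_or_ne b 0 with rfl | hb
  · simp
  · rw [abs_of_nonneg (Int.emod_nonneg a hb)]
    exact (Int.emod_lt_abs a hb).le.trans (le_max_right _ _)

/-- Division and remainder never leave the range of their operands, even for divisor zero, which is
why `Expr.Bdd` asks nothing of their results. -/
theorem Expr.Bdd.abs_eval_le {W : ℕ} {s : Store} {e : Expr} (h : e.Bdd W s) :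
    |e.eval s| ≤ W := by
  induction e with
  | const c => exact h
  | var x => exact h
  | get a i j => exact h.2.2
  | add e f => exact h.2.2
  | sub e f => exact h.2.2
  | mul e f => exact h.2.2
  | div e f ihe ihf => exact (abs_ediv_le_abs _ _).trans (ihe h.1)
  | mod e f ihe ihf => exact (abs_emod_le_max _ _).trans (max_le (ihe h.1) (ihf h.2))

theorem bitLen_le_of_abs_le {W : ℕ} {z : ℤ} (h : |z| ≤ W) : bitLen z ≤ W.size + 1 := by
  have : z.natAbs ≤ W := by rw [Int.abs_eq_natAbs] at h; exact_mod_cast h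
  exact Nat.succ_le_succ (Nat.size_le_size this)

theorem Expr.Bdd.cost_le {W : ℕ} {s : Store} {e : Expr} (h : e.Bdd W s) :
    e.cost s ≤ e.nodes * (W.size + 1) := by
  have hb := bitLen_le_of_abs_le h.abs_eval_le
  induction e with
  | const c => simpa [Expr.nodes, Expr.cost, Expr.eval] using hb
  | var x => simpa [Expr.nodes, Expr.cost, Expr.eval] using hb
  | get a e f ihe ihf | add e f ihe ihf | sub e f ihe ihf | mul e f ihe ihf | div e f ihe ihf
  | mod e f ihe ihf =>
    have h1 : e.Bdd W s := h.1
    have h2 : f.Bdd W s := by first | exact h.2 | exact h.2.1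
    have := ihe h1 (bitLen_le_of_abs_le h1.abs_eval_le)
    have := ihf h2 (bitLen_le_of_abs_le h2.abs_eval_le)
    simp only [Expr.cost, Expr.nodes, add_mul, one_mul]
    omega

/-- The number of steps of a program whose loops have at most `β` rounds each. -/
def Program.steps (β : ℕ) : Program → ℕ
  | .skip => 1
  | .assign _ e => e.nodes + 1
  | .store _ i j e => i.nodes + j.nodes + e.nodes + 1
  | .seq p q => p.steps β + q.steps β + 1
  | .branch e p q => e.nodes + p.steps β + q.steps β + 1
  | .loop e p => (β + 1) * (e.nodes + p.steps β + 1)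

/-- The syntax tree is fixed, so each loop contributes one factor β + 1 and the degree is at most
the nesting depth. -/
theorem Program.exists_steps_eq_eval (p : Program) :
    ∃ q : Polynomial ℕ, ∀ β, p.steps β = q.eval β := by
  induction p with
  | skip => exact ⟨1, by simp [Program.steps]⟩
  | assign x e => exact ⟨.C (e.nodes + 1), by simp [Program.steps]⟩
  | store a i j e => exact ⟨.C (i.nodes + j.nodes + e.nodes + 1), by simp [Program.steps]⟩
  | seq p q hp hq =>
    obtain ⟨f, hf⟩ := hp
    obtain ⟨g, hg⟩ := hq
    exact ⟨f + g + 1, by simp [Program.steps, hf, hg]⟩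
  | branch e p q hp hq =>
    obtain ⟨f, hf⟩ := hp
    obtain ⟨g, hg⟩ := hq
    exact ⟨.C e.nodes + f + g + 1, by simp [Program.steps, hf, hg]⟩
  | loop e p hp =>
    obtain ⟨f, hf⟩ := hp
    exact ⟨(.X + 1) * (.C e.nodes + f + 1), by simp [Program.steps, hf]⟩

/-- Started in `s`, the program `p` halts in a memory with property `Q`, and its cost is at most
the cost of `p.steps β` steps with numbers up to `W`. -/
def Runs (β W : ℕ) (p : Program) (s : Store) (Q : Store → Prop) : Prop :=
  ∃ s' t, Exec p s s' t ∧ t ≤ p.steps β * (W.size + 1) ∧ Q s'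

section rules

variable {β W : ℕ} {p q : Program} {s : Store} {Q R : Store → Prop} {e : Expr}

theorem Runs.mono (h : Runs β W p s Q) (hQ : ∀ s', Q s' → R s') : Runs β W p s R := by
  obtain ⟨s', t, h1, h2, h3⟩ := h
  exact ⟨s', t, h1, h2, hQ _ h3⟩

theorem Runs.assign {x : ℕ} (he : e.Bdd W s) (hQ : Q (s.setVar x (e.eval s))) :
    Runs β W (.assign x e) s Q := by
  refine ⟨_, _, Exec.assign x e s, ?_, hQ⟩
  have := he.cost_le
  simp only [Program.steps, add_mul, one_mul]
  omega

theorem Runs.store {a : ℕ} {i j : Expr} (hi : i.Bdd W s) (hj : j.Bdd W s) (he : e.Bdd W s)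
    (hQ : Q (s.setArr a (i.eval s) (j.eval s) (e.eval s))) :
    Runs β W (.store a i j e) s Q := by
  refine ⟨_, _, Exec.store a i j e s, ?_, hQ⟩
  have := he.cost_le
  have := hi.cost_le
  have := hj.cost_le
  simp only [Program.steps, add_mul, one_mul]
  omega

/-- Nesting the second run in the postcondition of the first lets a program be verified forwards,
instruction by instruction, with the costs added up silently. -/
theorem Runs.seq (h : Runs β W p s (fun s' => Runs β W q s' Q)) :
    Runs β W (.seq p q) s Q := by
  obtain ⟨s', t, h1, h2, s'', t', h3, h4, h5⟩ := h
  refine ⟨s'', _, Exec.seq h1 h3, ?_, h5⟩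
  simp only [Program.steps, add_mul, one_mul]
  omega

theorem Runs.branch (he : e.Bdd W s) (hp : 0 < e.eval s → Runs β W p s Q)
    (hq : ¬ 0 < e.eval s → Runs β W q s Q) : Runs β W (.branch e p q) s Q := by
  have hc := he.cost_le
  by_cases h : 0 < e.eval s
  · obtain ⟨s', t, h1, h2, h3⟩ := hp h
    refine ⟨s', _, Exec.branchPos h h1, ?_, h3⟩
    simp only [Program.steps, add_mul, one_mul]
    omega
  · obtain ⟨s', t, h1, h2, h3⟩ := hq h
    refine ⟨s', _, Exec.branchNeg h h1, ?_, h3⟩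
    simp only [Program.steps, add_mul, one_mul]
    omega

/-- The rule for loops, with an invariant `I m` in which `m` bounds the number of rounds that are
still to come. -/
theorem Runs.loop (I : ℕ → Store → Prop) {m : ℕ} (hm : m ≤ β) (h0 : I m s)
    (he : ∀ m s, I m s → e.Bdd W s)
    (hstep : ∀ m s, I m s → 0 < e.eval s → ∃ m', m = m' + 1 ∧ Runs β W p s (I m'))
    (hQ : ∀ m s, I m s → ¬ 0 < e.eval s → Q s) : Runs β W (.loop e p) s Q := by
  suffices H : ∀ m s, I m s → ∃ s' t, Exec (.loop e p) s s' t ∧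
      t ≤ (m + 1) * (e.nodes + p.steps β + 1) * (W.size + 1) ∧ Q s' by
    obtain ⟨s', t, h1, h2, h3⟩ := H m s h0
    refine ⟨s', t, h1, h2.trans ?_, h3⟩
    exact Nat.mul_le_mul_right _ (Nat.mul_le_mul_right _ (by omega))
  intro m
  induction m with
  | zero =>
    intro s hs
    have hn : ¬ 0 < e.eval s := fun h => by
      obtain ⟨m', h', -⟩ := hstep _ _ hs h
      omega
    refine ⟨s, _, Exec.loopNeg hn, ?_, hQ _ _ hs hn⟩
    have := (he _ _ hs).cost_le
    simp only [add_mul, one_mul, zero_mul]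
    omega
  | succ m ih =>
    intro s hs
    have hc := (he _ _ hs).cost_le
    by_cases h : 0 < e.eval s
    · obtain ⟨m', hm', s', t, h1, h2, h3⟩ := hstep _ _ hs h
      obtain rfl : m = m' := by omega
      obtain ⟨s'', t', h4, h5, h6⟩ := ih s' h3
      refine ⟨s'', _, Exec.loopPos h h1 h4, ?_, h6⟩
      have : (m + 1 + 1) * (e.nodes + p.steps β + 1) * (W.size + 1) =
        (m + 1) * (e.nodes + p.steps β + 1) * (W.size + 1) + e.nodes * (W.size + 1) +
          p.steps β * (W.size + 1) + (W.size + 1) := by ring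
      omega
    · refine ⟨s, _, Exec.loopNeg h, ?_, hQ _ _ hs h⟩
      have : (m + 1 + 1) * (e.nodes + p.steps β + 1) * (W.size + 1) =
        (m + 1) * (e.nodes + p.steps β + 1) * (W.size + 1) + e.nodes * (W.size + 1) +
          p.steps β * (W.size + 1) + (W.size + 1) := by ring
      omega

end rules

/-! ### What a program leaves unchanged -/

/-- Does the program contain an assignment to the variable `x`? -/
def Program.writesVar (x : ℕ) : Program → Bool
  | .skip => false
  | .assign y _ => y == x
  | .store _ _ _ _ => false
  | .seq p q => p.writesVar x || q.writesVar x
  | .branch _ p q => p.writesVar x || q.writesVar x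
  | .loop _ p => p.writesVar x

/-- Does the program contain an assignment to a cell of the array `a`? -/
def Program.writesArr (a : ℕ) : Program → Bool
  | .skip => false
  | .assign _ _ => false
  | .store b _ _ _ => b == a
  | .seq p q => p.writesArr a || q.writesArr a
  | .branch _ p q => p.writesArr a || q.writesArr a
  | .loop _ p => p.writesArr a

/-- The memories `s` and `s'` agree on everything that `p` does not write. -/
structure Frame (p : Program) (s s' : Store) : Prop where
  var : ∀ x, p.writesVar x = false → s'.var x = s.var x
  arr : ∀ a, p.writesArr a = false → s'.arr a = s.arr a

theorem Frame.refl (p : Program) (s : Store) : Frame p s s := ⟨fun _ _ => rfl, fun _ _ => rfl⟩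

theorem Frame.trans {p : Program} {s s' s'' : Store} (h : Frame p s s') (h' : Frame p s' s'') :
    Frame p s s'' :=
  ⟨fun x hx => (h'.var x hx).trans (h.var x hx), fun a ha => (h'.arr a ha).trans (h.arr a ha)⟩

theorem Frame.of_imp {p q : Program} {s s' : Store} (h : Frame p s s')
    (hv : ∀ x, q.writesVar x = false → p.writesVar x = false)
    (ha : ∀ a, q.writesArr a = false → p.writesArr a = false) : Frame q s s' :=
  ⟨fun x hx => h.var x (hv x hx), fun a h' => h.arr a (ha a h')⟩

theorem Exec.frame {p : Program} {s s' : Store} {t : ℕ} (h : Exec p s s' t) : Frame p s s' := by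
  induction h with
  | skip s => exact Frame.refl _ _
  | assign x e s =>
    refine ⟨fun y hy => ?_, fun _ _ => rfl⟩
    have : y ≠ x := by rintro rfl; simp [Program.writesVar] at hy
    simp [Store.setVar, Function.update_of_ne this]
  | store a i j e s =>
    refine ⟨fun _ _ => rfl, fun b hb => ?_⟩
    have : b ≠ a := by rintro rfl; simp [Program.writesArr] at hb
    simp [Store.setArr, Function.update_of_ne this]
  | seq h1 h2 ih1 ih2 =>
    refine (ih1.of_imp ?_ ?_).trans (ih2.of_imp ?_ ?_) <;>
      simp +contextual [Program.writesVar, Program.writesArr]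
  | branchPos h0 h1 ih => apply ih.of_imp <;> simp +contextual [Program.writesVar, Program.writesArr]
  | branchNeg h0 h1 ih => apply ih.of_imp <;> simp +contextual [Program.writesVar, Program.writesArr]
  | @loopPos e p _ _ _ _ _ h0 h1 h2 ih1 ih2 =>
    exact (ih1.of_imp (q := .loop e p) (fun _ => id) (fun _ => id)).trans ih2
  | loopNeg h0 => exact Frame.refl _ _

/-- What a program can write is computed from its syntax, so for concrete programs the side
conditions of `Frame` hold by `rfl`. Invariants then need to mention only what changes. -/
theorem Runs.frame {β W : ℕ} {p : Program} {s : Store} {Q : Store → Prop} (h : Runs β W p s Q) :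
    Runs β W p s (fun s' => Q s' ∧ Frame p s s') := by
  obtain ⟨s', t, h1, h2, h3⟩ := h
  exact ⟨s', t, h1, h2, h3, h1.frame⟩

/-! ### Reading an updated memory -/

@[simp]
theorem Store.var_setVar (s : Store) (x y : ℕ) (v : ℤ) :
    (s.setVar x v).var y = if y = x then v else s.var y := by
  simp [Store.setVar, Function.update_apply]

@[simp]
theorem Store.arr_setVar (s : Store) (x : ℕ) (v : ℤ) : (s.setVar x v).arr = s.arr := rfl

@[simp]
theorem Store.var_setArr (s : Store) (a : ℕ) (i j v : ℤ) : (s.setArr a i j v).var = s.var := rfl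

@[simp]
theorem Store.arr_setArr (s : Store) (a b : ℕ) (i j i' j' v : ℤ) :
    (s.setArr a i j v).arr b i' j' = if b = a ∧ i' = i ∧ j' = j then v else s.arr b i' j' := by
  unfold Store.setArr
  by_cases hb : b = a
  · subst hb
    by_cases hi : i' = i
    · subst hi
      simp [Function.update_apply]
    · simp [hi]
  · simp [hb]

theorem Store.setVar_setVar_self (s : Store) (x : ℕ) (v w : ℤ) :
    (s.setVar x v).setVar x w = s.setVar x w := by
  simp [Store.setVar]

theorem Store.setVar_comm (s : Store) {x y : ℕ} (h : x ≠ y) (v w : ℤ) :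
    (s.setVar x v).setVar y w = (s.setVar y w).setVar x v := by
  simp [Store.setVar, Function.update_comm h]

/-! ### Counting loops and sums -/

/-- Run `p` with the variable `x` going through `0, 1, …, y - 1`. -/
def forLoop (x y : ℕ) (p : Program) : Program :=
  .seq (.assign x (.const 0))
    (.loop (.sub (.var y) (.var x)) (.seq p (.assign x (.add (.var x) (.const 1)))))

theorem Runs.forLoop {β W : ℕ} {p : Program} {s : Store} {Q : Store → Prop} {x y : ℕ} (N : ℕ)
    (hN : s.var y = N) (hβ : N ≤ β) (hW : N < W) (hxy : y ≠ x) (hx : p.writesVar x = false)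
    (hy : p.writesVar y = false) (I : ℕ → Store → Prop) (h0 : I 0 (s.setVar x 0))
    (hstep : ∀ k < N, ∀ s', Frame (forLoop x y p) s s' → s'.var x = k → I k s' →
      Runs β W p s' (fun s'' => I (k + 1) (s''.setVar x (k + 1))))
    (hQ : ∀ s', Frame (LogRAM.forLoop x y p) s s' → s'.var x = N → I N s' → Q s') :
    Runs β W (LogRAM.forLoop x y p) s Q := by
  have hyF : (LogRAM.forLoop x y p).writesVar y = false := by
    simp [LogRAM.forLoop, Program.writesVar, hy, hxy.symm]
  refine Runs.seq (Runs.assign (by simp [Expr.Bdd]) ?_)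
  have hF0 : Frame (LogRAM.forLoop x y p) s (s.setVar x 0) := by
    refine ⟨fun z hz => ?_, fun _ _ => rfl⟩
    have : z ≠ x := by rintro rfl; simp [LogRAM.forLoop, Program.writesVar] at hz
    simp [this]
  -- With m rounds still to come the counter stands at N - m.
  refine Runs.loop (fun m s' => m ≤ N ∧ Frame (LogRAM.forLoop x y p) s s' ∧
    s'.var x = (N - m : ℕ) ∧ I (N - m) s') hβ ?_ ?_ ?_ ?_
  · simpa [Expr.eval] using ⟨hF0, h0⟩
  · rintro m s' ⟨hm, hF, hv, -⟩
    have := hF.var y hyF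
    simp only [Expr.Bdd, Expr.eval, hv, this, hN]
    refine ⟨?_, ?_, ?_⟩ <;> rw [abs_le] <;> constructor <;> push_cast [hm] <;> omega
  · rintro m s' ⟨hm, hF, hv, hI⟩ hpos
    have hyv := hF.var y hyF
    simp only [Expr.eval, hv, hyv, hN] at hpos
    obtain ⟨m, rfl⟩ : ∃ m', m = m' + 1 := ⟨m - 1, by omega⟩
    refine ⟨m, rfl, Runs.seq ?_⟩
    refine (hstep _ (by omega) s' hF hv hI).frame.mono ?_
    rintro s'' ⟨hI', hF'⟩
    have hxv : s''.var x = (N - (m + 1) : ℕ) := (hF'.var x hx).trans hv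
    have hk : N - (m + 1) + 1 = N - m := by omega
    refine Runs.assign ?_ ⟨by omega, ?_, ?_, ?_⟩
    · simp only [Expr.Bdd, Expr.eval, hxv]
      refine ⟨?_, ?_, ?_⟩ <;> rw [abs_le] <;> constructor <;> omega
    · refine hF.trans ⟨fun z hz => ?_, fun a ha => ?_⟩
      · simp only [LogRAM.forLoop, Program.writesVar, Bool.or_eq_false_iff, beq_eq_false_iff_ne]
          at hz
        simp [hz.1.symm, hF'.var z hz.2.1]
      · simp only [LogRAM.forLoop, Program.writesArr, Bool.or_eq_false_iff] at ha
        exact hF'.arr a ha.2.1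
    · simp only [Expr.eval, hxv, Store.var_setVar, if_true]
      omega
    · rw [hk] at hI'
      convert hI' using 2
      simp only [Expr.eval, hxv]
  · rintro m s' ⟨hm, hF, hv, hI⟩ hneg
    have hyv := hF.var y hyF
    simp only [Expr.eval, hv, hyv, hN] at hneg
    obtain rfl : m = 0 := by omega
    exact hQ s' hF hv hI

/-- Add up the values of `e`, with the variable `x` going through `0, 1, …, y - 1`. -/
def sumLoop (acc x y : ℕ) (e : Expr) : Program :=
  .seq (.assign acc (.const 0)) (forLoop x y (.assign acc (.add (.var acc) e)))

/-- The final memory is described exactly, so nothing else has to be carried through the loop. The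
price is the hypothesis that `e` evaluates to `f k` whatever the accumulator contains. -/
theorem Runs.sumLoop {β W : ℕ} {s : Store} {Q : Store → Prop} {acc x y : ℕ} {e : Expr} (N : ℕ)
    (hN : s.var y = N) (hβ : N ≤ β) (hW : N < W) (hxy : y ≠ x) (hax : acc ≠ x) (hay : acc ≠ y)
    (f : ℕ → ℤ)
    (he : ∀ k < N, ∀ v, e.Bdd W ((s.setVar acc v).setVar x k) ∧
      e.eval ((s.setVar acc v).setVar x k) = f k)
    (hf : ∀ k ≤ N, |∑ i ∈ Finset.range k, f i| ≤ W)
    (hQ : Q ((s.setVar acc (∑ i ∈ Finset.range N, f i)).setVar x N)) :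
    Runs β W (LogRAM.sumLoop acc x y e) s Q := by
  refine Runs.seq (Runs.assign (by simp [Expr.Bdd]) ?_)
  refine Runs.forLoop N (by simp [hay.symm, hN]) hβ hW hxy
    (by simp [Program.writesVar, hax]) (by simp [Program.writesVar, hay])
    (fun k s' => s' = (s.setVar acc (∑ i ∈ Finset.range k, f i)).setVar x k) ?_ ?_ ?_
  · simp [Expr.eval]
  · rintro k hk s' - - rfl
    obtain ⟨h1, h2⟩ := he k hk (∑ i ∈ Finset.range k, f i)
    have hs : ∑ i ∈ Finset.range k, f i + f k = ∑ i ∈ Finset.range (k + 1), f i :=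
      (Finset.sum_range_succ _ _).symm
    refine Runs.assign ⟨?_, h1, ?_⟩ ?_
    · simpa [Expr.Bdd, hax] using hf k hk.le
    · rw [h2]
      simpa [Expr.eval, hax, hs] using hf (k + 1) hk
    · simp only [Expr.eval, h2, Store.var_setVar, hax, if_false, if_true, hs]
      rw [Store.setVar_comm _ hax.symm, Store.setVar_setVar_self, Store.setVar_setVar_self,
        Store.setVar_comm _ hax, Store.setVar_comm _ hax.symm]
      norm_cast
  · rintro s' - - rfl
    exact hQ

end LogRAM


-- Double loops and matrices stored in arrays

namespace LogRAM

/-- Run `p` for all pairs of values `0, 1, …, y - 1` of the variables `i` and `j`. -/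
def pairLoop (i j y : ℕ) (p : Program) : Program := forLoop i y (forLoop j y p)

theorem forLoop_writesVar (x y z : ℕ) (p : Program) :
    (forLoop x y p).writesVar z = (x == z || p.writesVar z) := by
  simp only [forLoop, Program.writesVar]
  cases h : x == z <;> simp

theorem forLoop_writesArr (x y a : ℕ) (p : Program) :
    (forLoop x y p).writesArr a = p.writesArr a := by
  simp [forLoop, Program.writesArr]

/-- The rule for a double loop that computes the array `c` cell by cell. -/
theorem Runs.pairLoop {β W : ℕ} {p : Program} {s : Store} {Q : Store → Prop} {i j y c : ℕ} (N : ℕ)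
    (hN : s.var y = N) (hβ : N ≤ β) (hW : N < W) (hij : i ≠ j) (hyi : y ≠ i) (hyj : y ≠ j)
    (hi : p.writesVar i = false) (hj : p.writesVar j = false) (hy : p.writesVar y = false)
    (g : ℕ → ℕ → ℤ)
    (hbody : ∀ a < N, ∀ b < N, ∀ s', Frame (pairLoop i j y p) s s' → s'.var i = a → s'.var j = b →
      Runs β W p s' (fun s'' => ∀ a' b', s''.arr c a' b' =
        if a' = a ∧ b' = b then g a b else s'.arr c a' b'))
    (hQ : ∀ s', Frame (LogRAM.pairLoop i j y p) s s' → (∀ a b : ℤ, s'.arr c a b =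
      if 0 ≤ a ∧ a < N ∧ 0 ≤ b ∧ b < N then g a.toNat b.toNat else s.arr c a b) → Q s') :
    Runs β W (LogRAM.pairLoop i j y p) s Q := by
  refine Runs.forLoop N hN hβ hW hyi
    (by simp [forLoop_writesVar, hi, hij.symm]) (by simp [forLoop_writesVar, hy, hyj.symm])
    (fun k s' => ∀ a b : ℤ, s'.arr c a b =
      if 0 ≤ a ∧ a < k ∧ 0 ≤ b ∧ b < N then g a.toNat b.toNat else s.arr c a b) ?_ ?_ ?_
  · intro a b
    rw [if_neg (by push_cast; omega)]
    rfl
  · intro k hk s1 hF1 hv1 hI1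
    have hyv : s1.var y = N := by
      rw [hF1.var y (by simp [forLoop_writesVar, hy, hyj.symm, hyi.symm]), hN]
    refine Runs.forLoop N hyv hβ hW hyj hj hy
      (fun m s' => ∀ a b : ℤ, s'.arr c a b =
        if a = k ∧ 0 ≤ b ∧ b < m then g a.toNat b.toNat else s1.arr c a b) ?_ ?_ ?_
    · intro a b
      rw [if_neg (by push_cast; omega)]
      rfl
    · intro m hm s2 hF2 hv2 hI2
      have hF : Frame (LogRAM.pairLoop i j y p) s s2 := by
        refine hF1.trans (hF2.of_imp ?_ ?_)
        · intro z hz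
          rw [forLoop_writesVar, Bool.or_eq_false_iff] at hz
          exact hz.2
        · intro z hz
          rwa [forLoop_writesArr] at hz
      have hiv : s2.var i = k := by
        rw [hF2.var i (by simp [forLoop_writesVar, hi, hij.symm]), hv1]
      refine (hbody k hk m hm s2 hF hiv hv2).mono ?_
      intro s3 h3 a b
      rw [Store.arr_setVar, h3, hI2]
      by_cases h : a = k ∧ b = m
      · rw [if_pos h, if_pos (by push_cast; omega), h.1, h.2]
        simp
      · rw [if_neg h]
        congr 1
        push_cast
        exact propext ⟨fun h' => by omega, fun h' => by omega⟩
    · intro s2 hF2 hv2 hI2 a b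
      rw [Store.arr_setVar, hI2, hI1]
      by_cases h : a = k ∧ 0 ≤ b ∧ b < N
      · rw [if_pos h, if_pos (by push_cast; omega)]
      · rw [if_neg h]
        congr 1
        push_cast
        exact propext ⟨fun h' => by omega, fun h' => by omega⟩
  · intro s' hF hv hI
    exact hQ s' hF hI

theorem abs_sum_range_le {N k : ℕ} (hk : k ≤ N) {f : ℕ → ℤ} {c : ℤ}
    (hf : ∀ i < N, |f i| ≤ c) : |∑ i ∈ Finset.range k, f i| ≤ N * c := by
  rcases Nat.eq_zero_or_pos N with rfl | hN
  · obtain rfl : k = 0 := by omega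
    simp
  have hc : 0 ≤ c := (abs_nonneg _).trans (hf 0 hN)
  calc |∑ i ∈ Finset.range k, f i| ≤ ∑ i ∈ Finset.range k, |f i| := Finset.abs_sum_le_sum_abs _ _
    _ ≤ ∑ i ∈ Finset.range k, c :=
        Finset.sum_le_sum fun i hi => hf i (by have := Finset.mem_range.1 hi; omega)
    _ = k * c := by simp
    _ ≤ N * c := by gcongr

/-- The `n × n` matrix stored in the array `a`. -/
def Store.mat (s : Store) (n a : ℕ) : Matrix (Fin n) (Fin n) ℤ :=
  fun i j => s.arr a (i : ℕ) (j : ℕ)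

theorem Frame.mat {p : Program} {s s' : Store} (h : Frame p s s') {a : ℕ}
    (ha : p.writesArr a = false) (n : ℕ) : s'.mat n a = s.mat n a := by
  unfold Store.mat
  rw [h.arr a ha]

end LogRAM

namespace SysNF

open LogRAM

/-! ### The Faddeev–LeVerrier algorithm -/

mutual
/-- The matrices of the Faddeev–LeVerrier recursion. -/
def flMat {n : ℕ} (B : Matrix (Fin n) (Fin n) ℤ) : ℕ → Matrix (Fin n) (Fin n) ℤ
  | 0 => 1
  | k + 1 => B * flMat B k + flCoeff B k • 1

/-- The coefficients of the Faddeev–LeVerrier recursion. -/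
def flCoeff {n : ℕ} (B : Matrix (Fin n) (Fin n) ℤ) (k : ℕ) : ℤ :=
  (0 - (B * flMat B k).trace) / (k + 1)
end

theorem abs_mul_apply_le {n : ℕ} {A B : Matrix (Fin n) (Fin n) ℤ} {a b : ℤ}
    (hA : ∀ i j, |A i j| ≤ a) (hB : ∀ i j, |B i j| ≤ b) (i j : Fin n) :
    |(A * B) i j| ≤ n * (a * b) := by
  rw [Matrix.mul_apply]
  refine (Finset.abs_sum_le_sum_abs _ _).trans ((Finset.sum_le_sum (g := fun _ => a * b) ?_).trans
    (by simp))
  intro k _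
  rw [abs_mul]
  exact mul_le_mul (hA _ _) (hB _ _) (abs_nonneg _) ((abs_nonneg _).trans (hA i k))

theorem abs_trace_le {n : ℕ} {A : Matrix (Fin n) (Fin n) ℤ} {a : ℤ}
    (hA : ∀ i j, |A i j| ≤ a) : |A.trace| ≤ n * a := by
  rw [Matrix.trace]
  refine (Finset.abs_sum_le_sum_abs _ _).trans ((Finset.sum_le_sum (g := fun _ => a) ?_).trans
    (by simp))
  intro k _
  exact hA _ _

/-- Integer division does not increase absolute values, so the size bound is independent of the
exactness of the division. -/
theorem abs_flCoeff_le {n : ℕ} {B : Matrix (Fin n) (Fin n) ℤ} {b m : ℤ} {k : ℕ}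
    (hB : ∀ i j, |B i j| ≤ b) (hM : ∀ i j, |flMat B k i j| ≤ m) :
    |flCoeff B k| ≤ n * (n * (b * m)) := by
  rw [flCoeff, zero_sub]
  refine (abs_ediv_le_abs _ _).trans ?_
  rw [abs_neg]
  exact abs_trace_le (abs_mul_apply_le hB hM)

/-- Each round multiplies the entries by at most 2n²b: the product with B contributes n b, and the
trace term n² b. The bit length therefore grows only linearly with the number of rounds. -/
theorem abs_flMat_le {n : ℕ} {B : Matrix (Fin n) (Fin n) ℤ} {b : ℤ} (hB : ∀ i j, |B i j| ≤ b)
    (k : ℕ) : ∀ i j, |flMat B k i j| ≤ (2 * n ^ 2 * b) ^ k := by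
  induction k with
  | zero =>
    intro i j
    rw [flMat, Matrix.one_apply]
    split_ifs <;> simp
  | succ k ih =>
    intro i j
    have h1 := abs_mul_apply_le hB ih i j
    have h2 := abs_flCoeff_le hB ih
    have hb : 0 ≤ b := (abs_nonneg _).trans (hB i j)
    have hn : (1 : ℤ) ≤ n := by have := i.pos; omega
    have h3 : |(flCoeff B k • (1 : Matrix (Fin n) (Fin n) ℤ)) i j| ≤ |flCoeff B k| := by
      rw [Matrix.smul_apply, Matrix.one_apply]
      split_ifs <;> simp
    rw [flMat, Matrix.add_apply]
    refine (abs_add_le _ _).trans ?_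
    have h4 : 0 ≤ b * (2 * n ^ 2 * b) ^ k := by positivity
    have h5 : (n : ℤ) * (b * (2 * n ^ 2 * b) ^ k) ≤ n * (n * (b * (2 * n ^ 2 * b) ^ k)) := by
      nlinarith [mul_nonneg (mul_nonneg (by omega : (0 : ℤ) ≤ n) (by omega : (0 : ℤ) ≤ n - 1)) h4]
    calc _ ≤ 2 * (n * (n * (b * (2 * (n : ℤ) ^ 2 * b) ^ k))) := by linarith
      _ = _ := by ring

/-- One round of the Faddeev–LeVerrier recursion. -/
def flBody : Program :=
  .seq (pairLoop 3 4 0 (.seq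
    (sumLoop 6 5 0 (.mul (.get 0 (.var 3) (.var 5)) (.get 2 (.var 5) (.var 4))))
    (.store 5 (.var 3) (.var 4) (.var 6))))
  (.seq (sumLoop 6 5 0 (.get 5 (.var 5) (.var 5)))
  (.seq (.assign 7 (.div (.sub (.const 0) (.var 6)) (.add (.var 8) (.const 1))))
  (.seq (pairLoop 3 4 0 (.store 2 (.var 3) (.var 4) (.get 5 (.var 3) (.var 4))))
    (forLoop 3 0 (.store 2 (.var 3) (.var 3) (.add (.get 2 (.var 3) (.var 3)) (.var 7)))))))

/-- The Faddeev–LeVerrier algorithm. -/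
def flProg : Program :=
  .seq (forLoop 3 0 (.store 2 (.var 3) (.var 3) (.const 1))) (forLoop 8 0 flBody)

/-- The product with B is collected in array 5, since array 2 is still being read; only afterwards
is array 2 overwritten and the coefficient added to its diagonal. Variables 3, 4, 5 are counters, 6
is the accumulator, 7 the coefficient and 8 the round. -/
theorem runs_flBody {β W n : ℕ} {s : Store} {B : Matrix (Fin n) (Fin n) ℤ} {b m : ℤ} {k : ℕ}
    (hβ : n ≤ β) (hW : n < W) (hn : s.var 0 = n) (hk : k < n) (h8 : s.var 8 = k)
    (h0 : s.mat n 0 = B) (h2 : s.mat n 2 = flMat B k)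
    (hB : ∀ i j, |B i j| ≤ b) (hM : ∀ i j, |flMat B k i j| ≤ m)
    (hbW : b ≤ W) (hmW : m ≤ W) (hW1 : n * (b * m) ≤ W) (hW2 : n * (n * (b * m)) ≤ W)
    (hW3 : n * (b * m) + n * (n * (b * m)) ≤ W) :
    Runs β W flBody s (fun s' => s'.var 7 = flCoeff B k ∧ s'.mat n 2 = flMat B (k + 1)) := by
  have hb0 : 0 ≤ b := (abs_nonneg _).trans (hB ⟨k, hk⟩ ⟨k, hk⟩)
  have hm0 : 0 ≤ m := (abs_nonneg _).trans (hM ⟨k, hk⟩ ⟨k, hk⟩)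
  have hnn : ∀ a < n, a ≤ W := fun a ha => by omega
  have h0' : ∀ a < n, ∀ c < n, |s.arr 0 a c| ≤ b := fun a ha c hc => by
    have := hB ⟨a, ha⟩ ⟨c, hc⟩
    rwa [← h0] at this
  have h2' : ∀ a < n, ∀ c < n, |s.arr 2 a c| ≤ m := fun a ha c hc => by
    have := hM ⟨a, ha⟩ ⟨c, hc⟩
    rwa [← h2] at this
  have hprod : ∀ a < n, ∀ c < n, ∀ d < n, |s.arr 0 a c * s.arr 2 c d| ≤ b * m :=
    fun a ha c hc d hd => by
      rw [abs_mul]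
      exact mul_le_mul (h0' a ha c hc) (h2' c hc d hd) (abs_nonneg _) hb0
  have hbm : b * m ≤ W := by
    refine le_trans ?_ hW1
    have : 0 ≤ b * m := by positivity
    have : (1 : ℤ) ≤ n := by omega
    nlinarith
  refine Runs.seq (Runs.pairLoop (c := 5) n hn hβ hW (by decide) (by decide) (by decide) rfl rfl rfl
    (fun a c => ∑ i ∈ Finset.range n, s.arr 0 a i * s.arr 2 i c) ?_ ?_)
  · intro a ha c hc s1 hF1 hi hj
    have e0 := hF1.arr 0 rfl
    have e2 := hF1.arr 2 rfl
    refine Runs.seq (Runs.sumLoop n ((hF1.var 0 rfl).trans hn) hβ hW (by decide) (by decide)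
      (by decide) (fun i => s.arr 0 a i * s.arr 2 i c) ?_ ?_ ?_)
    · intro i hi' v
      simp only [Expr.Bdd, Expr.eval, Store.var_setVar, Store.arr_setVar, hi, hj, e0, e2]
      simpa using ⟨⟨hnn a ha, hnn i hi', (h0' a ha i hi').trans hbW⟩, ⟨hnn i hi', hnn c hc,
        (h2' i hi' c hc).trans hmW⟩, by simpa [abs_mul] using (hprod a ha i hi' c hc).trans hbm⟩
    · intro i hi'
      exact (abs_sum_range_le hi' fun i hi' => hprod a ha i hi' c hc).trans hW1
    · refine Runs.store ?_ ?_ ?_ ?_ 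
      · simpa [Expr.Bdd, hi] using hnn a ha
      · simpa [Expr.Bdd, hj] using hnn c hc
      · simpa [Expr.Bdd] using 
          (abs_sum_range_le le_rfl fun i hi' => hprod a ha i hi' c hc).trans hW1
      · intro a' b'
        simp [Expr.eval, hi, hj]
  intro s1 hF1 h5
  have hP : s1.mat n 5 = B * flMat B k := by
    ext i j
    rw [← h2, ← h0, Matrix.mul_apply, Store.mat, h5, if_pos (by have := i.2; have := j.2; omega)]
    simp [Finset.sum_range, Store.mat]
  have hPb : ∀ a < n, ∀ c < n, |s1.arr 5 a c| ≤ n * (b * m) := fun a ha c hc => by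
    have := abs_mul_apply_le hB hM ⟨a, ha⟩ ⟨c, hc⟩
    rwa [← hP] at this
  have htr : ∑ i ∈ Finset.range n, s1.arr 5 i i = (B * flMat B k).trace := by
    rw [← hP, Finset.sum_range]
    rfl
  have htrb : |(B * flMat B k).trace| ≤ W := (abs_trace_le (abs_mul_apply_le hB hM)).trans hW2
  refine Runs.seq (Runs.sumLoop n ((hF1.var 0 rfl).trans hn) hβ hW (by decide) (by decide)
      (by decide) (fun i => s1.arr 5 i i) ?_ ?_ ?_)
  · intro i hi' v
    simpa [Expr.Bdd, Expr.eval] using ⟨hnn i hi', (hPb i hi' i hi').trans hW1⟩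
  · intro i hi'
    exact (abs_sum_range_le hi' fun i hi' => hPb i hi' i hi').trans hW2
  rw [htr]
  refine Runs.seq (Runs.assign ?_ ?_)
  · have : |(k : ℤ) + 1| ≤ W := by rw [abs_of_nonneg (by omega)]; omega
    simp only [Expr.Bdd, Expr.eval, Store.var_setVar, hF1.var 8 rfl, h8]
    norm_num
    exact ⟨htrb, hnn k hk, by omega, this⟩
  set c := flCoeff B k with hc
  have hcb : |c| ≤ n * (n * (b * m)) := abs_flCoeff_le hB hM
  set s2 := ((s1.setVar 6 (B * flMat B k).trace).setVar 5 n).setVar 7 c with hs2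
  have : (((s1.setVar 6 (B * flMat B k).trace).setVar 5 n).setVar 7
      (((Expr.const 0).sub (Expr.var 6)).div ((Expr.var 8).add (Expr.const 1)) |>.eval
      ((s1.setVar 6 (B * flMat B k).trace).setVar 5 n))) = s2 := by
    rw [hs2, hc, flCoeff]
    simp [Expr.eval, hF1.var 8 rfl, h8]
  rw [this]
  have h20 : s2.var 0 = n := by simp [hs2, hF1.var 0 rfl, hn]
  refine Runs.seq (Runs.pairLoop (c := 2) n h20 hβ hW (by decide) (by decide) (by decide) rfl rfl
    rfl (fun a c => s1.arr 5 a c) ?_ ?_)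
  · intro a ha d hd s3 hF3 hi hj
    have e5 : s3.arr 5 = s1.arr 5 := hF3.arr 5 rfl
    refine Runs.store ?_ ?_ ?_ ?_ 
    · simpa [Expr.Bdd, hi] using hnn a ha
    · simpa [Expr.Bdd, hj] using hnn d hd
    · simpa [Expr.Bdd, Expr.eval, hi, hj, e5] using
        ⟨hnn a ha, hnn d hd, (hPb a ha d hd).trans hW1⟩
    · intro a' b'
      simp [Expr.eval, hi, hj, e5]
  intro s3 hF3 h2
  have h3 : ∀ a < n, ∀ d < n, s3.arr 2 a d = s1.arr 5 a d := fun a ha d hd => by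
    rw [h2, if_pos (by omega)]
    simp
  have h37 : s3.var 7 = c := by simp [hF3.var 7 rfl, hs2]
  refine Runs.forLoop n ((hF3.var 0 rfl).trans h20) hβ hW (by decide) rfl rfl
    (fun l s' => ∀ i j : Fin n, s'.arr 2 i j =
      (B * flMat B k) i j + if (i : ℕ) < l ∧ i = j then c else 0) ?_ ?_ ?_
  · intro i j
    simp [h3 i i.2 j j.2, ← hP, Store.mat]
  · intro a ha s4 hF4 hi hI
    have hd := hI ⟨a, ha⟩ ⟨a, ha⟩
    simp only [lt_irrefl, false_and, if_false, add_zero] at hd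
    have h47 : s4.var 7 = c := (hF4.var 7 rfl).trans h37
    have hPa : |(B * flMat B k) ⟨a, ha⟩ ⟨a, ha⟩| ≤ n * (b * m) := abs_mul_apply_le hB hM _ _
    refine Runs.store ?_ ?_ ?_ ?_
    · simpa [Expr.Bdd, hi] using hnn a ha
    · simpa [Expr.Bdd, hi] using hnn a ha
    · simp only [Expr.Bdd, Expr.eval, hi, hd, h47]
      refine ⟨⟨?_, ?_, hPa.trans hW1⟩, hcb.trans hW2, (abs_add_le _ _).trans
        ((add_le_add hPa hcb).trans hW3)⟩ <;> simpa using hnn a ha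
    · intro i j
      simp only [Expr.eval, Store.arr_setVar, Store.arr_setArr, hi, hd, h47, hI]
      by_cases hia : (i : ℕ) = a
      · obtain rfl : i = ⟨a, ha⟩ := Fin.ext hia
        by_cases hij : (⟨a, ha⟩ : Fin n) = j
        · subst hij
          simp
        · have : (j : ℕ) ≠ a := fun h => hij (Fin.ext h.symm)
          simp [hij, this]
      · have : ((i : ℕ) < a + 1) = ((i : ℕ) < a) := propext ⟨fun _ => by omega, fun _ => by omega⟩
        simp [hia, this]
  · intro s4 hF4 hi hI
    refine ⟨(hF4.var 7 rfl).trans h37, ?_⟩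
    ext i j
    rw [flMat, Matrix.add_apply, Matrix.smul_apply, Matrix.one_apply, Store.mat, hI]
    simp [hc]

theorem runs_flProg {β W n : ℕ} [NeZero n] {s : Store} {B : Matrix (Fin n) (Fin n) ℤ} {b : ℤ}
    (hβ : n ≤ β) (hn : s.var 0 = n) (h0 : s.mat n 0 = B) (h2 : s.arr 2 = 0)
    (hb : 1 ≤ b) (hB : ∀ i j, |B i j| ≤ b) (hW : (2 * n ^ 2 * b) ^ (n + 1) ≤ W) :
    Runs β W flProg s (fun s' => s'.var 7 = flCoeff B (n - 1)) := by
  have hn1 : 1 ≤ n := NeZero.one_le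
  have hn2 : (n : ℤ) ≤ n ^ 2 := by exact_mod_cast Nat.le_self_pow (by norm_num) n
  have hx : (1 : ℤ) ≤ 2 * n ^ 2 * b := by nlinarith
  have hxW : 2 * n ^ 2 * b ≤ (W : ℤ) := (le_self_pow₀ hx (by omega)).trans hW
  have hnW : n < W := by
    have : (n : ℤ) < W := by nlinarith
    exact_mod_cast this
  refine Runs.seq (Runs.forLoop n hn hβ hnW (by decide) rfl rfl
    (fun k s' => ∀ i j : Fin n, s'.arr 2 i j = if (i : ℕ) < k ∧ i = j then 1 else 0) ?_ ?_ ?_)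
  · intro i j
    simp [h2]
  · intro a ha s4 hF4 hi hI
    refine Runs.store ?_ ?_ ?_ ?_
    · simpa [Expr.Bdd, hi] using by omega
    · simpa [Expr.Bdd, hi] using by omega
    · simp only [Expr.Bdd, abs_one]
      exact_mod_cast (by omega : 1 ≤ W)
    · intro i j
      simp only [Expr.eval, Store.arr_setVar, Store.arr_setArr, hi, hI]
      by_cases hia : (i : ℕ) = a
      · obtain rfl : i = ⟨a, ha⟩ := Fin.ext hia
        by_cases hij : (⟨a, ha⟩ : Fin n) = j
        · subst hij
          simp
        · have : (j : ℕ) ≠ a := fun h => hij (Fin.ext h.symm)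
          simp [hij, this]
      · have : ((i : ℕ) < a + 1) = ((i : ℕ) < a) := propext ⟨fun _ => by omega, fun _ => by omega⟩
        simp [hia, this]
  intro s1 hF1 _ hI
  have hM : s1.mat n 2 = flMat B 0 := by
    ext i j
    simp [flMat, Store.mat, hI, Matrix.one_apply]
  -- After k rounds variable 7 holds the coefficient with index k - 1; none has been computed before
  -- the first round, hence the guard 0 < k.
  refine Runs.forLoop n ((hF1.var 0 rfl).trans hn) hβ hnW (by decide) rfl rfl
    (fun k s' => s'.mat n 2 = flMat B k ∧ (0 < k → s'.var 7 = flCoeff B (k - 1))) ⟨hM, by simp⟩ ?_ ?_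
  · rintro k hk s2 hF2 h8 ⟨hM, -⟩
    have hpow : (2 * n ^ 2 * b) * (2 * n ^ 2 * b) ^ k ≤ (W : ℤ) := by
      rw [← pow_succ']
      exact (pow_le_pow_right₀ hx (by omega)).trans hW
    have hm1 : (1 : ℤ) ≤ (2 * n ^ 2 * b) ^ k := one_le_pow₀ hx
    have hbm : 0 ≤ b * (2 * n ^ 2 * b) ^ k := by positivity
    have hle : (n : ℤ) * (b * (2 * n ^ 2 * b) ^ k) ≤ n * (n * (b * (2 * n ^ 2 * b) ^ k)) := by
      rw [← mul_assoc (n : ℤ) n, ← pow_two]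
      exact mul_le_mul_of_nonneg_right hn2 hbm
    have heq : (2 * n ^ 2 * b) * (2 * (n : ℤ) ^ 2 * b) ^ k =
      2 * (n * (n * (b * (2 * n ^ 2 * b) ^ k))) := by ring
    refine (runs_flBody hβ hnW ((hF2.var 0 rfl).trans ((hF1.var 0 rfl).trans hn)) hk h8
      ((hF2.mat rfl n).trans ((hF1.mat rfl n).trans h0)) hM hB (abs_flMat_le hB k) ?_ ?_ ?_ ?_ ?_).mono
      ?_
    · nlinarith
    · nlinarith
    · nlinarith
    · nlinarith
    · nlinarith
    · rintro s3 ⟨h7, h2⟩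
      exact ⟨h2, fun _ => by simpa using h7⟩
  · rintro s2 hF2 - ⟨-, h⟩
    exact h (by omega)

end SysNF


-- The Faddeev–LeVerrier recursion yields the characteristic polynomial

namespace SysNF

open LogRAM Polynomial

section charpoly

variable {n : ℕ} (B : Matrix (Fin n) (Fin n) ℤ)

/-- This is the product rule applied to every term of the Leibniz formula. -/
theorem derivative_det {m R : Type*} [Fintype m] [DecidableEq m] [CommRing R]
    (M : Matrix m m R[X]) :
    derivative M.det = ∑ i, (M.updateRow i fun j => derivative (M i j)).det := by
  simp only [Matrix.det_apply', derivative_sum]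
  rw [Finset.sum_comm]
  refine Finset.sum_congr rfl fun σ _ => ?_
  -- The Leibniz product is indexed by columns while the sum is over the differentiated row;
  -- reindexing by σ matches the two.
  rw [← Equiv.sum_comp σ, derivative_mul, derivative_intCast, zero_mul, zero_add,
    derivative_prod_finset, Finset.mul_sum]
  refine Finset.sum_congr rfl fun i _ => ?_
  rw [← Finset.mul_prod_erase _ _ (Finset.mem_univ i), Matrix.updateRow_self, mul_comm (∏ b ∈ _, _)]
  congr 2
  refine Finset.prod_congr rfl fun j hj => ?_
  rw [Matrix.updateRow_ne (σ.injective.ne (Finset.ne_of_mem_erase hj))]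

/-- Differentiating row i of X - B leaves the i-th unit vector, and the determinant with that row is
the i-th diagonal entry of the adjugate. -/
theorem derivative_charpoly : derivative B.charpoly = B.charmatrix.adjugate.trace := by
  rw [Matrix.charpoly, derivative_det, Matrix.trace]
  refine Finset.sum_congr rfl fun i _ => ?_
  rw [Matrix.diag_apply, Matrix.adjugate_apply]
  congr 2
  ext1 j
  rw [Matrix.charmatrix_apply, derivative_sub, derivative_C, sub_zero, Matrix.diagonal_apply,
    Pi.single_apply]
  simp only [eq_comm (a := j)]
  split_ifs <;> simp

/-- The coefficients of the adjugate of `X - B`. -/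
noncomputable def adjCoeff (k : ℕ) : Matrix (Fin n) (Fin n) ℤ :=
  (matPolyEquiv B.charmatrix.adjugate).coeff k

/-- The identity (X - B) adj(X - B) = χ · 1 is read as one between polynomials with matrix
coefficients. Comparing coefficients gives the recursion that `flMat` follows. -/
theorem X_sub_C_mul_matPolyEquiv_adjugate :
    (X - C B) * matPolyEquiv B.charmatrix.adjugate = matPolyEquiv (B.charpoly • 1) := by
  rw [← Matrix.matPolyEquiv_charmatrix, ← map_mul, Matrix.mul_adjugate, Matrix.charpoly]

theorem adjCoeff_eq (k : ℕ) :
    adjCoeff B k = B * adjCoeff B (k + 1) + B.charpoly.coeff (k + 1) • 1 := by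
  have h := congr_arg (fun p => p.coeff (k + 1)) (X_sub_C_mul_matPolyEquiv_adjugate B)
  simp only [sub_mul, coeff_sub, coeff_X_mul, coeff_C_mul] at h
  rw [adjCoeff, adjCoeff, sub_eq_iff_eq_add'.1 h]
  congr 1
  ext i j
  rw [matPolyEquiv_coeff_apply, Matrix.smul_apply, Matrix.smul_apply, Matrix.one_apply,
    Matrix.one_apply]
  split_ifs <;> simp

theorem zero_eq_mul_adjCoeff_zero :
    0 = B * adjCoeff B 0 + B.charpoly.coeff 0 • 1 := by
  have h := congr_arg (fun p => p.coeff 0) (X_sub_C_mul_matPolyEquiv_adjugate B)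
  simp only [sub_mul, coeff_sub, coeff_X_mul_zero, coeff_C_mul] at h
  rw [adjCoeff, sub_eq_iff_eq_add'.1 h]
  congr 1
  ext i j
  rw [matPolyEquiv_coeff_apply, Matrix.smul_apply, Matrix.smul_apply, Matrix.one_apply,
    Matrix.one_apply]
  split_ifs <;> simp

/-- Comparing coefficients in χ' = tr adj(X - B) supplies the second relation between traces and
coefficients of χ, which makes it possible to solve for the latter. -/
theorem trace_adjCoeff (k : ℕ) :
    (adjCoeff B k).trace = B.charpoly.coeff (k + 1) * (k + 1) := by
  rw [← coeff_derivative, derivative_charpoly, Matrix.trace, Matrix.trace, finsetSum_coeff]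
  refine Finset.sum_congr rfl fun i _ => ?_
  rw [Matrix.diag_apply, Matrix.diag_apply, adjCoeff, matPolyEquiv_coeff_apply]

/-- Multiplication by the monic X - B raises the degree by exactly one, and the product χ · 1 has
degree n. -/
theorem adjCoeff_eq_zero [NeZero n] {k : ℕ} (hk : n ≤ k) : adjCoeff B k = 0 := by
  set N := matPolyEquiv B.charmatrix.adjugate with hN
  suffices h : N.natDegree < n by
    exact coeff_eq_zero_of_natDegree_lt (h.trans_le hk)
  by_contra! hd
  have hN0 : N ≠ 0 := by
    intro h0
    rw [h0, natDegree_zero] at hd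
    exact NeZero.ne n (by omega)
  have hX : (X - C B).Monic := monic_X_sub_C B
  have h1 := hX.natDegree_mul' hN0
  rw [natDegree_X_sub_C] at h1
  have hlc : ((X - C B) * N).coeff (1 + N.natDegree) ≠ 0 := by
    rw [← h1, coeff_natDegree, leadingCoeff_ne_zero]
    intro h0
    rw [h0, natDegree_zero] at h1
    omega
  apply hlc
  rw [hN, X_sub_C_mul_matPolyEquiv_adjugate]
  ext i j
  rw [matPolyEquiv_coeff_apply, Matrix.smul_apply, Matrix.one_apply, ← hN]
  have hc : B.charpoly.coeff (1 + N.natDegree) = 0 := by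
    apply coeff_eq_zero_of_natDegree_lt
    rw [Matrix.charpoly_natDegree_eq_dim, Fintype.card_fin]
    omega
  split_ifs <;> simp [hc]

/-- The recursion runs through the coefficients of the adjugate from the top down. With m + 1 = n -
1 - k, the trace of `adjCoeff_eq` and `trace_adjCoeff` give -tr(B A) = (n - (m + 1)) χₘ₊₁ = (k + 1)
χₘ₊₁, where A is the coefficient of index m + 1. So the division by k + 1 is exact. -/
theorem flMat_eq_adjCoeff [NeZero n] {k : ℕ} (hk : k < n) : 
    flMat B k = adjCoeff B (n - 1 - k) ∧ flCoeff B k = B.charpoly.coeff (n - 1 - k) := by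
  have key : ∀ k < n, flMat B k = adjCoeff B (n - 1 - k) →
      flCoeff B k = B.charpoly.coeff (n - 1 - k) := by
    intro k hk h
    have h0 : 0 - (B * adjCoeff B (n - 1 - k)).trace = B.charpoly.coeff (n - 1 - k) * (k + 1) := by
      rcases Nat.eq_zero_or_pos (n - 1 - k) with h' | h'
      · rw [h']
        have := congr_arg Matrix.trace (zero_eq_mul_adjCoeff_zero B)
        rw [Matrix.trace_add, Matrix.trace_smul, Matrix.trace_one, Matrix.trace_zero, 
          Fintype.card_fin] at this
        have hn : (n : ℤ) = k + 1 := by omega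
        rw [hn, smul_eq_mul] at this
        linarith
      · obtain ⟨m, hm⟩ : ∃ m, n - 1 - k = m + 1 := ⟨n - 1 - k - 1, by omega⟩
        rw [hm]
        have := congr_arg Matrix.trace (adjCoeff_eq B m)
        rw [Matrix.trace_add, Matrix.trace_smul, Matrix.trace_one, trace_adjCoeff, 
          Fintype.card_fin] at this
        have hn : (n : ℤ) = k + 1 + (m + 1) := by omega
        rw [hn, smul_eq_mul] at this
        linarith
    rw [flCoeff, h, h0, Int.mul_ediv_cancel _ (by omega)]
  suffices h : flMat B k = adjCoeff B (n - 1 - k) from ⟨h, key k hk h⟩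
  induction k with
  | zero =>
    have hn := NeZero.pos n
    have h := adjCoeff_eq B (n - 1)
    rw [adjCoeff_eq_zero B (k := n - 1 + 1) (by omega), Nat.sub_add_cancel hn] at h
    have h1 : B.charpoly.coeff n = 1 := by
      have := B.charpoly_monic
      rw [Monic, leadingCoeff, Matrix.charpoly_natDegree_eq_dim, Fintype.card_fin] at this
      exact this
    rw [flMat, Nat.sub_zero, h, h1]
    simp
  | succ k ih =>
    obtain ⟨m, hm⟩ : ∃ m, n - 1 - k = m + 1 := ⟨n - 1 - k - 1, by omega⟩
    have ih' := ih (by omega)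
    rw [flMat, key k (by omega) ih', ih', hm, ← adjCoeff_eq]
    congr 1
    omega

/-- The last coefficient is the constant term of χ, which is the determinant up to sign. -/
theorem abs_flCoeff_pred [NeZero n] : |flCoeff B (n - 1)| = |B.det| := by
  have hn := NeZero.pos n
  rw [(flMat_eq_adjCoeff B (by omega)).2, Nat.sub_self, Matrix.det_eq_sign_charpoly_coeff]
  simp [abs_mul]

end charpoly

end SysNF


namespace SysNF

open LogRAM

/-! ### Triangular bases of integer lattices -/

section triangular

variable {n : ℕ}

/-- The integer lattice generated by the columns of `H`. -/
def colSpan (H : Matrix (Fin n) (Fin n) ℤ) : Submodule ℤ (Fin n → ℤ) :=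
  Submodule.span ℤ (Set.range fun c => H.col c)

/-- The integer lattice generated by the first `k` columns of `H`. -/
def lowSpan (H : Matrix (Fin n) (Fin n) ℤ) (k : ℕ) : Submodule ℤ (Fin n → ℤ) :=
  Submodule.span ℤ ((fun c => H.col c) '' {c | (c : ℕ) < k})

theorem col_mem_colSpan (H : Matrix (Fin n) (Fin n) ℤ) (c : Fin n) : H.col c ∈ colSpan H :=
  Submodule.subset_span ⟨c, rfl⟩

theorem col_mem_lowSpan (H : Matrix (Fin n) (Fin n) ℤ) {c : Fin n} {k : ℕ} (h : (c : ℕ) < k) :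
    H.col c ∈ lowSpan H k :=
  Submodule.subset_span ⟨c, h, rfl⟩

theorem lowSpan_le_colSpan (H : Matrix (Fin n) (Fin n) ℤ) (k : ℕ) : lowSpan H k ≤ colSpan H :=
  Submodule.span_mono (Set.image_subset_range _ _)

theorem lowSpan_congr {H H' : Matrix (Fin n) (Fin n) ℤ} {k : ℕ}
    (h : ∀ c : Fin n, (c : ℕ) < k → H'.col c = H.col c) : lowSpan H' k = lowSpan H k := by
  unfold lowSpan
  congr 1
  exact Set.image_congr fun c hc => h c hc

theorem mem_colSpan_iff {H : Matrix (Fin n) (Fin n) ℤ} {x : Fin n → ℤ} :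
    x ∈ colSpan H ↔ ∃ z, H.mulVec z = x := by
  rw [colSpan, Submodule.mem_span_range_iff_exists_fun]
  refine exists_congr fun z => ?_
  rw [Matrix.mulVec_eq_sum]
  simp [Matrix.col]

/-- If z had a nonzero coordinate from k on, the last such one would give, by triangularity, a
nonzero entry of Hz in its own row. -/
theorem mem_lowSpan_of_mem_colSpan {H : Matrix (Fin n) (Fin n) ℤ}
    (htri : ∀ r c, c < r → H r c = 0) (hpos : ∀ r, 0 < H r r) {x : Fin n → ℤ}
    (hx : x ∈ colSpan H) {k : ℕ} (hk : ∀ r : Fin n, k ≤ r → x r = 0) : x ∈ lowSpan H k := by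
  obtain ⟨z, rfl⟩ := mem_colSpan_iff.1 hx
  have hz : ∀ c : Fin n, k ≤ c → z c = 0 := by
    by_contra! hne
    set S := Finset.univ.filter fun c : Fin n => k ≤ c ∧ z c ≠ 0 with hS
    have hSn : S.Nonempty := by
      obtain ⟨c, hc⟩ := hne
      exact ⟨c, by simpa [hS] using hc⟩
    obtain ⟨c, hc, hmax⟩ := S.exists_max_image id hSn
    have hc' : k ≤ c ∧ z c ≠ 0 := by simpa [hS] using hc
    have h0 := hk c hc'.1
    rw [Matrix.mulVec, dotProduct, Finset.sum_eq_single c] at h0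
    · rcases mul_eq_zero.1 h0 with h | h
      · exact (hpos c).ne' h
      · exact hc'.2 h
    · intro d _ hd
      rcases lt_or_gt_of_ne hd with h | h
      · rw [htri c d h, zero_mul]
      · have : d ∉ S := fun hd' => absurd (hmax d hd') (not_le.2 h)
        have hz : z d = 0 := by
          by_contra hzd
          exact this (by simpa [hS] using ⟨hc'.1.trans h.le, hzd⟩)
        rw [hz, mul_zero]
    · simp
  rw [Matrix.mulVec_eq_sum]
  refine Submodule.sum_mem _ fun c _ => ?_
  by_cases hc : (c : ℕ) < k
  · have := Submodule.smul_mem _ (z c) (col_mem_lowSpan H hc)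
    simpa [Matrix.col] using this
  · simp [hz c (by omega)]

/-- This justifies working modulo D: changing the first k coordinates by multiples of D is a move
within S. -/
theorem smul_mem_of_single_mem {D : ℤ} {S : Submodule ℤ (Fin n → ℤ)} {k : ℕ}
    (hS : ∀ r : Fin n, (r : ℕ) < k → Pi.single r D ∈ S) {w : Fin n → ℤ}
    (hw : ∀ r : Fin n, k ≤ r → w r = 0) : D • w ∈ S := by
  rw [show D • w = ∑ r, w r • Pi.single r D from ?_]
  · refine Submodule.sum_mem _ fun r _ => ?_
    by_cases hr : (r : ℕ) < k
    · exact Submodule.smul_mem _ _ (hS r hr)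
    · simp [hw r (by omega)]
  · ext r
    simp [Finset.sum_apply, Pi.single_apply, mul_comm]

/-- `H` is an upper triangular basis of the lattice `Λ`, with entries between `0` and `D`. -/
structure IsTriBasis (D : ℤ) (Λ : Submodule ℤ (Fin n → ℤ)) (H : Matrix (Fin n) (Fin n) ℤ) :
    Prop where
  tri : ∀ r c, c < r → H r c = 0
  pos : ∀ r, 0 < H r r
  nonneg : ∀ r c, 0 ≤ H r c
  le : ∀ r c, H r c ≤ D
  span : colSpan H = Λ

/-- The state in the course of adding a vector to a triangular basis: the columns of `H` and `v`
generate `Λ`, and the entries of `v` from row `m` on have been eliminated. -/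
structure IsTriExt (D : ℤ) (Λ : Submodule ℤ (Fin n → ℤ)) (m : ℕ) (H : Matrix (Fin n) (Fin n) ℤ)
    (v : Fin n → ℤ) : Prop where
  tri : ∀ r c, c < r → H r c = 0
  pos : ∀ r, 0 < H r r
  nonneg : ∀ r c, 0 ≤ H r c
  le : ∀ r c, H r c ≤ D
  v_nonneg : ∀ r, 0 ≤ v r
  v_le : ∀ r, v r ≤ D
  v_eq_zero : ∀ r : Fin n, m ≤ r → v r = 0
  span : colSpan H ⊔ Submodule.span ℤ {v} = Λ
  low : ∀ k < m, ∀ r : Fin n, (r : ℕ) < k → Pi.single r D ∈ lowSpan H k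

theorem isTriBasis_scalar {D : ℤ} (hD : 0 < D) :
    IsTriBasis D (Submodule.span ℤ (Set.range fun r : Fin n => Pi.single r D))
      (D • (1 : Matrix (Fin n) (Fin n) ℤ)) where
  tri r c h := by simp [Matrix.one_apply_ne h.ne']
  pos r := by simpa
  nonneg r c := by
    rw [Matrix.smul_apply, Matrix.one_apply]
    split_ifs <;> simp [hD.le]
  le r c := by
    rw [Matrix.smul_apply, Matrix.one_apply]
    split_ifs <;> simp [hD.le]
  span := by
    unfold colSpan
    congr 2
    ext c r
    rw [Matrix.col_apply, Matrix.smul_apply, Matrix.one_apply, Pi.single_apply]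
    split_ifs <;> simp

theorem IsTriBasis.low {D : ℤ} {Λ : Submodule ℤ (Fin n → ℤ)} {H : Matrix (Fin n) (Fin n) ℤ}
    (h : IsTriBasis D Λ H) (hD : ∀ r : Fin n, Pi.single r D ∈ Λ) {k : ℕ} {r : Fin n}
    (hr : (r : ℕ) < k) : Pi.single r D ∈ lowSpan H k := by
  refine mem_lowSpan_of_mem_colSpan h.tri h.pos (h.span ▸ hD r) fun r' hr' => ?_
  rw [Pi.single_eq_of_ne]
  rintro rfl
  omega

theorem IsTriBasis.triExt {D : ℤ} {Λ Λ' : Submodule ℤ (Fin n → ℤ)}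
    {H : Matrix (Fin n) (Fin n) ℤ} (h : IsTriBasis D Λ H) (hD : ∀ r : Fin n, Pi.single r D ∈ Λ)
    {v : Fin n → ℤ} (hv : ∀ r, 0 ≤ v r) (hv' : ∀ r, v r ≤ D)
    (hΛ : Λ ⊔ Submodule.span ℤ {v} = Λ') : IsTriExt D Λ' n H v where
  tri := h.tri
  pos := h.pos
  nonneg := h.nonneg
  le := h.le
  v_nonneg := hv
  v_le := hv'
  v_eq_zero r hr := by omega
  span := by rw [h.span, hΛ]
  low _ _ _ hr := h.low hD hr

theorem IsTriExt.triBasis {D : ℤ} {Λ : Submodule ℤ (Fin n → ℤ)} {H : Matrix (Fin n) (Fin n) ℤ}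
    {v : Fin n → ℤ} (h : IsTriExt D Λ 0 H v) : IsTriBasis D Λ H where
  tri := h.tri
  pos := h.pos
  nonneg := h.nonneg
  le := h.le
  span := by
    have hv : v = 0 := funext fun r => h.v_eq_zero r (Nat.zero_le _)
    rw [← h.span, hv, Submodule.span_zero_singleton, sup_bot_eq]

theorem IsTriExt.pred {D : ℤ} {Λ : Submodule ℤ (Fin n → ℤ)} {H : Matrix (Fin n) (Fin n) ℤ}
    {v : Fin n → ℤ} {i : Fin n} (h : IsTriExt D Λ (i + 1) H v) (hi : v i = 0) :
    IsTriExt D Λ i H v where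
  tri := h.tri
  pos := h.pos
  nonneg := h.nonneg
  le := h.le
  v_nonneg := h.v_nonneg
  v_le := h.v_le
  v_eq_zero r hr := by
    rcases eq_or_ne r i with rfl | hne
    · exact hi
    · exact h.v_eq_zero r (by have : (r : ℕ) ≠ i := fun h => hne (Fin.ext h); omega)
  span := h.span
  low k hk := h.low k (by omega)

/-- One step of Euclid's algorithm on the column `i` of `H` and the vector `v`. -/
theorem IsTriExt.step {D : ℤ} {Λ : Submodule ℤ (Fin n → ℤ)} {H H' : Matrix (Fin n) (Fin n) ℤ}
    {v v' : Fin n → ℤ} {i : Fin n} (h : IsTriExt D Λ (i + 1) H v) (hi : 0 < v i)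
    (hH' : ∀ r c, H' r c = if c = i then v r else H r c)
    (hv' : ∀ r, v' r = (H r i - H i i / v i * v r) % D) :
    IsTriExt D Λ (i + 1) H' v' ∧ v' i = H i i % v i := by
  have hD : 0 < D := (h.pos i).trans_le (h.le i i)
  have hmod : H i i - H i i / v i * v i = H i i % v i := by
    rw [Int.emod_def]
    ring
  have hmod0 : 0 ≤ H i i % v i := Int.emod_nonneg _ hi.ne'
  have hmodlt : H i i % v i < D := (Int.emod_lt_of_pos _ hi).trans_le (h.v_le i)
  have hcol : ∀ c, c ≠ i → H'.col c = H.col c := fun c hc => by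
    ext r
    simp [hH', hc]
  have hcoli : H'.col i = v := by
    ext r
    simp [hH']
  have hlow : ∀ k ≤ (i : ℕ), lowSpan H' k = lowSpan H k := fun k hk =>
    lowSpan_congr fun c hc => hcol c (by rintro rfl; omega)
  have hgt : ∀ r, i < r → H r i - H i i / v i * v r = 0 := fun r hr => by
    rw [h.tri r i hr, h.v_eq_zero r (by have : (i : ℕ) < r := hr; omega)]
    simp
  -- The vector w records the multiples of D removed by the reduction. It vanishes from row i on,
  -- because the Euclidean remainder in row i is already below D and the rows below i are zero.
  set w : Fin n → ℤ := fun r => (H r i - H i i / v i * v r) / D with hw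
  have hw0 : ∀ r : Fin n, (i : ℕ) ≤ r → w r = 0 := by
    intro r hr
    rcases eq_or_lt_of_le hr with hr | hr
    · obtain rfl : i = r := Fin.ext hr
      rw [hw]
      simp only
      rw [hmod, Int.ediv_eq_zero_of_lt hmod0 hmodlt]
    · rw [hw]
      simp only
      rw [hgt r hr, Int.zero_ediv]
  have hvw : H.col i = v' + (H i i / v i) • v + D • w := by
    ext r
    have := Int.emod_add_mul_ediv (H r i - H i i / v i * v r) D
    simp only [Matrix.col_apply, Pi.add_apply, Pi.smul_apply, smul_eq_mul, hv', hw]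
    linarith
  -- The correction is generated by the columns before i alone. The step leaves them untouched, so
  -- it lies in the span both before and after.
  have hDw : D • w ∈ lowSpan H i := smul_mem_of_single_mem (h.low i (by omega)) hw0
  refine ⟨⟨?_, ?_, ?_, ?_, ?_, ?_, ?_, ?_, ?_⟩, ?_⟩
  · intro r c hrc
    rw [hH']
    split_ifs with hc
    · subst hc
      exact h.v_eq_zero r (by have : (c : ℕ) < r := hrc; omega)
    · exact h.tri r c hrc
  · intro r
    rw [hH']
    split_ifs with hc
    · rwa [hc]
    · exact h.pos r
  · intro r c
    rw [hH']
    split_ifs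
    · exact h.v_nonneg r
    · exact h.nonneg r c
  · intro r c
    rw [hH']
    split_ifs
    · exact h.v_le r
    · exact h.le r c
  · intro r
    rw [hv']
    exact Int.emod_nonneg _ hD.ne'
  · intro r
    rw [hv']
    exact (Int.emod_lt_of_pos _ hD).le
  · intro r hr
    rw [hv', hgt r (by have : (i : ℕ) < r := hr; exact this), Int.zero_emod]
  · rw [← h.span]
    apply le_antisymm
    · refine sup_le (Submodule.span_le.2 ?_) (Submodule.span_le.2 ?_)
      · rintro _ ⟨c, rfl⟩
        by_cases hc : c = i
        · subst hc
          simp only [hcoli]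
          exact Submodule.mem_sup_right (Submodule.mem_span_singleton_self v)
        · simp only [hcol c hc]
          exact Submodule.mem_sup_left (col_mem_colSpan H c)
      · rw [Set.singleton_subset_iff]
        have : v' = H.col i - (H i i / v i) • v - D • w := by rw [hvw]; abel
        rw [this]
        refine Submodule.sub_mem _ (Submodule.sub_mem _ ?_ (Submodule.smul_mem _ _ ?_)) ?_
        · exact Submodule.mem_sup_left (col_mem_colSpan H i)
        · exact Submodule.mem_sup_right (Submodule.mem_span_singleton_self v)
        · exact Submodule.mem_sup_left (lowSpan_le_colSpan _ _ hDw)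
    · have hv : v ∈ colSpan H' := hcoli ▸ col_mem_colSpan H' i
      refine sup_le (Submodule.span_le.2 ?_) (Submodule.span_le.2 ?_)
      · rintro _ ⟨c, rfl⟩
        by_cases hc : c = i
        · subst hc
          simp only [hvw]
          refine Submodule.add_mem _ (Submodule.add_mem _ ?_ (Submodule.smul_mem _ _ ?_)) ?_
          · exact Submodule.mem_sup_right (Submodule.mem_span_singleton_self v')
          · exact Submodule.mem_sup_left hv
          · rw [← hlow _ le_rfl] at hDw
            exact Submodule.mem_sup_left (lowSpan_le_colSpan _ _ hDw)
        · simp only [← hcol c hc]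
          exact Submodule.mem_sup_left (col_mem_colSpan H' c)
      · rw [Set.singleton_subset_iff]
        exact Submodule.mem_sup_left hv
  · intro k hk r hr
    rw [hlow k (by omega)]
    exact h.low k hk r hr
  · rw [hv', hmod, Int.emod_eq_of_lt hmod0 hmodlt]

/-- Reduction of the entry `(i, j)` of a triangular basis. -/
theorem IsTriBasis.reduce {D : ℤ} {Λ : Submodule ℤ (Fin n → ℤ)} {H H' : Matrix (Fin n) (Fin n) ℤ}
    (h : IsTriBasis D Λ H) (hD : ∀ r : Fin n, Pi.single r D ∈ Λ) {i j : Fin n} (hij : i < j)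
    (hH' : ∀ r c, H' r c =
      if c = j ∧ r ≤ i then (H r j - H i j / H i i * H r i) % D else H r c) :
    IsTriBasis D Λ H' ∧ H' i j < H i i := by
  have hi := h.pos i
  have hD0 : 0 < D := hi.trans_le (h.le i i)
  have hmod : H i j - H i j / H i i * H i i = H i j % H i i := by
    rw [Int.emod_def]
    ring
  have hmod0 : 0 ≤ H i j % H i i := Int.emod_nonneg _ hi.ne'
  have hmodlt : H i j % H i i < H i i := Int.emod_lt_of_pos _ hi
  have hcol : ∀ c, c ≠ j → H'.col c = H.col c := fun c hc => by
    ext r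
    simp [hH', hc]
  have hlow : lowSpan H' j = lowSpan H j :=
    lowSpan_congr fun c hc => hcol c (by rintro rfl; omega)
  -- As in Euclid's step, row i needs no reduction modulo D, so only rows above i are corrected, by
  -- a vector in the span of columns before j.
  set w : Fin n → ℤ := fun r =>
    if r ≤ i then (H r j - H i j / H i i * H r i) / D else 0 with hw
  have hw0 : ∀ r : Fin n, (i : ℕ) ≤ r → w r = 0 := by
    intro r hr
    rcases eq_or_lt_of_le hr with hr | hr
    · obtain rfl : i = r := Fin.ext hr
      simp only [hw, le_refl, if_true]
      rw [hmod, Int.ediv_eq_zero_of_lt hmod0 (hmodlt.trans_le (h.le i i))]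
    · exact if_neg (not_le.2 hr)
  have hij' : (i : ℕ) < j := hij
  have hvw : H.col j = H'.col j + ((H i j / H i i) • H.col i + D • w) := by
    ext r
    simp only [Matrix.col_apply, Pi.add_apply, Pi.smul_apply, smul_eq_mul, hH', hw, true_and]
    split_ifs with hr
    · have := Int.emod_add_mul_ediv (H r j - H i j / H i i * H r i) D
      linarith
    · rw [h.tri r i (not_le.1 hr)]
      ring
  have hy : (H i j / H i i) • H.col i + D • w ∈ lowSpan H j := by
    refine Submodule.add_mem _ (Submodule.smul_mem _ _ (col_mem_lowSpan H hij)) ?_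
    refine smul_mem_of_single_mem (k := i) (fun r hr => h.low hD (by omega)) hw0
  refine ⟨⟨?_, ?_, ?_, ?_, ?_⟩, ?_⟩
  · intro r c hrc
    rw [hH', if_neg, h.tri r c hrc]
    rintro ⟨rfl, hr⟩
    exact absurd (hrc.trans_le hr) hij.not_gt
  · intro r
    rw [hH', if_neg]
    · exact h.pos r
    · rintro ⟨rfl, hr⟩
      exact absurd hr (not_le.2 hij)
  · intro r c
    rw [hH']
    split_ifs
    · exact Int.emod_nonneg _ hD0.ne'
    · exact h.nonneg r c
  · intro r c
    rw [hH']
    split_ifs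
    · exact (Int.emod_lt_of_pos _ hD0).le
    · exact h.le r c
  · rw [← h.span]
    apply le_antisymm <;> refine Submodule.span_le.2 ?_
    · rintro _ ⟨c, rfl⟩
      by_cases hc : c = j
      · subst hc
        simp only
        rw [← sub_eq_iff_eq_add.2 hvw]
        exact Submodule.sub_mem _ (col_mem_colSpan _ _) (lowSpan_le_colSpan _ _ hy)
      · simp only [hcol c hc]
        exact col_mem_colSpan H c
    · rintro _ ⟨c, rfl⟩
      by_cases hc : c = j
      · subst hc
        simp only
        rw [hvw]
        exact Submodule.add_mem _ (col_mem_colSpan _ _) (lowSpan_le_colSpan _ _ (hlow ▸ hy))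
      · simp only [← hcol c hc]
        exact col_mem_colSpan H' c
  · rw [hH', if_pos ⟨rfl, le_rfl⟩, hmod, Int.emod_eq_of_lt hmod0 (hmodlt.trans_le (h.le i i))]
    exact hmodlt

end triangular

end SysNF


namespace LogRAM

/-- The vector of length `n` stored in the column `0` of the array `a`. -/
def Store.vec (s : Store) (n a : ℕ) : Fin n → ℤ := fun i => s.arr a (i : ℕ) 0

theorem Frame.vec {p : Program} {s s' : Store} (h : Frame p s s') {a : ℕ}
    (ha : p.writesArr a = false) (n : ℕ) : s'.vec n a = s.vec n a := by
  unfold Store.vec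
  rw [h.arr a ha]

end LogRAM

namespace SysNF

open LogRAM

/-! ### Computing a triangular basis -/

/-- One step of Euclid's algorithm on a column of the basis and the new vector. -/
def euclidBody : Program :=
  .seq (.assign 11 (.div (.get 3 (.var 10) (.var 10)) (.get 4 (.var 10) (.const 0))))
    (forLoop 3 0
      (.seq (.assign 12 (.mod (.sub (.get 3 (.var 3) (.var 10))
          (.mul (.var 11) (.get 4 (.var 3) (.const 0)))) (.var 7)))
        (.seq (.store 3 (.var 3) (.var 10) (.get 4 (.var 3) (.const 0)))
          (.store 4 (.var 3) (.const 0) (.var 12)))))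

/-- Elimination of one entry of the new vector. -/
def eliminateBody : Program :=
  .seq (.assign 10 (.sub (.sub (.var 0) (.const 1)) (.var 9)))
    (.loop (.get 4 (.var 10) (.const 0)) euclidBody)

/-- Adding one column of the input to the triangular basis. -/
def addColBody : Program :=
  .seq (forLoop 3 0 (.store 4 (.var 3) (.const 0) (.mod (.get 0 (.var 3) (.var 8)) (.var 7))))
    (forLoop 9 0 eliminateBody)

/-- Computation of a triangular basis. -/
def triProg : Program :=
  .seq (forLoop 3 0 (.store 3 (.var 3) (.var 3) (.var 7))) (forLoop 8 0 addColBody)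

section

variable {β W n : ℕ} {s : Store} {D : ℤ} {Λ : Submodule ℤ (Fin n → ℤ)}

/-- Entries and quotient all lie between 0 and D, so the largest intermediate value is at most D +
D² ≤ 2D² in absolute value; this is the origin of the bound on W. -/
theorem runs_euclidBody {H : Matrix (Fin n) (Fin n) ℤ} {v : Fin n → ℤ} {i : Fin n}
    (hβ : n ≤ β) (hW : n < W) (hDW : 2 * D ^ 2 ≤ W) (hn : s.var 0 = n) (h7 : s.var 7 = D)
    (h10 : s.var 10 = (i : ℕ)) (h3 : s.mat n 3 = H) (h4 : s.vec n 4 = v)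
    (h : IsTriExt D Λ (i + 1) H v) (hi : 0 < v i) :
    Runs β W euclidBody s (fun s' => IsTriExt D Λ (i + 1) (s'.mat n 3) (s'.vec n 4) ∧
      s'.mat n 3 i i = v i ∧ s'.vec n 4 i = H i i % v i) := by
  have hD : 0 < D := (h.pos i).trans_le (h.le i i)
  have hD2 : D ≤ W := by nlinarith
  have hnn : ∀ a < n, a ≤ W := fun a ha => by omega
  have h3' : ∀ r c : Fin n, s.arr 3 (r : ℕ) (c : ℕ) = H r c := fun r c => by rw [← h3]; rfl
  have h4' : ∀ r : Fin n, s.arr 4 (r : ℕ) 0 = v r := fun r => by rw [← h4]; rfl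
  have hHb : ∀ r c, |H r c| ≤ D := fun r c => by
    rw [abs_of_nonneg (h.nonneg r c)]
    exact h.le r c
  have hvb : ∀ r, |v r| ≤ D := fun r => by
    rw [abs_of_nonneg (h.v_nonneg r)]
    exact h.v_le r
  refine Runs.seq (Runs.assign ?_ ?_)
  · simpa [Expr.Bdd, Expr.eval, h10, h3', h4'] using
      ⟨⟨hnn i i.2, (hHb i i).trans hD2⟩, hnn i i.2, (hvb i).trans hD2⟩
  set q := H i i / v i with hq
  have hq0 : 0 ≤ q := Int.ediv_nonneg (h.nonneg i i) hi.le
  have hqD : q ≤ D := (Int.ediv_le_self _ (h.nonneg i i)).trans (h.le i i)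
  have hs1 : s.setVar 11 (((Expr.get 3 (.var 10) (.var 10)).div
    (.get 4 (.var 10) (.const 0))).eval s) = s.setVar 11 q := by
    simp [Expr.eval, h10, h3', h4', hq]
  rw [hs1]
  set v' : Fin n → ℤ := fun r => (H r i - q * v r) % D with hv'
  have hv'b : ∀ r, |v' r| ≤ W := fun r => by
    simp only [hv']
    rw [abs_of_nonneg (Int.emod_nonneg _ hD.ne')]
    exact (Int.emod_lt_of_pos _ hD).le.trans hD2
  refine Runs.forLoop n (by simpa using hn) hβ hW (by decide) rfl rfl
    (fun k s' => (∀ r c : Fin n, s'.arr 3 (r : ℕ) (c : ℕ) =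
        if (r : ℕ) < k ∧ c = i then v r else H r c) ∧
      ∀ r : Fin n, s'.arr 4 (r : ℕ) 0 = if (r : ℕ) < k then v' r else v r) ?_ ?_ ?_
  · simp [h3', h4']
  · rintro k hk s1 hF hk3 ⟨hI3, hI4⟩
    have e7 : s1.var 7 = D := by simp [hF.var 7 rfl, h7]
    have e10 : s1.var 10 = (i : ℕ) := by simp [hF.var 10 rfl, h10]
    have e11 : s1.var 11 = q := by simp [hF.var 11 rfl]
    have ek3 : s1.arr 3 k (i : ℕ) = H ⟨k, hk⟩ i := by simpa using hI3 ⟨k, hk⟩ i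
    have ek4 : s1.arr 4 k 0 = v ⟨k, hk⟩ := by simpa using hI4 ⟨k, hk⟩
    have hqv : |q * v ⟨k, hk⟩| ≤ D * D := by
      rw [abs_mul, abs_of_nonneg hq0]
      exact mul_le_mul hqD (hvb _) (abs_nonneg _) hD.le
    refine Runs.seq (Runs.assign ?_ ?_)
    · simp only [Expr.Bdd, Expr.eval, hk3, e7, e10, e11, ek3, ek4]
      refine ⟨⟨⟨?_, ?_, (hHb _ _).trans hD2⟩, ⟨?_, ⟨?_, ?_, (hvb _).trans hD2⟩, ?_⟩, ?_⟩, ?_⟩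
      · simpa using hnn k hk
      · simpa using hnn i i.2
      · rw [abs_of_nonneg hq0]
        omega
      · simpa using hnn k hk
      · simp
      · nlinarith
      · refine (abs_sub _ _).trans ?_
        have := hHb ⟨k, hk⟩ i
        nlinarith
      · rwa [abs_of_pos hD]
    have hs2 : ((Expr.sub (.get 3 (.var 3) (.var 10))
          (.mul (.var 11) (.get 4 (.var 3) (.const 0)))).mod (.var 7)).eval s1 = v' ⟨k, hk⟩ := by
      simp only [Expr.eval, hk3, e7, e10, e11, ek3, ek4, hv']
    rw [hs2]
    refine Runs.seq (Runs.store ?_ ?_ ?_ ?_)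
    · simpa [Expr.Bdd, hk3] using hnn k hk
    · simpa [Expr.Bdd, e10] using hnn i i.2
    · simpa [Expr.Bdd, Expr.eval, hk3, ek4] using ⟨hnn k hk, (hvb _).trans hD2⟩
    refine Runs.store ?_ ?_ ?_ ⟨?_, ?_⟩
    · simpa [Expr.Bdd, hk3] using hnn k hk
    · simp [Expr.Bdd]
    · simpa [Expr.Bdd] using hv'b _
    · intro r c
      simp only [Expr.eval, Store.arr_setVar, Store.arr_setArr, Store.var_setVar, hk3, e10, hI3]
      norm_num
      rw [ek4]
      by_cases hr : (r : ℕ) = k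
      · obtain rfl : r = ⟨k, hk⟩ := Fin.ext hr
        by_cases hc : c = i
        · simp [hc]
        · have : (c : ℕ) ≠ i := fun h => hc (Fin.ext h)
          simp [hc, this]
      · have : ((r : ℕ) ≤ k) = ((r : ℕ) < k) := propext ⟨fun _ => by omega, fun _ => by omega⟩
        simp [hr, this]
    · intro r
      simp only [Expr.eval, Store.arr_setVar, Store.arr_setArr, Store.var_setVar,
        Store.var_setArr, hk3, hI4]
      norm_num
      by_cases hr : (r : ℕ) = k
      · obtain rfl : r = ⟨k, hk⟩ := Fin.ext hr
        simp
      · have : ((r : ℕ) ≤ k) = ((r : ℕ) < k) := propext ⟨fun _ => by omega, fun _ => by omega⟩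
        simp [hr, this]
  · rintro s1 hF - ⟨hI3, hI4⟩
    have hH' : ∀ r c, s1.mat n 3 r c = if c = i then v r else H r c := fun r c => by
      rw [Store.mat, hI3]
      simp
    have hv4 : ∀ r, s1.vec n 4 r = (H r i - H i i / v i * v r) % D := fun r => by
      rw [Store.vec, hI4]
      simp [hv', hq]
    obtain ⟨h1, h2⟩ := h.step hi hH' hv4
    exact ⟨h1, by simp [hH'], h2⟩

/-- Euclid's algorithm takes (a, b) to (b, a mod b). If b < a, then b + a mod b ≤ a, and the product
of the pair is at least halved. If b ≥ a, the first round may not decrease the product, so the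
potential counts it twice in that case; afterwards b < a always holds. The number of rounds is thus
logarithmic in 2D². -/
theorem runs_eliminateBody {H : Matrix (Fin n) (Fin n) ℤ} {v : Fin n → ℤ} {i : Fin n} {L : ℕ}
    (hβ : n ≤ β) (hL : L ≤ β) (hW : n < W) (hDW : 2 * D ^ 2 ≤ W) (hDL : 2 * D ^ 2 < 2 ^ L)
    (hn : s.var 0 = n)
    (h7 : s.var 7 = D) (h9 : s.var 9 = (n - 1 - i : ℕ)) (h3 : s.mat n 3 = H) (h4 : s.vec n 4 = v)
    (h : IsTriExt D Λ (i + 1) H v) :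
    Runs β W eliminateBody s (fun s' => IsTriExt D Λ i (s'.mat n 3) (s'.vec n 4)) := by
  have hi := i.2
  have hD : 0 < D := (h.pos i).trans_le (h.le i i)
  have hD2 : D ≤ W := by nlinarith
  refine Runs.seq (Runs.assign ?_ ?_)
  · simp only [Expr.Bdd, Expr.eval, hn, h9]
    refine ⟨⟨?_, ?_, ?_⟩, ?_, ?_⟩ <;> rw [abs_le] <;> constructor <;> omega
  have hs1 : s.setVar 10 (((Expr.sub (.var 0) (.const 1)).sub (.var 9)).eval s) =
      s.setVar 10 (i : ℕ) := by
    simp only [Expr.eval, hn, h9]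
    congr 1
    omega
  rw [hs1]
  refine Runs.loop (fun m s' => s'.var 0 = n ∧ s'.var 7 = D ∧ s'.var 10 = (i : ℕ) ∧
    IsTriExt D Λ (i + 1) (s'.mat n 3) (s'.vec n 4) ∧
    (s'.vec n 4 i < s'.mat n 3 i i → s'.mat n 3 i i * s'.vec n 4 i < 2 ^ m) ∧
    (s'.mat n 3 i i ≤ s'.vec n 4 i → 2 * (s'.mat n 3 i i * s'.vec n 4 i) < 2 ^ m)) hL ?_ ?_ ?_ ?_
  · have e3 : (s.setVar 10 (i : ℕ)).mat n 3 = H := h3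
    have e4 : (s.setVar 10 (i : ℕ)).vec n 4 = v := h4
    rw [e3, e4]
    have hb : H i i * v i ≤ D * D := mul_le_mul (h.le i i) (h.v_le i) (h.v_nonneg i) hD.le
    have hb0 : 0 ≤ H i i * v i := mul_nonneg (h.nonneg i i) (h.v_nonneg i)
    refine ⟨by simpa using hn, by simpa using h7, by simp, h, fun _ => ?_, fun _ => ?_⟩ <;>
      nlinarith
  · rintro m s1 ⟨-, -, e10, h', -⟩
    have hv : |s1.arr 4 (i : ℕ) 0| ≤ W := by
      have : s1.arr 4 (i : ℕ) 0 = s1.vec n 4 i := rfl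
      rw [this, abs_of_nonneg (h'.v_nonneg i)]
      exact (h'.v_le i).trans hD2
    simpa [Expr.Bdd, Expr.eval, e10] using ⟨by omega, hv⟩
  · rintro m s1 ⟨e0, e7, e10, h', hlt, hge⟩ hpos
    have hvi : 0 < s1.vec n 4 i := by simpa [Expr.eval, e10, Store.vec] using hpos
    have hHi := h'.pos i
    have hm : m ≠ 0 := by
      rintro rfl
      have : 0 < s1.mat n 3 i i * s1.vec n 4 i := mul_pos hHi hvi
      rcases lt_or_ge (s1.vec n 4 i) (s1.mat n 3 i i) with hc | hc
      · have := hlt hc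
        omega
      · have := hge hc
        omega
    obtain ⟨m, rfl⟩ := Nat.exists_eq_succ_of_ne_zero hm
    refine ⟨m, rfl, (runs_euclidBody hβ hW hDW e0 e7 e10 rfl rfl h' hvi).frame.mono ?_⟩
    rintro s2 ⟨⟨h2, e3, e4⟩, hF⟩
    refine ⟨(hF.var 0 rfl).trans e0, (hF.var 7 rfl).trans e7, (hF.var 10 rfl).trans e10, h2, ?_⟩
    rw [e3, e4]
    generalize s1.mat n 3 i i = a at *
    generalize s1.vec n 4 i = b at *
    have hr := Int.emod_lt_of_pos a hvi
    have hr0 := Int.emod_nonneg a hvi.ne'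
    -- The remainder is smaller than the divisor, so after a round only the first case of the
    -- potential can occur.
    refine ⟨fun _ => ?_, fun hle => absurd hr (not_lt.2 hle)⟩
    have hp : (2 : ℤ) ^ (m + 1) = 2 * 2 ^ m := by ring
    rw [Nat.succ_eq_add_one, hp] at hlt hge
    rcases lt_or_ge b a with hc | hc
    · have h1 := hlt hc
      have h2 : b + a % b ≤ a := by
        have h3 := Int.emod_add_mul_ediv a b
        have h4 : 1 ≤ a / b := Int.le_ediv_of_mul_le hvi (by omega)
        nlinarith
      nlinarith
    · have h1 := hge hc
      have h2 : a % b ≤ a := by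
        have h3 := Int.emod_add_mul_ediv a b
        have h4 := mul_nonneg hvi.le (Int.ediv_nonneg hHi.le hvi.le)
        linarith
      nlinarith
  · rintro m s1 ⟨-, -, e10, h', -⟩ hneg
    have : ¬ 0 < s1.vec n 4 i := by simpa [Expr.eval, e10, Store.vec] using hneg
    exact h'.pred (le_antisymm (not_lt.1 this) (h'.v_nonneg i))

theorem runs_addColBody {B H : Matrix (Fin n) (Fin n) ℤ} {j : Fin n} {L : ℕ}
    (hβ : n ≤ β) (hL : L ≤ β) (hW : n < W) (hDW : 2 * D ^ 2 ≤ W) (hDL : 2 * D ^ 2 < 2 ^ L)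
    (hBW : ∀ r c, |B r c| ≤ W) (hn : s.var 0 = n) (h7 : s.var 7 = D) (h8 : s.var 8 = (j : ℕ))
    (h0 : s.mat n 0 = B) (h3 : s.mat n 3 = H) (h : IsTriBasis D Λ H)
    (hD : ∀ r : Fin n, Pi.single r D ∈ Λ) :
    Runs β W addColBody s (fun s' =>
      IsTriBasis D (Λ ⊔ Submodule.span ℤ {B.col j}) (s'.mat n 3)) := by
  have hD0 : 0 < D := (h.pos j).trans_le (h.le j j)
  have hD2 : D ≤ W := by nlinarith
  have hj := j.2
  set v : Fin n → ℤ := fun r => B r j % D with hv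
  have h0' : ∀ r c : Fin n, s.arr 0 (r : ℕ) (c : ℕ) = B r c := fun r c => by rw [← h0]; rfl
  refine Runs.seq (Runs.forLoop n hn hβ hW (by decide) rfl rfl
    (fun k s' => ∀ r : Fin n, (r : ℕ) < k → s'.arr 4 (r : ℕ) 0 = v r) ?_ ?_ ?_)
  · simp
  · intro k hk s1 hF hk3 hI
    have e0 : s1.arr 0 k (j : ℕ) = B ⟨k, hk⟩ j := by
      rw [hF.arr 0 rfl, ← h0']
    have e7 := (hF.var 7 rfl).trans h7
    have e8 := (hF.var 8 rfl).trans h8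
    refine Runs.store ?_ ?_ ?_ ?_
    · simpa [Expr.Bdd, hk3] using by omega
    · simp [Expr.Bdd]
    · simp only [Expr.Bdd, Expr.eval, hk3, e0, e7, e8]
      refine ⟨⟨?_, ?_, hBW _ _⟩, ?_⟩
      · simpa using by omega
      · simpa using by omega
      · rwa [abs_of_pos hD0]
    · intro r hr
      simp only [Expr.eval, Store.arr_setVar, Store.arr_setArr, hk3, e0, e7, e8]
      by_cases hrk : (r : ℕ) = k
      · obtain rfl : r = ⟨k, hk⟩ := Fin.ext hrk
        simp [hv]
      · simpa [hrk] using hI r (by omega)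
  intro s1 hF1 _ hI
  have hv4 : s1.vec n 4 = v := funext fun r => hI r r.2
  -- Reducing the new column modulo D changes nothing, since Λ contains D ℤⁿ.
  have hspan : Λ ⊔ Submodule.span ℤ {v} = Λ ⊔ Submodule.span ℤ {B.col j} := by
    have hDw : D • (fun r => B r j / D) ∈ Λ :=
      smul_mem_of_single_mem (k := n) (fun r _ => hD r) fun r hr => absurd r.2 (not_lt.2 hr)
    have hvB : B.col j = v + D • (fun r => B r j / D) := by
      ext r
      exact (Int.emod_add_mul_ediv _ _).symm
    apply le_antisymm <;> refine sup_le le_sup_left (Submodule.span_le.2 ?_) <;>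
      rw [Set.singleton_subset_iff]
    · rw [← sub_eq_iff_eq_add.2 hvB]
      exact Submodule.sub_mem _ (Submodule.mem_sup_right (Submodule.mem_span_singleton_self _))
        (Submodule.mem_sup_left hDw)
    · rw [hvB]
      exact Submodule.add_mem _ (Submodule.mem_sup_right (Submodule.mem_span_singleton_self _))
        (Submodule.mem_sup_left hDw)
  have hext : IsTriExt D (Λ ⊔ Submodule.span ℤ {B.col j}) n (s1.mat n 3) (s1.vec n 4) := by
    rw [hF1.mat (a := 3) rfl n, h3, hv4]
    exact h.triExt hD (fun r => Int.emod_nonneg _ hD0.ne')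
      (fun r => (Int.emod_lt_of_pos _ hD0).le) hspan
  refine Runs.forLoop n ((hF1.var 0 rfl).trans hn) hβ hW (by decide) rfl rfl
    (fun k s' => IsTriExt D (Λ ⊔ Submodule.span ℤ {B.col j}) (n - k) (s'.mat n 3) (s'.vec n 4))
    hext ?_ ?_
  · intro k hk s2 hF2 hk9 hI
    have hk' : n - (k + 1) < n := by omega
    refine (runs_eliminateBody (i := ⟨n - (k + 1), hk'⟩) hβ hL hW hDW hDL
      ((hF2.var 0 rfl).trans ((hF1.var 0 rfl).trans hn))
      ((hF2.var 7 rfl).trans ((hF1.var 7 rfl).trans h7)) ?_ rfl rfl ?_).mono fun _ h => h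
    · rw [hk9]
      simp only
      omega
    · convert hI using 1
      simp only
      omega
  · intro s2 _ _ hI
    rw [Nat.sub_self] at hI
    exact hI.triBasis

/-- Starting from D · 1 instead of an empty basis guarantees full rank throughout. The final lattice
D ℤⁿ + L(B) is L(B), because D ℤⁿ lies in L(B). -/
theorem runs_triProg {B : Matrix (Fin n) (Fin n) ℤ} {L : ℕ}
    (hβ : n ≤ β) (hL : L ≤ β) (hW : n < W) (hDW : 2 * D ^ 2 ≤ W) (hDL : 2 * D ^ 2 < 2 ^ L)
    (hBW : ∀ r c, |B r c| ≤ W) (hn : s.var 0 = n) (h7 : s.var 7 = D)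
    (h0 : s.mat n 0 = B) (h3 : s.arr 3 = 0) (hD0 : 0 < D)
    (hD : ∀ r : Fin n, Pi.single r D ∈ colSpan B) :
    Runs β W triProg s (fun s' => IsTriBasis D (colSpan B) (s'.mat n 3)) := by
  have hD2 : D ≤ W := by nlinarith
  refine Runs.seq (Runs.forLoop n hn hβ hW (by decide) rfl rfl
    (fun k s' => ∀ r c : Fin n, s'.arr 3 (r : ℕ) (c : ℕ) =
      if (r : ℕ) < k ∧ r = c then D else 0) ?_ ?_ ?_)
  · simp [h3]
  · intro a ha s4 hF4 hi hI
    have e7 := (hF4.var 7 rfl).trans h7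
    refine Runs.store ?_ ?_ ?_ ?_
    · simpa [Expr.Bdd, hi] using by omega
    · simpa [Expr.Bdd, hi] using by omega
    · simpa [Expr.Bdd, e7, abs_of_pos hD0] using hD2
    · intro i j
      simp only [Expr.eval, Store.arr_setVar, Store.arr_setArr, hi, hI, e7]
      by_cases hia : (i : ℕ) = a
      · obtain rfl : i = ⟨a, ha⟩ := Fin.ext hia
        by_cases hij : (⟨a, ha⟩ : Fin n) = j
        · subst hij
          simp
        · have : (j : ℕ) ≠ a := fun h => hij (Fin.ext h.symm)
          simp [hij, this]
      · have : ((i : ℕ) < a + 1) = ((i : ℕ) < a) := propext ⟨fun _ => by omega, fun _ => by omega⟩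
        simp [hia, this]
  intro s1 hF1 _ hI
  have hH : s1.mat n 3 = D • (1 : Matrix (Fin n) (Fin n) ℤ) := by
    ext r c
    rw [Store.mat, hI, Matrix.smul_apply, Matrix.one_apply]
    simp
  set Λ : ℕ → Submodule ℤ (Fin n → ℤ) := fun k =>
    Submodule.span ℤ (Set.range fun r : Fin n => Pi.single r D) ⊔ lowSpan B k with hΛ
  have hΛD : ∀ k (r : Fin n), Pi.single r D ∈ Λ k := fun k r =>
    Submodule.mem_sup_left (Submodule.subset_span ⟨r, rfl⟩)
  have hΛ0 : Λ 0 = Submodule.span ℤ (Set.range fun r : Fin n => Pi.single r D) := by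
    simp [hΛ, lowSpan]
  have hΛn : Λ n = colSpan B := by
    apply le_antisymm
    · refine sup_le (Submodule.span_le.2 ?_) (lowSpan_le_colSpan B n)
      rintro _ ⟨r, rfl⟩
      exact hD r
    · refine Submodule.span_le.2 ?_
      rintro _ ⟨c, rfl⟩
      exact Submodule.mem_sup_right (col_mem_lowSpan B c.2)
  have hΛs : ∀ j : Fin n, Λ j ⊔ Submodule.span ℤ {B.col j} = Λ (j + 1) := fun j => by
    have : {c : Fin n | (c : ℕ) < j + 1} = insert j {c : Fin n | (c : ℕ) < j} := by
      ext c
      simp [Fin.ext_iff]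
      omega
    simp only [hΛ, sup_assoc, lowSpan]
    rw [this, Set.image_insert_eq, Submodule.span_insert, sup_comm (Submodule.span ℤ {B.col j})]
  refine Runs.forLoop n ((hF1.var 0 rfl).trans hn) hβ hW (by decide) rfl rfl
    (fun k s' => IsTriBasis D (Λ k) (s'.mat n 3)) ?_ ?_ ?_
  · have : (s1.setVar 8 0).mat n 3 = s1.mat n 3 := rfl
    rw [this, hΛ0, hH]
    exact isTriBasis_scalar hD0
  · intro k hk s2 hF2 h8 hI
    refine (runs_addColBody (j := ⟨k, hk⟩) (B := B) hβ hL hW hDW hDL hBW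
      ((hF2.var 0 rfl).trans ((hF1.var 0 rfl).trans hn))
      ((hF2.var 7 rfl).trans ((hF1.var 7 rfl).trans h7)) h8
      ((hF2.mat rfl n).trans ((hF1.mat rfl n).trans h0)) rfl hI (hΛD k)).mono fun s3 h => ?_
    rw [hΛs ⟨k, hk⟩] at h
    exact h
  · intro s2 _ _ hI
    rwa [hΛn] at hI

end

end SysNF


namespace SysNF

open LogRAM

/-! ### Reducing the triangular basis -/

/-- Reduction of one entry of the triangular basis. -/
def reduceBody : Program :=
  .seq (.assign 10 (.sub (.sub (.var 8) (.const 1)) (.var 9)))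
  (.seq (.assign 11 (.div (.get 3 (.var 10) (.var 8)) (.get 3 (.var 10) (.var 10))))
  (.seq (.assign 12 (.add (.var 10) (.const 1)))
    (forLoop 3 12 (.store 3 (.var 3) (.var 8) (.mod (.sub (.get 3 (.var 3) (.var 8))
      (.mul (.var 11) (.get 3 (.var 3) (.var 10)))) (.var 7))))))

/-- Reduction of the triangular basis. -/
def reduceProg : Program := forLoop 8 0 (forLoop 9 8 reduceBody)

section

variable {β W n : ℕ} {s : Store} {D : ℤ} {Λ : Submodule ℤ (Fin n → ℤ)}

theorem runs_reduceBody {H : Matrix (Fin n) (Fin n) ℤ} {i j : Fin n}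
    (hβ : n ≤ β) (hW : n < W) (hDW : 2 * D ^ 2 ≤ W) (h7 : s.var 7 = D)
    (h8 : s.var 8 = (j : ℕ)) (h9 : s.var 9 = (j - 1 - i : ℕ)) (hij : i < j) (h3 : s.mat n 3 = H)
    (h : IsTriBasis D Λ H) :
    Runs β W reduceBody s (fun s' => ∀ r c, s'.mat n 3 r c =
      if c = j ∧ r ≤ i then (H r j - H i j / H i i * H r i) % D else H r c) := by
  have hi := i.2
  have hj := j.2
  have hij' : (i : ℕ) < j := hij
  have hD : 0 < D := (h.pos i).trans_le (h.le i i)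
  have hD2 : D ≤ W := by nlinarith
  have h3' : ∀ r c : Fin n, s.arr 3 (r : ℕ) (c : ℕ) = H r c := fun r c => by rw [← h3]; rfl
  have hHb : ∀ r c, |H r c| ≤ D := fun r c => by
    rw [abs_of_nonneg (h.nonneg r c)]
    exact h.le r c
  refine Runs.seq (Runs.assign ?_ ?_)
  · simp only [Expr.Bdd, Expr.eval, h8, h9]
    refine ⟨⟨?_, ?_, ?_⟩, ?_, ?_⟩ <;> rw [abs_le] <;> constructor <;> omega
  have hs1 : ((Expr.sub (.var 8) (.const 1)).sub (.var 9)).eval s = (i : ℕ) := by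
    simp only [Expr.eval, h8, h9]
    omega
  rw [hs1]
  set q := H i j / H i i with hq
  have hq0 : 0 ≤ q := Int.ediv_nonneg (h.nonneg i j) (h.nonneg i i)
  have hqD : q ≤ D := (Int.ediv_le_self _ (h.nonneg i j)).trans (h.le i j)
  refine Runs.seq (Runs.assign ?_ ?_)
  · simpa [Expr.Bdd, Expr.eval, h8, h3'] using
      ⟨⟨by omega, by omega, (hHb i j).trans hD2⟩, by omega, (hHb i i).trans hD2⟩
  have hs2 : ((Expr.get 3 (.var 10) (.var 8)).div (.get 3 (.var 10) (.var 10))).eval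
      (s.setVar 10 (i : ℕ)) = q := by
    simp [Expr.eval, h8, h3', hq]
  rw [hs2]
  refine Runs.seq (Runs.assign ?_ ?_)
  · simp only [Expr.Bdd, Expr.eval, Store.var_setVar]
    norm_num
    refine ⟨by omega, by omega, ?_⟩
    rw [abs_le]
    constructor <;> omega
  have hs3 : ((Expr.var 10).add (.const 1)).eval ((s.setVar 10 (i : ℕ)).setVar 11 q) =
      (i + 1 : ℕ) := by
    simp [Expr.eval]
  rw [hs3]
  refine Runs.forLoop (i + 1) (by simp) (by omega) (by omega) (by decide) rfl rfl
    (fun k s' => ∀ r c : Fin n, s'.arr 3 (r : ℕ) (c : ℕ) =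
        if c = j ∧ (r : ℕ) < k then (H r j - q * H r i) % D else H r c) ?_ ?_ ?_
  · simp [h3']
  · intro k hk s1 hF hk3 hI
    have hkn : k < n := by omega
    have e7 : s1.var 7 = D := by simp [hF.var 7 rfl, h7]
    have e8 : s1.var 8 = (j : ℕ) := by simp [hF.var 8 rfl, h8]
    have e10 : s1.var 10 = (i : ℕ) := by simp [hF.var 10 rfl]
    have e11 : s1.var 11 = q := by simp [hF.var 11 rfl]
    have ekj : s1.arr 3 k (j : ℕ) = H ⟨k, hkn⟩ j := by simpa using hI ⟨k, hkn⟩ j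
    -- Overwriting in place is harmless: only column j is written, and i < j.
    have eki : s1.arr 3 k (i : ℕ) = H ⟨k, hkn⟩ i := by simpa [hij.ne] using hI ⟨k, hkn⟩ i
    have hqv : |q * H ⟨k, hkn⟩ i| ≤ D * D := by
      rw [abs_mul, abs_of_nonneg hq0]
      exact mul_le_mul hqD (hHb _ _) (abs_nonneg _) hD.le
    refine Runs.store ?_ ?_ ?_ ?_
    · simpa [Expr.Bdd, hk3] using by omega
    · simpa [Expr.Bdd, e8] using by omega
    · simp only [Expr.Bdd, Expr.eval, hk3, e7, e8, e10, e11, ekj, eki]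
      refine ⟨⟨⟨?_, ?_, (hHb _ _).trans hD2⟩, ⟨?_, ⟨?_, ?_, (hHb _ _).trans hD2⟩, ?_⟩, ?_⟩, ?_⟩
      · simpa using by omega
      · simpa using by omega
      · rw [abs_of_nonneg hq0]
        omega
      · simpa using by omega
      · simpa using by omega
      · nlinarith
      · refine (abs_sub _ _).trans ?_
        have := hHb ⟨k, hkn⟩ j
        nlinarith
      · rwa [abs_of_pos hD]
    · intro r c
      simp only [Expr.eval, Store.arr_setVar, Store.arr_setArr, hk3, e7, e8, e10, e11, ekj, eki, hI]
      by_cases hr : (r : ℕ) = k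
      · obtain rfl : r = ⟨k, hkn⟩ := Fin.ext hr
        by_cases hc : c = j
        · simp [hc]
        · have : (c : ℕ) ≠ j := fun h => hc (Fin.ext h)
          simp [hc, this]
      · have : ((r : ℕ) < k + 1) = ((r : ℕ) < k) := propext ⟨fun _ => by omega, fun _ => by omega⟩
        simp [hr, this]
  · intro s1 hF _ hI r c
    rw [Store.mat, hI]
    simp only [Nat.lt_succ_iff, Fin.le_def]

/-- Within a column the rows are treated from the diagonal upwards. Reducing the entry in row i
alters only rows up to i of that column, so the entries already reduced below it and all diagonal
entries survive. -/
theorem runs_reduceProg {H : Matrix (Fin n) (Fin n) ℤ}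
    (hβ : n ≤ β) (hW : n < W) (hDW : 2 * D ^ 2 ≤ W) (hn : s.var 0 = n) (h7 : s.var 7 = D)
    (h3 : s.mat n 3 = H) (h : IsTriBasis D Λ H) (hD : ∀ r : Fin n, Pi.single r D ∈ Λ) :
    Runs β W reduceProg s (fun s' => IsTriBasis D Λ (s'.mat n 3) ∧
      ∀ r c, r < c → s'.mat n 3 r c < s'.mat n 3 r r) := by
  refine Runs.forLoop n hn hβ hW (by decide) rfl rfl
    (fun k s' => IsTriBasis D Λ (s'.mat n 3) ∧
      ∀ r c : Fin n, r < c → (c : ℕ) < k → s'.mat n 3 r c < s'.mat n 3 r r) ?_ ?_ ?_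
  · have : (s.setVar 8 0).mat n 3 = s.mat n 3 := rfl
    rw [this, h3]
    exact ⟨h, by simp⟩
  · rintro k hk s1 hF1 h8 ⟨hI, hI'⟩
    refine Runs.forLoop k h8 (by omega) (by omega) (by decide) rfl rfl
      (fun l s' => IsTriBasis D Λ (s'.mat n 3) ∧
        ∀ r c : Fin n, r < c → ((c : ℕ) < k ∨ (c : ℕ) = k ∧ k ≤ r + l) →
          s'.mat n 3 r c < s'.mat n 3 r r) ?_ ?_ ?_
    · refine ⟨hI, fun r c hrc hc => hI' r c hrc ?_⟩
      have : (r : ℕ) < c := hrc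
      omega
    · rintro l hl s2 hF2 h9 ⟨hJ, hJ'⟩
      have hi : k - 1 - l < n := by omega
      refine (runs_reduceBody (i := ⟨k - 1 - l, hi⟩) (j := ⟨k, hk⟩) hβ hW hDW
        ((hF2.var 7 rfl).trans ((hF1.var 7 rfl).trans h7)) ((hF2.var 8 rfl).trans h8) ?_ ?_ rfl
        hJ).mono fun s3 hs3 => ?_
      · rw [h9]
        simp only
        omega
      · rw [Fin.lt_def]
        simp only
        omega
      · have hlt : (⟨k - 1 - l, hi⟩ : Fin n) < ⟨k, hk⟩ := by
          rw [Fin.lt_def]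
          simp only
          omega
        obtain ⟨h1, h2⟩ := hJ.reduce hD hlt hs3
        refine ⟨h1, fun r c hrc hc => ?_⟩
        have hrc' : (r : ℕ) < c := hrc
        have hrr : s3.mat n 3 r r = s2.mat n 3 r r := by
          rw [hs3, if_neg]
          rintro ⟨rfl, hr⟩
          exact absurd hr (not_le.2 hlt)
        change s3.mat n 3 r c < s3.mat n 3 r r
        rw [hrr]
        by_cases hcr : c = ⟨k, hk⟩ ∧ r = ⟨k - 1 - l, hi⟩
        · rw [hcr.1, hcr.2]
          exact h2
        · rw [hs3, if_neg]
          · refine hJ' r c hrc ?_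
            simp only [Fin.ext_iff] at hcr
            omega
          · rintro ⟨rfl, hr⟩
            simp only [Fin.ext_iff, true_and] at hcr
            rw [Fin.le_def] at hr
            simp only at hr hc
            omega
    · rintro s2 hF2 - ⟨hJ, hJ'⟩
      refine ⟨hJ, fun r c hrc hc => hJ' r c hrc ?_⟩
      omega
  · rintro s1 hF1 - ⟨hI, hI'⟩
    exact ⟨hI, fun r c hrc => hI' r c hrc c.2⟩

/-- Solve Hx = y from the last row up. A row with diagonal entry 1 has zeros to its right, so it
contributes |xₖ| = |yₖ| at most. A row with diagonal entry h ≥ 2 gives |xₖ| ≤ |yₖ| + S, with S the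
sum over later coordinates, and so at worst doubles S; the doubling is paid for by the factor h. The
total growth is bounded by the product of the diagonal instead of by 2ⁿ. -/
theorem sum_abs_le_of_reduced {H : Matrix (Fin n) (Fin n) ℤ} (htri : ∀ r c, c < r → H r c = 0)
    (hpos : ∀ r, 0 < H r r) (hnonneg : ∀ r c, 0 ≤ H r c) (hred : ∀ r c, r < c → H r c < H r r)
    (x : Fin n → ℤ) :
    ∑ i, |x i| ≤ (∏ i, H i i) * ∑ i, |H.mulVec x i| := by
  set F : ℕ → Finset (Fin n) := fun k => Finset.univ.filter fun i : Fin n => k ≤ (i : ℕ) with hF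
  have hF0 : F 0 = Finset.univ := by simp [hF]
  have hFn : F n = ∅ := by
    ext i
    simp [hF]
  have hFs : ∀ k : Fin n, F k = insert k (F (k + 1)) := fun k => by
    ext i
    simp only [hF, Finset.mem_filter, Finset.mem_univ, true_and, Finset.mem_insert, Fin.ext_iff]
    omega
  have hFk : ∀ k : Fin n, k ∉ F (k + 1) := fun k => by simp [hF]
  suffices h : ∀ m ≤ n, ∑ i ∈ F (n - m), |x i| ≤
      (∏ i ∈ F (n - m), H i i) * ∑ i ∈ F (n - m), |H.mulVec x i| by
    have := h n le_rfl
    rwa [Nat.sub_self, hF0] at this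
  intro m
  induction m with
  | zero => simp [hFn]
  | succ m ih =>
    intro hm
    have ih := ih (by omega)
    obtain ⟨k, hk⟩ : ∃ k : Fin n, (k : ℕ) = n - (m + 1) := ⟨⟨n - (m + 1), by omega⟩, rfl⟩
    have hk1 : n - m = k + 1 := by omega
    rw [hk1] at ih
    rw [← hk, hFs k, Finset.sum_insert (hFk k), Finset.sum_insert (hFk k),
      Finset.prod_insert (hFk k)]
    set S := ∑ i ∈ F (k + 1), |x i| with hS
    set P := ∏ i ∈ F (k + 1), H i i with hP
    set Y := ∑ i ∈ F (k + 1), |H.mulVec x i| with hY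
    have hS0 : 0 ≤ S := Finset.sum_nonneg fun _ _ => abs_nonneg _
    have hY0 : 0 ≤ Y := Finset.sum_nonneg fun _ _ => abs_nonneg _
    have hP1 : 1 ≤ P := by
      have : 0 < P := Finset.prod_pos fun i _ => hpos i
      omega
    have hrow : H.mulVec x k = H k k * x k + ∑ i ∈ F (k + 1), H k i * x i := by
      rw [Matrix.mulVec, dotProduct, ← Finset.sum_insert (f := fun i => H k i * x i) (hFk k),
        ← hFs k]
      refine (Finset.sum_subset (Finset.subset_univ _) fun i _ hi => ?_).symm
      rw [htri k i, zero_mul]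
      simpa [hF] using hi
    -- Separating the diagonal entry 1 is essential: there the remaining entries of the row are
    -- zero, and no growth may be charged.
    have hrest : |∑ i ∈ F (k + 1), H k i * x i| ≤ (if H k k = 1 then 0 else H k k) * S := by
      refine (Finset.abs_sum_le_sum_abs _ _).trans ?_
      rw [hS, Finset.mul_sum]
      refine Finset.sum_le_sum fun i hi => ?_
      have hki : k < i := by
        rw [Fin.lt_def]
        simp only [hF, Finset.mem_filter, Finset.mem_univ, true_and] at hi
        omega
      have h1 := hred k i hki
      have h2 := hnonneg k i
      rw [abs_mul, abs_of_nonneg h2]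
      refine mul_le_mul_of_nonneg_right ?_ (abs_nonneg _)
      split_ifs <;> omega
    have hxk : H k k * |x k| ≤ |H.mulVec x k| + (if H k k = 1 then 0 else H k k) * S := by
      have : H k k * x k = H.mulVec x k - ∑ i ∈ F (k + 1), H k i * x i := by rw [hrow]; ring
      rw [← abs_of_pos (hpos k), ← abs_mul, this, abs_of_pos (hpos k)]
      exact (abs_sub _ _).trans (by gcongr)
    have hy0 := abs_nonneg (H.mulVec x k)
    have hp := hpos k
    generalize |H.mulVec x k| = y at *
    generalize |x k| = z at *
    generalize H k k = h at *
    split_ifs at hxk with h1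
    · subst h1
      nlinarith
    · have h2 : 2 ≤ h := by omega
      have h3 : z ≤ y + S := by
        by_contra! hlt
        nlinarith
      have h4 : y ≤ h * P * y := by
        have : 1 ≤ h * P := by nlinarith
        nlinarith
      nlinarith [mul_nonneg (by omega : (0 : ℤ) ≤ h - 2) hS0, mul_le_mul_of_nonneg_left ih hp.le]

end

end SysNF


namespace SysNF

open LogRAM

/-! ### Back substitution -/

/-- Computation of one entry of the solution `U` of `H * U = B`. -/
def solveBody : Program :=
  .seq (.assign 10 (.sub (.sub (.var 0) (.const 1)) (.var 9)))
  (.seq (sumLoop 6 5 0 (.mul (.get 3 (.var 10) (.var 5)) (.get 6 (.var 5) (.var 8))))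
    (.store 6 (.var 10) (.var 8) (.div (.sub (.get 0 (.var 10) (.var 8)) (.var 6))
      (.get 3 (.var 10) (.var 10)))))

/-- Computation of the solution `U` of `H * U = B`. -/
def solveProg : Program := forLoop 8 0 (forLoop 9 0 solveBody)

/-- Computation of the vector that is dual to the perturbed basis. -/
def dualProg : Program :=
  .seq (.store 7 (.const 0) (.const 0) (.const 1))
    (forLoop 8 0 (.seq
      (sumLoop 6 5 0 (.mul (.get 7 (.var 5) (.const 0)) (.get 3 (.var 5) (.var 8))))
      (.store 7 (.add (.var 8) (.const 1)) (.const 0)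
        (.sub (.const 0) (.mul (.var 13) (.var 6))))))

section

variable {β W n : ℕ} {s : Store}

theorem runs_solveBody {H U B : Matrix (Fin n) (Fin n) ℤ} {i j : Fin n} {D b u : ℤ}
    (hβ : n ≤ β) (hW : n < W) (hn : s.var 0 = n) (h8 : s.var 8 = (j : ℕ))
    (h9 : s.var 9 = (n - 1 - i : ℕ)) (h0 : s.mat n 0 = B) (h3 : s.mat n 3 = H)
    (htri : ∀ r c, c < r → H r c = 0) (hpos : ∀ r, 0 < H r r) (hHU : H * U = B)
    (hH : ∀ r c, |H r c| ≤ D) (hU : ∀ r c, |U r c| ≤ u) (hB : ∀ r c, |B r c| ≤ b)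
    (hDW : D ≤ W) (huW : u ≤ W) (hbW : n * (D * u) + b ≤ W)
    (h6 : ∀ r : Fin n, s.arr 6 (r : ℕ) (j : ℕ) = if i < r then U r j else 0) :
    Runs β W solveBody s (fun s' => ∀ r c : ℤ, s'.arr 6 r c =
      if r = (i : ℕ) ∧ c = (j : ℕ) then U i j else s.arr 6 r c) := by
  have hi := i.2
  have hj := j.2
  have hD0 : 0 ≤ D := (abs_nonneg _).trans (hH i i)
  have hu0 : 0 ≤ u := (abs_nonneg _).trans (hU i i)
  have hb0 : 0 ≤ b := (abs_nonneg _).trans (hB i i)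
  have hDu0 : 0 ≤ D * u := mul_nonneg hD0 hu0
  have hDu : D * u ≤ n * (D * u) := by
    have : (1 : ℤ) ≤ n := by omega
    nlinarith [mul_nonneg hD0 hu0]
  have h3' : ∀ r c : Fin n, s.arr 3 (r : ℕ) (c : ℕ) = H r c := fun r c => by rw [← h3]; rfl
  have h0' : ∀ r c : Fin n, s.arr 0 (r : ℕ) (c : ℕ) = B r c := fun r c => by rw [← h0]; rfl
  refine Runs.seq (Runs.assign ?_ ?_)
  · simp only [Expr.Bdd, Expr.eval, hn, h9]
    refine ⟨⟨?_, ?_, ?_⟩, ?_, ?_⟩ <;> rw [abs_le] <;> constructor <;> omega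
  have hs1 : ((Expr.sub (.var 0) (.const 1)).sub (.var 9)).eval s = (i : ℕ) := by
    simp only [Expr.eval, hn, h9]
    omega
  rw [hs1]
  have hterm : ∀ k < n, |s.arr 6 (k : ℕ) (j : ℕ)| ≤ u ∧
      |s.arr 3 (i : ℕ) k * s.arr 6 (k : ℕ) (j : ℕ)| ≤ D * u := fun k hk => by
    have h1 : |s.arr 6 (k : ℕ) (j : ℕ)| ≤ u := by
      have := h6 ⟨k, hk⟩
      simp only at this
      rw [this]
      split_ifs
      · exact hU _ _
      · simpa using hu0
    refine ⟨h1, ?_⟩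
    rw [abs_mul]
    have := hH i ⟨k, hk⟩
    rw [← h3'] at this
    exact mul_le_mul this h1 (abs_nonneg _) hD0
  -- The program sums over the whole row. The terms left of the diagonal vanish by triangularity,
  -- and the diagonal term vanishes because the unknown in row i is still stored as 0.
  have hsum : ∑ k ∈ Finset.range n, s.arr 3 (i : ℕ) k * s.arr 6 (k : ℕ) (j : ℕ) =
      B i j - H i i * U i j := by
    rw [Finset.sum_range, ← hHU, Matrix.mul_apply,
      ← Finset.add_sum_erase Finset.univ _ (Finset.mem_univ i),
      ← Finset.add_sum_erase Finset.univ (fun k => H i k * U k j) (Finset.mem_univ i), h6 i,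
      if_neg (lt_irrefl _), mul_zero, zero_add, add_sub_cancel_left]
    refine Finset.sum_congr rfl fun k hk => ?_
    rw [h6, h3']
    rcases lt_or_gt_of_ne (Finset.ne_of_mem_erase hk) with hlt | hlt
    · rw [htri i k hlt, zero_mul, zero_mul]
    · rw [if_pos hlt]
  refine Runs.seq (Runs.sumLoop n (by simpa using hn) hβ hW (by decide) (by decide) (by decide)
    (fun k => s.arr 3 (i : ℕ) k * s.arr 6 (k : ℕ) (j : ℕ)) ?_ ?_ ?_)
  · intro k hk v
    obtain ⟨h1, h2⟩ := hterm k hk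
    have h4 := hH i ⟨k, hk⟩
    rw [← h3'] at h4
    simp only [Expr.Bdd, Expr.eval, Store.var_setVar, Store.arr_setVar, h8]
    norm_num
    exact ⟨⟨by omega, by omega, h4.trans hDW⟩, ⟨by omega, by omega, h1.trans huW⟩,
      by rw [← abs_mul]; linarith⟩
  · intro k hk
    have := abs_sum_range_le hk fun k hk => (hterm k hk).2
    linarith
  rw [hsum]
  have hacc : |B i j - H i i * U i j| ≤ n * (D * u) := by
    rw [← hsum]
    exact abs_sum_range_le le_rfl fun k hk => (hterm k hk).2
  have hfin : |H i i * U i j| ≤ D * u := by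
    rw [abs_mul]
    exact mul_le_mul (hH _ _) (hU _ _) (abs_nonneg _) hD0
  have hdiv : H i i * U i j / H i i = U i j := Int.mul_ediv_cancel_left _ (hpos i).ne'
  have hBb := hB i j
  have hHb := hH i i
  refine Runs.store ?_ ?_ ?_ ?_
  · simpa [Expr.Bdd] using by omega
  · simpa [Expr.Bdd, h8] using by omega
  · simp only [Expr.Bdd, Expr.eval, Store.var_setVar, Store.arr_setVar, h8]
    norm_num
    rw [h0', h3', sub_sub_cancel]
    exact ⟨⟨⟨by omega, by omega, by linarith⟩, by linarith, by linarith⟩, by omega, by linarith⟩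
  · intro r c
    simp only [Expr.eval, Store.var_setVar, Store.arr_setVar, Store.arr_setArr, h8]
    norm_num
    rw [h0', h3', sub_sub_cancel, hdiv]

theorem runs_solveProg {H U B : Matrix (Fin n) (Fin n) ℤ} {D b u : ℤ}
    (hβ : n ≤ β) (hW : n < W) (hn : s.var 0 = n) (h0 : s.mat n 0 = B) (h3 : s.mat n 3 = H)
    (h6 : s.arr 6 = 0)
    (htri : ∀ r c, c < r → H r c = 0) (hpos : ∀ r, 0 < H r r) (hHU : H * U = B)
    (hH : ∀ r c, |H r c| ≤ D) (hU : ∀ r c, |U r c| ≤ u) (hB : ∀ r c, |B r c| ≤ b)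
    (hDW : D ≤ W) (huW : u ≤ W) (hbW : n * (D * u) + b ≤ W) :
    Runs β W solveProg s (fun s' => s'.mat n 6 = U) := by
  refine Runs.forLoop n hn hβ hW (by decide) rfl rfl
    (fun k s' => ∀ r c : Fin n, s'.arr 6 (r : ℕ) (c : ℕ) = if (c : ℕ) < k then U r c else 0)
    ?_ ?_ ?_
  · simp [h6]
  · intro k hk s1 hF1 h8 hI
    refine Runs.forLoop n ((hF1.var 0 rfl).trans hn) hβ hW (by decide) rfl rfl
      (fun l s' => ∀ r c : Fin n, s'.arr 6 (r : ℕ) (c : ℕ) =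
        if (c : ℕ) < k ∨ (c : ℕ) = k ∧ n ≤ r + l then U r c else 0) ?_ ?_ ?_
    · intro r c
      rw [Store.arr_setVar, hI]
      congr 1
      exact propext ⟨fun _ => by omega, fun _ => by omega⟩
    · intro l hl s2 hF2 h9 hJ
      have hi : n - 1 - l < n := by omega
      refine (runs_solveBody (i := ⟨n - 1 - l, hi⟩) (j := ⟨k, hk⟩) hβ hW
        ((hF2.var 0 rfl).trans ((hF1.var 0 rfl).trans hn)) ((hF2.var 8 rfl).trans h8) ?_
        ((hF2.mat rfl n).trans ((hF1.mat rfl n).trans h0))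
        ((hF2.mat rfl n).trans ((hF1.mat rfl n).trans h3))
        htri hpos hHU hH hU hB hDW huW hbW ?_).mono ?_
      · rw [h9]
        simp only
        omega
      · intro r
        rw [hJ]
        congr 1
        simp only [Fin.lt_def, lt_irrefl, true_and, false_or]
        exact propext ⟨fun _ => by omega, fun _ => by omega⟩
      · intro s3 hs3 r c
        rw [Store.arr_setVar, hs3, hJ]
        by_cases h : r = ⟨n - 1 - l, hi⟩ ∧ c = ⟨k, hk⟩
        · obtain ⟨rfl, rfl⟩ := h
          rw [if_pos ⟨rfl, rfl⟩, if_pos]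
          simp only [lt_irrefl, true_and, false_or]
          omega
        · simp only [Fin.ext_iff] at h
          rw [if_neg (by simp only; omega)]
          congr 1
          exact propext ⟨fun _ => by omega, fun _ => by omega⟩
    · intro s2 hF2 _ hJ r c
      rw [Store.arr_setVar, hJ]
      congr 1
      exact propext ⟨fun _ => by omega, fun _ => by omega⟩
  · intro s1 hF1 _ hI
    ext r c
    rw [Store.mat, hI, if_pos c.2]

/-- Each new entry of c is at most T n D times the bound for the earlier ones, so its bit length
stays polynomial. Summing over all rows is correct because H has zeros where c is not yet known. -/
theorem runs_dualProg {H : Matrix (Fin n) (Fin n) ℤ} {D T : ℤ}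
    (hβ : n ≤ β) (hW : n < W) (hn : s.var 0 = n) (h13 : s.var 13 = T) (h3 : s.mat n 3 = H)
    (h7 : s.arr 7 = 0) (htri : ∀ r c, c < r → H r c = 0) (hH : ∀ r c, |H r c| ≤ D)
    (hD : 1 ≤ D) (hT : 1 ≤ T) (hXW : (T * n * D) ^ (n + 1) ≤ W) :
    Runs β W dualProg s (fun s' => s'.arr 7 0 0 = 1 ∧
      (∀ j : Fin n, s'.arr 7 (j + 1 : ℕ) 0 =
        -(T * ∑ i : Fin n, s'.arr 7 (i : ℕ) 0 * H i j)) ∧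
      ∀ i ≤ n, |s'.arr 7 (i : ℕ) 0| ≤ (T * n * D) ^ n) := by
  have h1W : (1 : ℤ) ≤ W := by omega
  refine Runs.seq (Runs.store ?_ ?_ ?_ ?_)
  · simp [Expr.Bdd]
  · simp [Expr.Bdd]
  · simpa [Expr.Bdd] using h1W
  refine Runs.forLoop n (by simpa using hn) hβ hW (by decide) rfl rfl
    (fun k s' => s'.arr 7 0 0 = 1 ∧
      (∀ j : Fin n, (j : ℕ) < k → s'.arr 7 (j + 1 : ℕ) 0 =
        -(T * ∑ i : Fin n, s'.arr 7 (i : ℕ) 0 * H i j)) ∧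
      ∀ i ≤ n, |s'.arr 7 (i : ℕ) 0| ≤ (T * n * D) ^ k) ?_ ?_ ?_
  · refine ⟨by simp [Expr.eval], by simp, fun i _ => ?_⟩
    simp only [Expr.eval, Store.arr_setVar, Store.arr_setArr, h7]
    split_ifs <;> simp
  · rintro k hk s1 hF h8 ⟨hI0, hI1, hI2⟩
    have hX : 1 ≤ T * n * D := by
      have hn1 : (1 : ℤ) ≤ n := by omega
      have : 1 ≤ T * n := by nlinarith
      nlinarith
    have e3 : ∀ r c : Fin n, s1.arr 3 (r : ℕ) (c : ℕ) = H r c := fun r c => by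
      rw [hF.arr 3 rfl, ← h3]
      rfl
    have e13 : s1.var 13 = T := by simp [hF.var 13 rfl, h13]
    have hXk : (T * n * D) ^ k ≤ (W : ℤ) := (pow_le_pow_right₀ hX (by omega)).trans hXW
    have hXk0 : 1 ≤ (T * n * D) ^ k := one_le_pow₀ hX
    have hpow : T * (n * ((T * n * D) ^ k * D)) = (T * n * D) ^ (k + 1) := by ring
    have hpow' : (T * n * D) ^ (k + 1) ≤ (W : ℤ) := (pow_le_pow_right₀ hX (by omega)).trans hXW
    have hn0 : (1 : ℤ) ≤ n := by omega
    have hle1 : D ≤ (T * n * D) ^ (k + 1) := by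
      rw [← hpow]
      have h1 : D ≤ (T * n * D) ^ k * D := le_mul_of_one_le_left (by omega) hXk0
      have h2 : (T * n * D) ^ k * D ≤ n * ((T * n * D) ^ k * D) :=
        le_mul_of_one_le_left (by omega) hn0
      have h3 : n * ((T * n * D) ^ k * D) ≤ T * (n * ((T * n * D) ^ k * D)) :=
        le_mul_of_one_le_left (by omega) hT
      omega
    have hle3 : n * ((T * n * D) ^ k * D) ≤ (T * n * D) ^ (k + 1) := by
      rw [← hpow]
      exact le_mul_of_one_le_left (by positivity) hT
    have hle2 : (T * n * D) ^ k * D ≤ (T * n * D) ^ (k + 1) :=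
      (le_mul_of_one_le_left (by positivity) hn0).trans hle3
    have hTle : T ≤ (T * n * D) ^ (k + 1) := by
      rw [← hpow]
      refine le_mul_of_one_le_right (by omega) ?_
      have h1 : 1 ≤ (T * n * D) ^ k * D := by nlinarith
      nlinarith
    have hterm : ∀ i < n, |s1.arr 7 (i : ℕ) 0 * s1.arr 3 (i : ℕ) k| ≤ (T * n * D) ^ k * D :=
      fun i hi => by
        rw [abs_mul]
        have := hH ⟨i, hi⟩ ⟨k, hk⟩
        rw [← e3] at this
        exact mul_le_mul (hI2 i hi.le) this (abs_nonneg _) (by positivity)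
    have hsum : ∑ i ∈ Finset.range n, s1.arr 7 (i : ℕ) 0 * s1.arr 3 (i : ℕ) k =
        ∑ i : Fin n, s1.arr 7 (i : ℕ) 0 * H i ⟨k, hk⟩ := by
      rw [Finset.sum_range]
      exact Finset.sum_congr rfl fun i _ => by rw [← e3]
    set S := ∑ i : Fin n, s1.arr 7 (i : ℕ) 0 * H i ⟨k, hk⟩ with hS
    have hSb : |S| ≤ n * ((T * n * D) ^ k * D) := by
      rw [← hsum]
      exact abs_sum_range_le le_rfl hterm
    have hTS : |T * S| ≤ (T * n * D) ^ (k + 1) := by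
      rw [← hpow, abs_mul, abs_of_pos (by omega : 0 < T)]
      exact mul_le_mul_of_nonneg_left hSb (by omega)
    refine Runs.seq (Runs.sumLoop n ?_ hβ hW (by decide) (by decide) (by decide)
      (fun i => s1.arr 7 (i : ℕ) 0 * s1.arr 3 (i : ℕ) k) ?_ ?_ ?_)
    · rw [hF.var 0 rfl]
      simpa using hn
    · intro i hi v
      have h4 := hH ⟨i, hi⟩ ⟨k, hk⟩
      rw [← e3] at h4
      have h5 := hI2 i hi.le
      have h6 := hterm i hi
      simp only [Expr.Bdd, Expr.eval, Store.var_setVar, Store.arr_setVar, h8]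
      norm_num
      exact ⟨⟨by omega, by omega⟩, ⟨by omega, by omega, by simp only at h4; omega⟩,
        by rw [← abs_mul]; omega⟩
    · intro i hi
      exact (abs_sum_range_le hi hterm).trans (hle3.trans hpow')
    rw [hsum]
    refine Runs.store ?_ ?_ ?_ ?_
    · simp only [Expr.Bdd, Expr.eval, Store.var_setVar, h8]
      norm_num
      refine ⟨by omega, by omega, ?_⟩
      rw [abs_le]
      constructor <;> omega
    · simp [Expr.Bdd]
    · simp only [Expr.Bdd, Expr.eval, Store.var_setVar, e13]
      norm_num
      rw [← abs_mul, abs_of_pos (by omega : 0 < T)]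
      omega
    · have hev : ∀ i : ℕ, i ≤ k → (((s1.setVar 6 S).setVar 5 n).setArr 7 (k + 1) 0
          (0 - T * S)).arr 7 (i : ℕ) 0 = s1.arr 7 i 0 := fun i hi => by
        simp only [Store.arr_setVar, Store.arr_setArr]
        rw [if_neg]
        omega
      have hev' : (((s1.setVar 6 S).setVar 5 n).setArr 7 (k + 1) 0
          (0 - T * S)).arr 7 (k + 1 : ℕ) 0 = 0 - T * S := by
        simp
      -- Writing entry k + 1 does not disturb the relations up to column k: it enters them with a
      -- coefficient of H below the diagonal, which is zero.
      have hsum' : ∀ j : Fin n, (j : ℕ) ≤ k → ∑ i : Fin n, (((s1.setVar 6 S).setVar 5 n).setArr 7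
          (k + 1) 0 (0 - T * S)).arr 7 (i : ℕ) 0 * H i j =
          ∑ i : Fin n, s1.arr 7 (i : ℕ) 0 * H i j := fun j hj => by
        refine Finset.sum_congr rfl fun i _ => ?_
        by_cases hi : (i : ℕ) ≤ k
        · rw [hev i hi]
        · rw [htri i j (by rw [Fin.lt_def]; omega), mul_zero, mul_zero]
      have heq : (((s1.setVar 6 S).setVar 5 n).setArr 7
          (((Expr.var 8).add (.const 1)).eval ((s1.setVar 6 S).setVar 5 n))
          ((Expr.const 0).eval ((s1.setVar 6 S).setVar 5 n))
          (((Expr.const 0).sub ((Expr.var 13).mul (.var 6))).eval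
            ((s1.setVar 6 S).setVar 5 n))) =
          ((s1.setVar 6 S).setVar 5 n).setArr 7 (k + 1) 0 (0 - T * S) := by
        simp [Expr.eval, h8, e13]
      rw [heq]
      simp only [Store.arr_setVar (Store.setArr _ _ _ _ _)]
      refine ⟨?_, ?_, ?_⟩
      · simpa using (hev 0 (Nat.zero_le _)).trans hI0
      · intro j hj
        rw [hsum' j (by omega)]
        rcases Nat.lt_succ_iff_lt_or_eq.1 hj with hj' | hj'
        · rw [hev _ (by omega), hI1 j hj']
        · obtain rfl : j = ⟨k, hk⟩ := Fin.ext hj'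
          rw [hev', hS, zero_sub]
      · intro i hi
        by_cases hik : i = k + 1
        · subst hik
          rw [hev', zero_sub, abs_neg]
          exact hTS
        · have : (((s1.setVar 6 S).setVar 5 n).setArr 7 (k + 1) 0
              (0 - T * S)).arr 7 (i : ℕ) 0 = s1.arr 7 i 0 := by
            simp only [Store.arr_setVar, Store.arr_setArr]
            rw [if_neg]
            omega
          rw [this]
          exact (hI2 i hi).trans (pow_le_pow_right₀ hX (by omega))
  · rintro s1 hF - ⟨hI0, hI1, hI2⟩
    exact ⟨hI0, fun j => hI1 j j.2, hI2⟩

end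

end SysNF


namespace SysNF

open LogRAM

/-! ### Assembling the output -/

/-- The perturbation of the upper right corner, and the modulus. -/
def modulusProg : Program :=
  .seq (.branch (.get 7 (.var 0) (.const 0)) (.assign 14 (.const 0))
    (.branch (.sub (.const 0) (.get 7 (.var 0) (.const 0))) (.assign 14 (.const 0))
      (.assign 14 (.const 2))))
  (.seq (.assign 15 (.sub (.var 14) (.get 7 (.var 0) (.const 0))))
    (.branch (.var 15) .skip (.assign 15 (.sub (.const 0) (.var 15)))))

/-- Computation of the images of the columns of `B`. -/
def imageProg : Program :=
  .seq (forLoop 4 0 (.store 6 (.const (-1)) (.var 4)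
    (.mul (.var 14) (.get 6 (.sub (.var 0) (.const 1)) (.var 4)))))
    (pairLoop 3 4 0 (.store 1 (.var 3) (.var 4) (.add
      (.mul (.var 13) (.get 0 (.var 3) (.var 4))) (.get 6 (.sub (.var 3) (.const 1)) (.var 4)))))

/-- Writing down the matrix in systematic normal form. -/
def outputProg : Program :=
  .seq (pairLoop 3 4 0 (.store 0 (.var 3) (.var 4) (.const 0)))
  (.seq (forLoop 4 0 (.seq (.store 0 (.var 4) (.var 4) (.const 1))
    (.store 0 (.const 0) (.var 4) (.sub (.const 0) (.get 7 (.var 4) (.const 0))))))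
  (.seq (.store 0 (.const 0) (.const 0) (.var 15)) (.assign 0 (.var 13))))

/-- The perturbation of the upper right corner. -/
def cornerShift (x : ℤ) : ℤ := if x = 0 then 2 else 0

section

variable {β W n : ℕ} {s : Store}

/-- A branch can only test positivity, so x = 0 is recognized by the failure of both 0 < x and 0 <
-x. -/
theorem runs_modulusProg {x : ℤ} (hW : n < W) (hW2 : 2 ≤ W) (hn : s.var 0 = n)
    (h7 : s.arr 7 (n : ℕ) 0 = x) (hx : |x| + 2 ≤ W) :
    Runs β W modulusProg s (fun s' => s'.var 14 = cornerShift x ∧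
      s'.var 15 = |cornerShift x - x|) := by
  have hget : ∀ s' : Store, s'.var 0 = n → s'.arr 7 = s.arr 7 →
      (Expr.get 7 (.var 0) (.const 0)).Bdd W s' ∧
      (Expr.get 7 (.var 0) (.const 0)).eval s' = x := fun s' h0 h => by
    simp only [Expr.Bdd, Expr.eval, h0, h, h7]
    norm_num
    exact ⟨by omega, by omega⟩
  obtain ⟨hg1, hg2⟩ := hget s hn rfl
  have hrest : ∀ d : ℤ, d = cornerShift x → Runs β W (.seq
      (.assign 15 (.sub (.var 14) (.get 7 (.var 0) (.const 0))))
      (.branch (.var 15) .skip (.assign 15 (.sub (.const 0) (.var 15))))) (s.setVar 14 d)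
      (fun s' => s'.var 14 = cornerShift x ∧ s'.var 15 = |cornerShift x - x|) := by
    intro d hd
    obtain ⟨hg1, hg2⟩ := hget (s.setVar 14 d) (by simpa using hn) rfl
    have hd2 : |d| ≤ 2 := by
      rw [hd, cornerShift]
      split_ifs <;> simp
    have hdx : |d - x| ≤ W := (abs_sub _ _).trans (by omega)
    refine Runs.seq (Runs.assign ⟨?_, hg1, ?_⟩ ?_)
    · simpa [Expr.Bdd] using by omega
    · rw [hg2]
      simpa [Expr.eval] using hdx
    have : (Expr.sub (.var 14) (.get 7 (.var 0) (.const 0))).eval (s.setVar 14 d) = d - x := by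
      rw [← hg2]
      simp [Expr.eval]
    rw [this]
    refine Runs.branch ?_ ?_ ?_
    · simpa [Expr.Bdd] using hdx
    · intro h
      have h : 0 < d - x := by simpa [Expr.eval] using h
      refine ⟨_, _, Exec.skip _, ?_, ?_⟩
      · simp [Program.steps]
      · simp [← hd, abs_of_pos h]
    · intro h
      have h : d - x ≤ 0 := by simpa [Expr.eval] using h
      refine Runs.assign ?_ ?_
      · simp only [Expr.Bdd, Expr.eval, Store.var_setVar]
        norm_num
        rw [abs_sub_comm x d]
        exact ⟨hdx, hdx⟩
      · simp [← hd, Expr.eval, abs_of_nonpos h]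
  refine Runs.seq (Runs.branch hg1 (fun h => ?_) fun h => Runs.branch ?_ (fun h' => ?_) fun h' => ?_)
  · rw [hg2] at h
    refine Runs.assign (by simp [Expr.Bdd]) (hrest _ ?_)
    rw [cornerShift, if_neg h.ne']
    rfl
  · refine ⟨by simp [Expr.Bdd], hg1, ?_⟩
    rw [hg2]
    simpa [Expr.eval] using by omega
  · have h' : x < 0 := by
      simp only [Expr.eval] at h' hg2
      omega
    refine Runs.assign (by simp [Expr.Bdd]) (hrest _ ?_)
    rw [cornerShift, if_neg h'.ne]
    rfl
  · have h' : x = 0 := by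
      simp only [Expr.eval] at h' hg2 h
      omega
    refine Runs.assign ?_ (hrest _ ?_)
    · simpa [Expr.Bdd] using by exact_mod_cast hW2
    · rw [cornerShift, if_pos h']
      rfl

/-- Multiplication by the perturbation shifts the rows of U cyclically, with factor δ for the row
that wraps around. That scaled row is stored in row -1 of array 6, so that the main loop can read
row i - 1 without a case distinction. -/
theorem runs_imageProg [NeZero n] {B U : Matrix (Fin n) (Fin n) ℤ} {δ T b u : ℤ}
    (hβ : n ≤ β) (hW : n < W) (hn : s.var 0 = n) (h0 : s.mat n 0 = B) (h6 : s.mat n 6 = U)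
    (h13 : s.var 13 = T) (h14 : s.var 14 = δ) (hT : 0 ≤ T) (hδ : 0 ≤ δ) (hδ2 : δ ≤ 2)
    (hB : ∀ r c, |B r c| ≤ b) (hU : ∀ r c, |U r c| ≤ u) (hbW : b ≤ W) (hTW : T ≤ W)
    (hW' : T * b + 2 * u + 2 ≤ W) :
    Runs β W imageProg s (fun s' => ∀ i j, s'.mat n 1 i j =
      T * B i j + (if i = 0 then δ else 1) * U (i - 1) j) := by
  have hn1 : 1 ≤ n := NeZero.one_le
  have hb0 : 0 ≤ b := (abs_nonneg _).trans (hB 0 0)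
  have hu0 : 0 ≤ u := (abs_nonneg _).trans (hU 0 0)
  have hTb : 0 ≤ T * b := mul_nonneg hT hb0
  have h0' : ∀ r c : Fin n, s.arr 0 (r : ℕ) (c : ℕ) = B r c := fun r c => by rw [← h0]; rfl
  have h6' : ∀ r c : Fin n, s.arr 6 (r : ℕ) (c : ℕ) = U r c := fun r c => by rw [← h6]; rfl
  have hlast : n - 1 < n := by omega
  refine Runs.seq (Runs.forLoop n hn hβ hW (by decide) rfl rfl
    (fun k s' => (∀ i j : ℕ, s'.arr 6 i j = s.arr 6 i j) ∧
      ∀ j : Fin n, (j : ℕ) < k → s'.arr 6 (-1) (j : ℕ) = δ * U ⟨n - 1, hlast⟩ j) ?_ ?_ ?_)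
  · simp
  · rintro k hk s1 hF h4 ⟨hI, hI'⟩
    have e0 := (hF.var 0 rfl).trans hn
    have e14 := (hF.var 14 rfl).trans h14
    have hcast : (n : ℤ) - 1 = (n - 1 : ℕ) := by omega
    have e6 : s1.arr 6 ((n : ℤ) - 1) k = U ⟨n - 1, hlast⟩ ⟨k, hk⟩ := by
      rw [hcast, hI, ← h6']
    have hUb := hU ⟨n - 1, hlast⟩ ⟨k, hk⟩
    have hδU : |δ * U ⟨n - 1, hlast⟩ ⟨k, hk⟩| ≤ W := by
      rw [abs_mul, abs_of_nonneg hδ]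
      nlinarith [abs_nonneg (U ⟨n - 1, hlast⟩ ⟨k, hk⟩)]
    refine Runs.store ?_ ?_ ?_ ⟨?_, ?_⟩
    · simp only [Expr.Bdd]
      norm_num
      omega
    · simpa [Expr.Bdd, h4] using by omega
    · simp only [Expr.Bdd, Expr.eval, h4, e0, e14, e6]
      refine ⟨?_, ⟨⟨?_, ?_, ?_⟩, ?_, ?_⟩, hδU⟩
      · rw [abs_of_nonneg hδ]
        omega
      · simpa using by omega
      · simpa using by omega
      · rw [hcast]
        simpa using by omega
      · simpa using by omega
      · omega
    · intro i j
      simp only [Expr.eval, Store.arr_setVar, Store.arr_setArr]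
      rw [if_neg (by omega), hI]
    · intro j hj
      simp only [Expr.eval, Store.arr_setVar, Store.arr_setArr, h4, e0, e14, e6]
      by_cases hjk : (j : ℕ) = k
      · obtain rfl : j = ⟨k, hk⟩ := Fin.ext hjk
        simp
      · rw [if_neg (by omega)]
        exact hI' j (by omega)
  rintro s1 hF1 - ⟨hI, hI'⟩
  have e60 : ∀ a b : Fin n, s1.arr 6 ((a : ℕ) - 1 : ℤ) (b : ℕ) =
      (if a = 0 then δ else 1) * U (a - 1) b := by
    intro i j
    by_cases hi : i = 0
    · subst hi
      rw [if_pos rfl]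
      have h1 : (((0 : Fin n) : ℕ) : ℤ) - 1 = -1 := by simp
      have h2 : (0 : Fin n) - 1 = ⟨n - 1, hlast⟩ := by
        obtain ⟨m, rfl⟩ : ∃ m, n = m + 1 := ⟨n - 1, by omega⟩
        ext
        rw [Fin.coe_sub_one]
        simp
      rw [h1, hI' j j.2, h2]
    · rw [if_neg hi, one_mul, ← h6']
      have hi' : (i : ℕ) ≠ 0 := fun h => hi (Fin.ext (by simpa using h))
      have h2 : ((i - 1 : Fin n) : ℕ) = i - 1 := by
        obtain ⟨m, rfl⟩ : ∃ m, n = m + 1 := ⟨n - 1, by omega⟩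
        rw [Fin.coe_sub_one, if_neg hi]
      rw [h2, ← hI]
      congr 1
      omega
  refine Runs.pairLoop (c := 1) n ((hF1.var 0 rfl).trans hn) hβ hW (by decide) (by decide)
    (by decide) rfl rfl rfl
    (fun i j => T * s1.arr 0 i j + s1.arr 6 ((i : ℤ) - 1) j) ?_ ?_
  · intro i hi j hj s2 hF2 h3 h4
    have e0 : s2.arr 0 (i : ℤ) j = s1.arr 0 i j := by rw [hF2.arr 0 rfl]
    have e6 : s2.arr 6 ((i : ℤ) - 1) j = s1.arr 6 ((i : ℤ) - 1) j := by rw [hF2.arr 6 rfl]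
    have e13 := (hF2.var 13 rfl).trans ((hF1.var 13 rfl).trans h13)
    have hb1 : |s1.arr 0 (i : ℤ) j| ≤ b := by
      have := hB ⟨i, hi⟩ ⟨j, hj⟩
      rw [← h0', ← hF1.arr 0 rfl] at this
      exact this
    have hb2 : |s1.arr 6 ((i : ℤ) - 1) j| ≤ 2 * u := by
      have h := e60 ⟨i, hi⟩ ⟨j, hj⟩
      have h2 := hU (⟨i, hi⟩ - 1) ⟨j, hj⟩
      simp only at h
      rw [h, abs_mul]
      refine mul_le_mul ?_ h2 (abs_nonneg _) (by norm_num)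
      split_ifs
      · rwa [abs_of_nonneg hδ]
      · simp
    have hb3 : |T * s1.arr 0 (i : ℤ) j| ≤ T * b := by
      rw [abs_mul, abs_of_nonneg hT]
      exact mul_le_mul_of_nonneg_left hb1 hT
    refine Runs.store ?_ ?_ ?_ ?_
    · simpa [Expr.Bdd, h3] using by omega
    · simpa [Expr.Bdd, h4] using by omega
    · simp only [Expr.Bdd, Expr.eval, h3, h4, e0, e6, e13]
      refine ⟨⟨?_, ⟨?_, ?_, by omega⟩, by omega⟩, ⟨⟨?_, ?_, ?_⟩, ?_, by omega⟩,
        (abs_add_le _ _).trans (by omega)⟩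
      · rwa [abs_of_nonneg hT]
      · simpa using by omega
      · simpa using by omega
      · simpa using by omega
      · simpa using by omega
      · rw [abs_le]
        constructor <;> omega
      · simpa using by omega
    · intro a' b'
      simp only [Expr.eval, Store.arr_setArr, h3, h4, e0, e6, e13, true_and]
  · intro s2 hF2 h1 i j
    rw [Store.mat, h1, if_pos (by have := i.2; have := j.2; omega)]
    simp only [Int.toNat_natCast]
    rw [e60, hF1.arr 0 rfl, h0']

theorem runs_outputProg [NeZero n] {c : Fin n → ℤ} {N T X : ℤ}
    (hβ : n ≤ β) (hW : n < W) (hn : s.var 0 = n) (h13 : s.var 13 = T) (h15 : s.var 15 = N)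
    (h7 : ∀ j : Fin n, s.arr 7 (j : ℕ) 0 = c j) (hc : ∀ j, |c j| ≤ X) (hXW : X ≤ W)
    (hNW : |N| ≤ W) (hTW : |T| ≤ W) :
    Runs β W outputProg s (fun s' => s'.var 0 = T ∧ ∀ i j, s'.mat n 0 i j =
      if i = 0 then if j = 0 then N else -c j else if i = j then 1 else 0) := by
  have hn1 : 1 ≤ n := NeZero.one_le
  refine Runs.seq (Runs.pairLoop (c := 0) n hn hβ hW (by decide) (by decide)
    (by decide) rfl rfl rfl (fun _ _ => 0) ?_ ?_)
  · intro i hi j hj s1 hF1 h3 h4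
    refine Runs.store ?_ ?_ ?_ ?_
    · simpa [Expr.Bdd, h3] using by omega
    · simpa [Expr.Bdd, h4] using by omega
    · simp [Expr.Bdd]
    · intro a b
      simp [Expr.eval, h3, h4]
  intro s1 hF1 h1
  refine Runs.seq (Runs.forLoop n ((hF1.var 0 rfl).trans hn) hβ hW (by decide) rfl rfl
    (fun k s' => ∀ i j : Fin n, s'.arr 0 (i : ℕ) (j : ℕ) = if (j : ℕ) < k then
      if i = 0 then -c j else if i = j then 1 else 0 else 0) ?_ ?_ ?_)
  · intro i j
    rw [Store.arr_setVar, h1, if_pos (by have := i.2; have := j.2; omega)]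
    simp
  · intro k hk s2 hF2 h4 hI
    have e7 : s2.arr 7 (k : ℤ) 0 = c ⟨k, hk⟩ := by
      rw [hF2.arr 7 rfl, hF1.arr 7 rfl, ← h7]
    have hck := hc ⟨k, hk⟩
    refine Runs.seq (Runs.store ?_ ?_ ?_ ?_)
    · simpa [Expr.Bdd, h4] using by omega
    · simpa [Expr.Bdd, h4] using by omega
    · simp only [Expr.Bdd, abs_one]
      exact_mod_cast (by omega : 1 ≤ W)
    refine Runs.store ?_ ?_ ?_ ?_
    · simp [Expr.Bdd]
    · simpa [Expr.Bdd, h4] using by omega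
    · simp only [Expr.Bdd, Expr.eval, Store.arr_setArr, Store.var_setArr, h4]
      norm_num
      rw [e7]
      omega
    · intro i j
      simp only [Expr.eval, Store.arr_setVar, Store.arr_setArr, Store.var_setArr, h4, hI]
      norm_num
      rw [e7]
      by_cases hjk : (j : ℕ) = k
      · obtain rfl : j = ⟨k, hk⟩ := Fin.ext hjk
        have h5 : ((i : ℕ) = k) = (i = ⟨k, hk⟩) := propext ⟨fun h => Fin.ext h, fun h => by rw [h]⟩
        simp [h5]
      · have h5 : ((j : ℕ) < k) = ((j : ℕ) ≤ k) := propext ⟨fun _ => by omega, fun _ => by omega⟩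
        simp [hjk, h5]
  intro s2 hF2 _ hI
  have e13 := (hF2.var 13 rfl).trans ((hF1.var 13 rfl).trans h13)
  have e15 := (hF2.var 15 rfl).trans ((hF1.var 15 rfl).trans h15)
  -- The loop has left -c 0 in the corner, which N now replaces. Variable 0 is overwritten last,
  -- since the loops take the dimension from it.
  refine Runs.seq (Runs.store ?_ ?_ ?_ (Runs.assign ?_ ⟨?_, ?_⟩))
  · simp [Expr.Bdd]
  · simp [Expr.Bdd]
  · simpa [Expr.Bdd, e15] using hNW
  · simpa [Expr.Bdd, e13] using hTW
  · simp [Expr.eval, e13]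
  · intro i j
    rw [Store.mat]
    simp only [Expr.eval, Store.arr_setVar, Store.arr_setArr, hI, e15, j.2, if_true]
    norm_num
    split_ifs <;> simp_all

end

end SysNF


namespace SysNF

open LogRAM

/-! ### The perturbed lattice -/

section

variable {n : ℕ}

theorem colSpan_mul_of_isUnit (M : Matrix (Fin n) (Fin n) ℤ) {V : Matrix (Fin n) (Fin n) ℤ}
    (hV : IsUnit V.det) : colSpan (M * V) = colSpan M := by
  ext x
  rw [mem_colSpan_iff, mem_colSpan_iff]
  constructor
  · rintro ⟨z, rfl⟩
    exact ⟨V.mulVec z, by rw [Matrix.mulVec_mulVec]⟩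
  · rintro ⟨z, rfl⟩
    refine ⟨V⁻¹.mulVec z, ?_⟩
    rw [Matrix.mulVec_mulVec, Matrix.mul_assoc, Matrix.mul_nonsing_inv _ hV, Matrix.mul_one]

/-- The coordinates are given by a column of the adjugate, up to sign. -/
theorem single_det_mem_colSpan (B : Matrix (Fin n) (Fin n) ℤ) (r : Fin n) :
    Pi.single r |B.det| ∈ colSpan B := by
  have h : Pi.single r B.det ∈ colSpan B := by
    rw [mem_colSpan_iff]
    refine ⟨B.adjugate.mulVec (Pi.single r 1), ?_⟩
    rw [Matrix.mulVec_mulVec, Matrix.mul_adjugate, Matrix.smul_mulVec, Matrix.one_mulVec,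
      ← Pi.single_smul, smul_eq_mul, mul_one]
  rcases abs_choice B.det with h' | h' <;> rw [h']
  · exact h
  · rw [Pi.single_neg]
    exact Submodule.neg_mem _ h

theorem exists_mul_eq_of_colSpan_eq {H B : Matrix (Fin n) (Fin n) ℤ}
    (h : colSpan H = colSpan B) : ∃ U, H * U = B := by
  have : ∀ j, ∃ z, H.mulVec z = B.col j := fun j =>
    mem_colSpan_iff.1 (h ▸ col_mem_colSpan B j)
  choose z hz using this
  refine ⟨Matrix.of fun i j => z j i, ?_⟩
  ext i j
  have := congr_fun (hz j) i
  rw [Matrix.col_apply] at this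
  rw [← this]
  rfl

/-- The determinant of U is a nonzero integer; the inequality is all that is needed, so its being a
unit plays no role. -/
theorem prod_diag_le_abs_det {H U B : Matrix (Fin n) (Fin n) ℤ} (htri : ∀ r c, c < r → H r c = 0)
    (hHU : H * U = B) (hB : B.det ≠ 0) : ∏ i, H i i ≤ |B.det| := by
  have h1 : H.det = ∏ i, H i i := Matrix.det_of_isUpperTriangular fun i j h => htri i j h
  rw [← hHU, Matrix.det_mul] at hB ⊢
  rw [abs_mul, ← h1]
  have : 1 ≤ |U.det| := Int.one_le_abs (right_ne_zero_of_mul hB)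
  exact (le_abs_self _).trans (le_mul_of_one_le_right (abs_nonneg _) this)

/-- The perturbation: ones below the diagonal and `δ` in the upper right corner. -/
def shiftMatrix (n : ℕ) [NeZero n] (δ : ℤ) : Matrix (Fin n) (Fin n) ℤ :=
  Matrix.of fun i j => if j = i - 1 then if i = 0 then δ else 1 else 0

/-- The matrix in systematic normal form with first row `N, -c₁, …, -cₙ₋₁`. -/
def sysMatrix [NeZero n] (N : ℤ) (c : Fin n → ℤ) : Matrix (Fin n) (Fin n) ℤ :=
  Matrix.of fun i j => if i = 0 then if j = 0 then N else -c j else if i = j then 1 else 0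

variable [NeZero n]

theorem shiftMatrix_mulVec (δ : ℤ) (x : Fin n → ℤ) (i : Fin n) :
    (shiftMatrix n δ).mulVec x i = (if i = 0 then δ else 1) * x (i - 1) := by
  simp [Matrix.mulVec, dotProduct, shiftMatrix]

theorem sum_abs_shiftMatrix_le {δ : ℤ} (hδ : 0 ≤ δ) (hδ2 : δ ≤ 2) (x : Fin n → ℤ) :
    ∑ i, |(shiftMatrix n δ).mulVec x i| ≤ 2 * ∑ i, |x i| := by
  rw [← Equiv.sum_comp (Equiv.subRight (1 : Fin n)) fun i => |x i|, Finset.mul_sum]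
  refine Finset.sum_le_sum fun i _ => ?_
  rw [shiftMatrix_mulVec, abs_mul, Equiv.subRight_apply]
  refine mul_le_mul_of_nonneg_right ?_ (abs_nonneg _)
  split_ifs
  · rwa [abs_of_nonneg hδ]
  · simp

theorem val_add_one_eq {j : Fin n} (hj : j + 1 ≠ 0) : ((j + 1 : Fin n) : ℕ) = j + 1 := by
  have := Fin.val_sub_one_of_ne_zero hj
  rw [add_sub_cancel_right] at this
  have h0 : ((j + 1 : Fin n) : ℕ) ≠ 0 := fun h => hj (Fin.ext (by simpa using h))
  rw [this, Nat.sub_add_cancel (Nat.pos_of_ne_zero h0)]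

theorem val_eq_of_add_one_eq_zero {j : Fin n} (hj : j + 1 = 0) : (j : ℕ) + 1 = n := by
  obtain ⟨m, rfl⟩ : ∃ m, n = m + 1 := ⟨n - 1, by have := NeZero.pos n; omega⟩
  have : j = Fin.last m := by
    rw [eq_neg_of_add_eq_zero_left hj]
    ext
    simp [Fin.coe_neg_one]
  rw [this]
  simp

/-- A triangular matrix `H` and integers `c₀, …, cₙ` with the recursion that makes `c₀, …, cₙ₋₁`
orthogonal to all columns of `T • H + shiftMatrix n δ` except the last one. -/
structure IsDual (T : ℤ) (H : Matrix (Fin n) (Fin n) ℤ) (c : ℕ → ℤ) : Prop where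
  tri : ∀ r c, c < r → H r c = 0
  zero : c 0 = 1
  succ : ∀ j : Fin n, c (j + 1) = -(T * ∑ i : Fin n, c i * H i j)

/-- Any nonzero shift at x = 0 would do here; the value 2 is taken because the modulus must also be
even. -/
theorem cornerShift_sub_ne_zero (x : ℤ) : cornerShift x - x ≠ 0 := by
  unfold cornerShift
  split_ifs <;> omega

variable {T : ℤ} {H : Matrix (Fin n) (Fin n) ℤ} {c : ℕ → ℤ}

/-- In column j the part T H contributes -cⱼ₊₁ by the recursion, and the one below the diagonal
contributes cⱼ₊₁. They cancel except in the last column, where the perturbation has δ c₀ = δ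
instead. -/
theorem IsDual.vecMul (h : IsDual T H c) (δ : ℤ) (j : Fin n) :
    ∑ i : Fin n, c i * (T • H + shiftMatrix n δ) i j = if j + 1 = 0 then δ - c n else 0 := by
  have h1 : ∑ i : Fin n, c i * (shiftMatrix n δ) i j =
      c (j + 1 : Fin n) * (if j + 1 = 0 then δ else 1) := by
    rw [Finset.sum_eq_single (j + 1)]
    · simp [shiftMatrix]
    · intro i _ hi
      rw [shiftMatrix, Matrix.of_apply, if_neg, mul_zero]
      rintro rfl
      exact hi (by simp)
    · simp
  have h2 : ∑ i : Fin n, c i * (T • H) i j = -c (j + 1) := by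
    rw [h.succ, neg_neg, Finset.mul_sum]
    refine Finset.sum_congr rfl fun i _ => ?_
    rw [Matrix.smul_apply, smul_eq_mul]
    ring
  simp only [Matrix.add_apply, mul_add]
  rw [Finset.sum_add_distrib, h1, h2]
  split_ifs with hj
  · rw [hj, val_eq_of_add_one_eq_zero hj]
    simp [h.zero]
    ring
  · rw [val_add_one_eq hj]
    ring

/-- Below the first row the matrix in normal form is the identity, so V must agree with G there. Its
first row is forced by c · G to be zero except for the last entry, the sign s of δ - cₙ. -/
theorem IsDual.exists_unimodular (h : IsDual T H c) {δ N : ℤ} (hN : N = |δ - c n|) :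
    ∃ V : Matrix (Fin n) (Fin n) ℤ, IsUnit V.det ∧
      sysMatrix N (fun j => c j) * V = T • H + shiftMatrix n δ := by
  obtain ⟨s, hs, hsN⟩ : ∃ s : ℤ, IsUnit s ∧ δ - c n = s * N := by
    rcases abs_choice (δ - c n) with h' | h'
    · exact ⟨1, isUnit_one, by rw [hN, h', one_mul]⟩
    · exact ⟨-1, isUnit_one.neg, by rw [hN, h']; ring⟩
  set G := T • H + shiftMatrix n δ with hG
  set V : Matrix (Fin n) (Fin n) ℤ := Matrix.of fun i j =>
    if i = 0 then if j + 1 = 0 then s else 0 else G i j with hV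
  refine ⟨V, ?_, ?_⟩
  -- Moving the first row of V to the bottom brings the ones below the diagonal onto the diagonal
  -- and makes the matrix upper triangular, with diagonal 1, …, 1, s.
  · have h1 := Matrix.det_permute (Equiv.addRight (1 : Fin n)) V
    have h2 : (V.submatrix (Equiv.addRight (1 : Fin n)) id).det =
        ∏ i : Fin n, V (i + 1) i := by
      refine Matrix.det_of_isUpperTriangular fun i j hij => ?_
      change j < i at hij
      have hij' : (j : ℕ) < i := hij
      simp only [Matrix.submatrix_apply, Equiv.coe_addRight, id, hV, Matrix.of_apply]
      split_ifs with h0 h0'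
      · have := val_eq_of_add_one_eq_zero h0
        have := val_eq_of_add_one_eq_zero h0'
        omega
      · rfl
      · have hi := val_add_one_eq h0
        rw [hG, Matrix.add_apply, Matrix.smul_apply, h.tri _ _ (by rw [Fin.lt_def]; omega),
          shiftMatrix, Matrix.of_apply, if_neg]
        · simp
        · rw [add_sub_cancel_right]
          exact hij.ne
    have h3 : IsUnit (∏ i : Fin n, V (i + 1) i) := by
      refine IsUnit.prod_univ_iff.2 fun i => ?_
      simp only [hV, Matrix.of_apply]
      split_ifs with h0
      · exact hs
      · have hi := val_add_one_eq h0
        rw [hG, Matrix.add_apply, Matrix.smul_apply, h.tri _ _ (by rw [Fin.lt_def]; omega),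
          shiftMatrix, Matrix.of_apply, if_pos (by simp), if_neg h0]
        simp
    rw [← h2, h1] at h3
    exact isUnit_of_mul_isUnit_right h3
  · ext i j
    rw [Matrix.mul_apply]
    by_cases hi : i = 0
    · subst hi
      have hv := h.vecMul δ j
      rw [← hG, ← Finset.add_sum_erase _ _ (Finset.mem_univ 0)] at hv
      rw [← Finset.add_sum_erase _ _ (Finset.mem_univ 0)]
      have h0 : sysMatrix N (fun j : Fin n => c j) 0 0 * V 0 j =
          if j + 1 = 0 then δ - c n else 0 := by
        simp only [sysMatrix, hV, Matrix.of_apply, if_true, mul_ite, mul_zero, hsN, mul_comm]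
      have h1 : ∑ k ∈ Finset.univ.erase 0, sysMatrix N (fun j : Fin n => c j) 0 k * V k j =
          -∑ k ∈ Finset.univ.erase 0, c (k : Fin n) * G k j := by
        rw [← Finset.sum_neg_distrib]
        refine Finset.sum_congr rfl fun k hk => ?_
        simp only [sysMatrix, hV, Matrix.of_apply, if_true, if_neg (Finset.ne_of_mem_erase hk)]
        ring
      have h2 : c ((0 : Fin n) : ℕ) = 1 := by simpa using h.zero
      rw [h2, one_mul] at hv
      rw [h0, h1, ← hv]
      ring
    · rw [Finset.sum_eq_single i]
      · simp [sysMatrix, hV, hi]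
      · intro k _ hk
        simp [sysMatrix, hi, hk.symm]
      · simp

theorem det_sysMatrix (N : ℤ) (c : Fin n → ℤ) : (sysMatrix N c).det = N := by
  rw [Matrix.det_of_isUpperTriangular]
  · rw [Finset.prod_eq_single 0]
    · simp [sysMatrix]
    · intro i _ hi
      simp [sysMatrix, hi]
    · simp
  · intro i j hij
    change j < i at hij
    have : i ≠ 0 := by
      rintro rfl
      exact absurd hij (by simp)
    simp [sysMatrix, this, hij.ne']

/-- This is a parity argument: for even T all of c₁, …, cₙ are even, hence so is N, whereas the sum
of squares plus one is odd. -/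
theorem IsDual.isSysNF (h : IsDual T H c) (hT : Even T) {N : ℤ}
    (hN : N = |cornerShift (c n) - c n|) : IsSysNF (sysMatrix N (fun j : Fin n => c j)) := by
  have hodd : ∀ j : Fin n, Even (c (j + 1)) := fun j => by
    rw [h.succ]
    exact (hT.mul_right _).neg
  have heven : Even (cornerShift (c n)) := by
    unfold cornerShift
    split_ifs <;> decide
  have hNe : Even N := by
    have h1 : Even (c n) := by
      have h2 := NeZero.pos n
      have := hodd ⟨n - 1, by omega⟩
      simp only at this
      rwa [Nat.sub_add_cancel h2] at this
    rw [hN, even_abs]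
    exact heven.sub h1
  refine ⟨?_, ?_, ?_, ?_⟩
  · simp only [sysMatrix, Matrix.of_apply, if_true, hN]
    exact abs_pos.2 (cornerShift_sub_ne_zero _)
  · intro i hi
    simp [sysMatrix, hi]
  · intro i hi j hj
    simp [sysMatrix, hi, hj.symm]
  · intro hmod
    have h0 : sysMatrix N (fun j : Fin n => c j) 0 0 = N := by simp [sysMatrix]
    rw [h0] at hmod
    have h2 : (2 : ℤ) ∣ ∑ i ∈ Finset.univ.erase (0 : Fin n),
        sysMatrix N (fun j : Fin n => c j) 0 i ^ 2 + 1 :=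
      (even_iff_two_dvd.1 hNe).trans (Int.modEq_zero_iff_dvd.1 hmod)
    have h3 : (2 : ℤ) ∣ ∑ i ∈ Finset.univ.erase (0 : Fin n),
        sysMatrix N (fun j : Fin n => c j) 0 i ^ 2 := by
      refine Finset.dvd_sum fun i hi => ?_
      have hi0 := Finset.ne_of_mem_erase hi
      have h4 : (i : ℕ) ≠ 0 := fun h => hi0 (Fin.ext (by simpa using h))
      have h5 := hodd ⟨i - 1, by omega⟩
      simp only at h5
      rw [Nat.sub_add_cancel (by omega)] at h5
      have : sysMatrix N (fun j : Fin n => c j) 0 i = -c i := by simp [sysMatrix, hi0]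
      rw [this, neg_sq]
      exact (even_iff_two_dvd.1 h5).trans (dvd_pow_self _ (by norm_num))
    omega

end

/-! ### Embedding into Euclidean space -/

section

variable {n : ℕ}

/-- The inclusion of the integer vectors into Euclidean space. -/
noncomputable def intEmb (n : ℕ) : (Fin n → ℤ) →ₗ[ℤ] EuclideanSpace ℝ (Fin n) where
  toFun x := WithLp.toLp 2 fun i => (x i : ℝ)
  map_add' x y := by
    ext i
    simp
  map_smul' m x := by
    ext i
    simp

theorem intEmb_injective : Function.Injective (intEmb n) := fun x y h => by
  ext i
  have := congr_arg (fun v : EuclideanSpace ℝ (Fin n) => v i) h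
  simpa [intEmb] using this

theorem latticeOf_eq_map (B : Matrix (Fin n) (Fin n) ℤ) :
    latticeOf B = (colSpan B).map (intEmb n) := by
  rw [latticeOf, colSpan, Submodule.map_span, ← Set.range_comp]
  rfl

theorem norm_intEmb_le (x : Fin n → ℤ) : ‖intEmb n x‖ ≤ ((∑ i, |x i| : ℤ) : ℝ) := by
  rw [EuclideanSpace.norm_eq]
  push_cast
  refine Real.sqrt_le_iff.2 ⟨Finset.sum_nonneg fun _ _ => abs_nonneg _, ?_⟩
  have : ∀ i, ‖(intEmb n x) i‖ = |(x i : ℝ)| := fun i => Real.norm_eq_abs _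
  simp only [this]
  exact Finset.sum_sq_le_sq_sum_of_nonneg fun _ _ => abs_nonneg _

theorem sum_abs_le_norm_intEmb (x : Fin n → ℤ) :
    ((∑ i, |x i| : ℤ) : ℝ) ≤ n * ‖intEmb n x‖ := by
  push_cast
  calc ∑ i, |(x i : ℝ)| ≤ ∑ _i : Fin n, ‖intEmb n x‖ :=
        Finset.sum_le_sum fun i _ => PiLp.norm_apply_le (intEmb n x) i
    _ = n * ‖intEmb n x‖ := by simp

theorem intEmb_comp_injective {H : Matrix (Fin n) (Fin n) ℤ} (hH : H.det ≠ 0) :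
    Function.Injective (intEmb n ∘ₗ H.mulVecLin) := by
  refine intEmb_injective.comp ?_
  exact Matrix.mulVec_injective_of_det_ne_zero hH

theorem range_intEmb_comp (H : Matrix (Fin n) (Fin n) ℤ) :
    LinearMap.range (intEmb n ∘ₗ H.mulVecLin) = latticeOf H := by
  rw [latticeOf_eq_map, LinearMap.range_comp]
  congr 1
  ext x
  rw [mem_colSpan_iff]
  rfl

/-- The isomorphism of two lattices that maps one basis to another. -/
noncomputable def latticeEquiv {H G B B' : Matrix (Fin n) (Fin n) ℤ} (hH : H.det ≠ 0)
    (hG : G.det ≠ 0) (hB : latticeOf H = latticeOf B) (hB' : latticeOf G = latticeOf B') :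
    latticeOf B ≃ₗ[ℤ] latticeOf B' :=
  (LinearEquiv.ofEq _ _ ((range_intEmb_comp H).trans hB)).symm.trans
    (((LinearEquiv.ofInjective _ (intEmb_comp_injective hH)).symm.trans
      (LinearEquiv.ofInjective _ (intEmb_comp_injective hG))).trans
        (LinearEquiv.ofEq _ _ ((range_intEmb_comp G).trans hB')))

theorem latticeEquiv_apply {H G B B' : Matrix (Fin n) (Fin n) ℤ} (hH : H.det ≠ 0)
    (hG : G.det ≠ 0) (hB : latticeOf H = latticeOf B) (hB' : latticeOf G = latticeOf B')
    (v : latticeOf B) (z : Fin n → ℤ) (hv : (v : EuclideanSpace ℝ (Fin n)) = intEmb n (H.mulVec z)) :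
    (latticeEquiv hH hG hB hB' v : EuclideanSpace ℝ (Fin n)) = intEmb n (G.mulVec z) := by
  have : (LinearEquiv.ofInjective _ (intEmb_comp_injective hH)).symm
      ((LinearEquiv.ofEq _ _ ((range_intEmb_comp H).trans hB)).symm v) = z := by
    rw [LinearEquiv.symm_apply_eq]
    ext1
    exact hv
  simp only [latticeEquiv, LinearEquiv.trans_apply]
  rw [this]
  rfl

/-- The perturbation moves the vectors of the lattice by a relative error of at most `ε`. -/
theorem exists_latticeEquiv [NeZero n] {B H U B' : Matrix (Fin n) (Fin n) ℤ} {T δ : ℤ} {ε : ℝ}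
    (hB : B.det ≠ 0) (hT : 0 < T) (htri : ∀ r c, c < r → H r c = 0)
    (hpos : ∀ r, 0 < H r r) (hnonneg : ∀ r c, 0 ≤ H r c) (hred : ∀ r c, r < c → H r c < H r r)
    (hspan : colSpan H = colSpan B) (hHU : H * U = B) (hδ : 0 ≤ δ) (hδ2 : δ ≤ 2)
    (hG : (T • H + shiftMatrix n δ).det ≠ 0)
    (hB' : colSpan (T • H + shiftMatrix n δ) = colSpan B')
    (hTε : 2 * (n * (|B.det| : ℤ)) ≤ ε * T) :
    ∃ σ : latticeOf B ≃ₗ[ℤ] latticeOf B',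
      (∀ j, (σ ⟨colVec B j, colVec_mem B j⟩ : EuclideanSpace ℝ (Fin n)) =
        colVec ((T • H + shiftMatrix n δ) * U) j) ∧
      ∀ v : latticeOf B, ‖(T : ℝ)⁻¹ • (σ v : EuclideanSpace ℝ (Fin n)) -
        (v : EuclideanSpace ℝ (Fin n))‖ ≤ ε * ‖(v : EuclideanSpace ℝ (Fin n))‖ := by
  have hH : H.det ≠ 0 := by
    intro h0
    apply hB
    rw [← hHU, Matrix.det_mul, h0, zero_mul]
  have hL : latticeOf H = latticeOf B := by rw [latticeOf_eq_map, latticeOf_eq_map, hspan]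
  have hL' : latticeOf (T • H + shiftMatrix n δ) = latticeOf B' := by
    rw [latticeOf_eq_map, latticeOf_eq_map, hB']
  refine ⟨latticeEquiv hH hG hL hL', fun j => ?_, fun v => ?_⟩
  · rw [latticeEquiv_apply hH hG hL hL' _ (U.col j)]
    · rfl
    · change colVec B j = _
      rw [← hHU]
      rfl
  · obtain ⟨z, hz⟩ : ∃ z, intEmb n (H.mulVec z) = v := by
      have : (v : EuclideanSpace ℝ (Fin n)) ∈ LinearMap.range (intEmb n ∘ₗ H.mulVecLin) := by
        rw [range_intEmb_comp, hL]
        exact v.2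
      exact this
    rw [latticeEquiv_apply hH hG hL hL' v z hz.symm, ← hz]
    have hT' : (0 : ℝ) < T := by exact_mod_cast hT
    have h1 : (T • H + shiftMatrix n δ).mulVec z =
        T • H.mulVec z + (shiftMatrix n δ).mulVec z := by
      rw [Matrix.add_mulVec, Matrix.smul_mulVec]
    -- The main part T H z cancels exactly, and only the perturbation of the coordinate vector z
    -- remains.
    have h2 : (T : ℝ)⁻¹ • intEmb n ((T • H + shiftMatrix n δ).mulVec z) - intEmb n (H.mulVec z) =
        (T : ℝ)⁻¹ • intEmb n ((shiftMatrix n δ).mulVec z) := by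
      rw [h1, map_add, map_smul, smul_add, ← Int.cast_smul_eq_zsmul ℝ, smul_smul,
        inv_mul_cancel₀ hT'.ne', one_smul, add_sub_cancel_left]
    rw [h2, norm_smul, norm_inv, Real.norm_eq_abs, abs_of_pos hT', inv_mul_le_iff₀ hT']
    -- The coordinates z are controlled by the vector Hz in the 1-norm; passing to the Euclidean
    -- norm costs the factor n.
    have h3 : (∑ i, |(shiftMatrix n δ).mulVec z i| : ℤ) ≤
        2 * (|B.det| * ∑ i, |H.mulVec z i|) := by
      refine (sum_abs_shiftMatrix_le hδ hδ2 z).trans (mul_le_mul_of_nonneg_left ?_ (by norm_num))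
      refine (sum_abs_le_of_reduced htri hpos hnonneg hred z).trans ?_
      exact mul_le_mul_of_nonneg_right (prod_diag_le_abs_det htri hHU hB)
        (Finset.sum_nonneg fun _ _ => abs_nonneg _)
    have h4 := norm_intEmb_le ((shiftMatrix n δ).mulVec z)
    have h5 := sum_abs_le_norm_intEmb (H.mulVec z)
    have h6 : (((∑ i, |(shiftMatrix n δ).mulVec z i|) : ℤ) : ℝ) ≤
        2 * ((|B.det| : ℤ) * ((∑ i, |H.mulVec z i| : ℤ) : ℝ)) := by exact_mod_cast h3
    have h7 : (0 : ℝ) ≤ (|B.det| : ℤ) := by exact_mod_cast abs_nonneg _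
    have h8 := norm_nonneg (intEmb n (H.mulVec z))
    calc ‖intEmb n ((shiftMatrix n δ).mulVec z)‖ ≤
          2 * ((|B.det| : ℤ) * (n * ‖intEmb n (H.mulVec z)‖)) :=
        h4.trans (h6.trans (by gcongr))
      _ = (2 * (n * (|B.det| : ℤ))) * ‖intEmb n (H.mulVec z)‖ := by ring
      _ ≤ (ε * T) * ‖intEmb n (H.mulVec z)‖ := mul_le_mul_of_nonneg_right hTε h8
      _ = T * (ε * ‖intEmb n (H.mulVec z)‖) := by ring

end

end SysNF


namespace SysNF

open LogRAM

/-! ### The algorithm -/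

/-- Replace the variable `7` by its absolute value. -/
def absProg : Program := .branch (.var 7) .skip (.assign 7 (.sub (.const 0) (.var 7)))

/-- The scaling factor. -/
def scaleExpr : Expr :=
  .mul (.const 2) (.add (.div (.mul (.mul (.var 0) (.var 7)) (.var 2)) (.var 1)) (.const 1))

/-- The whole algorithm. -/
def sysNFProg : Program :=
  .seq flProg (.seq absProg (.seq triProg (.seq reduceProg (.seq solveProg
    (.seq (.assign 13 scaleExpr) (.seq dualProg (.seq modulusProg
      (.seq imageProg outputProg))))))))

theorem runs_absProg {β W : ℕ} {s : Store} {x : ℤ} (h7 : s.var 7 = x) (hx : |x| ≤ W) :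
    Runs β W absProg s (fun s' => s'.var 7 = |x|) := by
  refine Runs.branch ?_ (fun h => ?_) (fun h => ?_)
  · simpa [Expr.Bdd, h7] using hx
  · have h : 0 < x := by simpa [Expr.eval, h7] using h
    exact ⟨_, _, Exec.skip _, by simp [Program.steps], h7.trans (abs_of_pos h).symm⟩
  · have h : x ≤ 0 := by simpa [Expr.eval, h7] using h
    refine Runs.assign ?_ ?_
    · simpa [Expr.Bdd, Expr.eval, h7] using hx
    · simp [Expr.eval, h7, abs_of_nonpos h]

/-- The scaling factor, as a function of the dimension, the determinant, and the denominator and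
numerator of the precision. -/
def scaleFactor (n : ℕ) (D den num : ℤ) : ℤ := 2 * (n * D * den / num + 1)

/-- The relation between the input matrix and the memory at the end of the computation. -/
structure IsResult {n : ℕ} [NeZero n] (B : Matrix (Fin n) (Fin n) ℤ) (T : ℤ) (s : Store)
    (H U : Matrix (Fin n) (Fin n) ℤ) (c : ℕ → ℤ) : Prop where
  basis : IsTriBasis |B.det| (colSpan B) H
  red : ∀ r c, r < c → H r c < H r r
  mul : H * U = B
  dual : IsDual T H c
  scale : s.var 0 = T
  sys : s.mat n 0 = sysMatrix |cornerShift (c n) - c n| (fun j => c j)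
  image : s.mat n 1 = (T • H + shiftMatrix n (cornerShift (c n))) * U

/-- The determinant is, up to sign, the last coefficient of the recursion, so the size bound already
proved for the recursion serves in place of Hadamard's inequality. -/
theorem abs_det_le {n : ℕ} [NeZero n] {B : Matrix (Fin n) (Fin n) ℤ} {b : ℤ}
    (hb : 1 ≤ b) (hB : ∀ i j, |B i j| ≤ b) : |B.det| ≤ (2 * n ^ 2 * b) ^ n := by
  have hn := NeZero.pos n
  rw [← abs_flCoeff_pred B]
  refine (abs_flCoeff_le hB (abs_flMat_le hB _)).trans ?_
  obtain ⟨m, rfl⟩ : ∃ m, n = m + 1 := ⟨n - 1, by omega⟩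
  rw [Nat.add_sub_cancel, pow_succ _ m]
  have h : (0 : ℤ) ≤ (2 * ((m + 1 : ℕ) : ℤ) ^ 2 * b) ^ m := by positivity
  have h' : 0 ≤ ((m + 1 : ℕ) : ℤ) ^ 2 * b * (2 * ((m + 1 : ℕ) : ℤ) ^ 2 * b) ^ m := by positivity
  nlinarith

/-- The stages communicate through fixed cells: variable 7 holds D and 13 holds T; array 0 holds B
until the output is written, 3 the triangular basis, 6 the coordinates U and 7 the dual vector. The
frame conditions carry these past the stages that do not write them. -/
theorem runs_sysNFProg {β W n L : ℕ} [NeZero n] {s : Store} {B : Matrix (Fin n) (Fin n) ℤ}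
    {num den b D T : ℤ} (hn : s.var 0 = n) (h1 : s.var 1 = num) (h2 : s.var 2 = den)
    (h0 : s.mat n 0 = B) (ha : ∀ a ≠ 0, s.arr a = 0) (hB : B.det ≠ 0) (hnum : 0 < num)
    (hden : 0 < den) (hb : 1 ≤ b) (hBb : ∀ i j, |B i j| ≤ b) (hD : D = |B.det|)
    (hT : T = scaleFactor n D den num) (hβ : n ≤ β) (hL : L ≤ β) (hDL : 2 * D ^ 2 < 2 ^ L)
    (hnumW : num ≤ W) (hflW : (2 * n ^ 2 * b) ^ (n + 1) ≤ W) (hDW : 2 * D ^ 2 ≤ W)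
    (hsolveW : n * (D * (D * (n * b))) + b ≤ W)
    (hscaleW : 2 * (n * D * den + 1) ≤ W) (hdualW : (T * n * D) ^ (n + 1) + 2 ≤ W)
    (himgW : T * b + 2 * (D * (n * b)) + 2 ≤ W) :
    Runs β W sysNFProg s (fun s' => ∃ H U c, IsResult B T s' H U c) := by
  have hn1 : 1 ≤ n := NeZero.one_le
  have hn1' : (1 : ℤ) ≤ n := by exact_mod_cast hn1
  have hD1 : 1 ≤ D := by
    rw [hD]
    exact Int.one_le_abs hB
  have hDn : 0 ≤ n * D := by positivity
  have hquot0 : 0 ≤ n * D * den / num := Int.ediv_nonneg (by positivity) hnum.le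
  have hquot : n * D * den / num ≤ n * D * den := Int.ediv_le_self _ (by positivity)
  have hT2 : 2 ≤ T := by
    rw [hT, scaleFactor]
    omega
  have hTW : T ≤ W := by
    rw [hT, scaleFactor]
    omega
  have hnD : n * D ≤ n * D * den := le_mul_of_one_le_right hDn (by omega)
  have hDle : D ≤ n * D := le_mul_of_one_le_left (by omega) hn1'
  have hnle : (n : ℤ) ≤ n * D := le_mul_of_one_le_right (by omega) hD1
  have hdle : den ≤ n * D * den := le_mul_of_one_le_left hden.le (by omega)
  have hnW : n < W := by
    have : (n : ℤ) < W := by omega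
    exact_mod_cast this
  have hX1 : 1 ≤ T * n * D := by
    have : 1 ≤ T * n := by nlinarith
    nlinarith
  have hXn : (T * n * D) ^ n ≤ (T * n * D) ^ (n + 1) := pow_le_pow_right₀ hX1 (Nat.le_succ n)
  have hbn : b ≤ n * b := le_mul_of_one_le_left (by omega) hn1'
  have hu0 : 0 ≤ D * (n * b) := by positivity
  have hbW : b ≤ W := by
    have : 0 ≤ n * (D * (D * (n * b))) := by positivity
    omega
  have hDcol : ∀ r : Fin n, Pi.single r D ∈ colSpan B := fun r => hD ▸ single_det_mem_colSpan B r
  refine Runs.seq ((runs_flProg hβ hn h0 (ha 2 (by decide)) hb hBb hflW).frame.mono ?_)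
  rintro s1 ⟨h7, hF1⟩
  have hdet : |flCoeff B (n - 1)| = D := by rw [abs_flCoeff_pred, hD]
  refine Runs.seq ((runs_absProg h7 (by rw [hdet]; omega)).frame.mono ?_)
  rintro s2 ⟨h7, hF2⟩
  rw [hdet] at h7
  have n2 : s2.var 0 = n := (hF2.var 0 rfl).trans ((hF1.var 0 rfl).trans hn)
  have m2 : s2.mat n 0 = B := (hF2.mat rfl n).trans ((hF1.mat rfl n).trans h0)
  refine Runs.seq ((runs_triProg hβ hL hnW hDW hDL (fun i j => (hBb i j).trans hbW) n2 h7 m2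
    ((hF2.arr 3 rfl).trans ((hF1.arr 3 rfl).trans (ha 3 (by decide)))) (by omega)
    hDcol).frame.mono ?_)
  rintro s3 ⟨hH, hF3⟩
  have n3 : s3.var 0 = n := (hF3.var 0 rfl).trans n2
  refine Runs.seq ((runs_reduceProg hβ hnW hDW n3 ((hF3.var 7 rfl).trans h7) rfl hH
    hDcol).frame.mono ?_)
  rintro s4 ⟨⟨hH, hred⟩, hF4⟩
  have n4 : s4.var 0 = n := (hF4.var 0 rfl).trans n3
  have m4 : s4.mat n 0 = B := (hF4.mat rfl n).trans ((hF3.mat rfl n).trans m2)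
  have e67 : s4.arr 6 = 0 ∧ s4.arr 7 = 0 := by
    constructor
    · rw [hF4.arr 6 rfl, hF3.arr 6 rfl, hF2.arr 6 rfl, hF1.arr 6 rfl, ha 6 (by decide)]
    · rw [hF4.arr 7 rfl, hF3.arr 7 rfl, hF2.arr 7 rfl, hF1.arr 7 rfl, ha 7 (by decide)]
  obtain ⟨U, hU⟩ := exists_mul_eq_of_colSpan_eq hH.span
  generalize hHeq : s4.mat n 3 = H at *
  have hHb : ∀ r c, |H r c| ≤ D := fun r c => by
    rw [abs_of_nonneg (hH.nonneg r c)]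
    exact hH.le r c
  -- A column of U consists of the coordinates of a column of B, so the estimate behind the
  -- approximation also bounds the back substitution.
  have hUb : ∀ r c, |U r c| ≤ D * (n * b) := fun r c => by
    have h3 := sum_abs_le_of_reduced hH.tri hH.pos hH.nonneg hred (fun i => U i c)
    have h4 : ∀ i, H.mulVec (fun i => U i c) i = B i c := fun i => by
      rw [← hU]
      rfl
    simp only [h4] at h3
    refine (Finset.single_le_sum (f := fun i => |U i c|) (fun _ _ => abs_nonneg _)
      (Finset.mem_univ r)).trans (h3.trans ?_)
    refine mul_le_mul (hD ▸ prod_diag_le_abs_det hH.tri hU hB) ?_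
      (Finset.sum_nonneg fun _ _ => abs_nonneg _) (by omega)
    exact (Finset.sum_le_sum fun i _ => hBb i c).trans (by simp)
  have huW : D * (n * b) ≤ W := by
    have : 0 ≤ T * b := mul_nonneg (by omega) (by omega)
    omega
  refine Runs.seq ((runs_solveProg hβ hnW n4 m4 hHeq e67.1 hH.tri hH.pos hU hHb hUb hBb (by omega)
    huW hsolveW).frame.mono ?_)
  rintro s5 ⟨hU6, hF5⟩
  have e1 : s5.var 1 = num := by
    rw [hF5.var 1 rfl, hF4.var 1 rfl, hF3.var 1 rfl, hF2.var 1 rfl, hF1.var 1 rfl, h1]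
  have e2 : s5.var 2 = den := by
    rw [hF5.var 2 rfl, hF4.var 2 rfl, hF3.var 2 rfl, hF2.var 2 rfl, hF1.var 2 rfl, h2]
  have e7 : s5.var 7 = D := by
    rw [hF5.var 7 rfl, hF4.var 7 rfl, hF3.var 7 rfl, h7]
  have n5 : s5.var 0 = n := (hF5.var 0 rfl).trans n4
  refine Runs.seq (Runs.assign ?_ ?_)
  · simp only [scaleExpr, Expr.Bdd, Expr.eval, e1, e2, e7, n5]
    refine ⟨?_, ⟨⟨⟨⟨?_, ?_, ?_⟩, ?_, ?_⟩, ?_⟩, ?_, ?_⟩, ?_⟩ <;>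
      rw [abs_of_nonneg (by omega)] <;> omega
  have hTe : scaleExpr.eval s5 = T := by
    simp only [scaleExpr, Expr.eval, e1, e2, e7, n5, hT, scaleFactor]
  rw [hTe]
  have m5 : (s5.setVar 13 T).mat n 0 = B := (hF5.mat rfl n).trans m4
  have H5 : (s5.setVar 13 T).mat n 3 = H := (hF5.mat rfl n).trans hHeq
  have U5 : (s5.setVar 13 T).mat n 6 = U := hU6
  have n5' : (s5.setVar 13 T).var 0 = n := by simpa using n5
  refine Runs.seq ((runs_dualProg (T := T) hβ hnW n5' (by simp) H5
    ((hF5.arr 7 rfl).trans e67.2) hH.tri hHb hD1 (by omega) (by omega)).frame.mono ?_)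
  rintro s6 ⟨⟨hc0, hc1, hc2⟩, hF6⟩
  have hdual : IsDual T H (fun i => s6.arr 7 (i : ℕ) 0) := ⟨hH.tri, by simpa using hc0, hc1⟩
  generalize hceq : (fun i : ℕ => s6.arr 7 (i : ℤ) 0) = c at *
  have hc : ∀ i : ℕ, s6.arr 7 (i : ℤ) 0 = c i := fun i => by rw [← hceq]
  have hcb : ∀ i ≤ n, |c i| ≤ (T * n * D) ^ n := fun i hi => by
    rw [← hc]
    exact hc2 i hi
  have n6 : s6.var 0 = n := (hF6.var 0 rfl).trans n5'
  have hcn := hcb n le_rfl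
  refine Runs.seq ((runs_modulusProg hnW (by omega) n6 (hc n) (by omega)).frame.mono ?_)
  rintro s7 ⟨⟨h14, h15⟩, hF7⟩
  have hδ : 0 ≤ cornerShift (c n) ∧ cornerShift (c n) ≤ 2 := by
    unfold cornerShift
    split_ifs <;> simp
  have n7 : s7.var 0 = n := (hF7.var 0 rfl).trans n6
  have T7 : s7.var 13 = T := by
    rw [hF7.var 13 rfl, hF6.var 13 rfl]
    simp
  refine Runs.seq ((runs_imageProg hβ hnW n7 ((hF7.mat rfl n).trans ((hF6.mat rfl n).trans m5))
    ((hF7.mat rfl n).trans ((hF6.mat rfl n).trans U5)) T7 h14 (by omega) hδ.1 hδ.2 hBb hUb hbW hTW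
    himgW).frame.mono ?_)
  rintro s8 ⟨hA, hF8⟩
  have hNW : |cornerShift (c n) - c n| ≤ W := by
    refine (abs_sub _ _).trans ?_
    rw [abs_of_nonneg hδ.1]
    omega
  refine (runs_outputProg (c := fun j => c j) (X := (T * n * D) ^ n) hβ hnW
    ((hF8.var 0 rfl).trans n7) ((hF8.var 13 rfl).trans T7) ((hF8.var 15 rfl).trans h15) ?_
    (fun j => hcb j j.2.le) (by omega) (by rwa [abs_abs]) ?_).frame.mono ?_
  · intro j
    rw [hF8.arr 7 rfl, hF7.arr 7 rfl, hc]
  · rwa [abs_of_nonneg (by omega)]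
  rintro s9 ⟨⟨hT0, hB'⟩, hF9⟩
  refine ⟨H, U, c, hD ▸ hH, hred, hU, hdual, hT0, ?_, ?_⟩
  · ext i j
    rw [hB']
    rfl
  · ext i j
    rw [hF9.mat rfl n, hA, Matrix.add_mul, Matrix.smul_mul, hU, Matrix.add_apply,
      Matrix.smul_apply, smul_eq_mul]
    congr 1
    exact (shiftMatrix_mulVec _ (fun i => U i j) i).symm

/-! ### Size bounds -/

theorem abs_lt_two_pow_bitLen (z : ℤ) : |z| < 2 ^ bitLen z := by
  rw [Int.abs_eq_natAbs, bitLen]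
  have h := Nat.lt_size_self z.natAbs
  have : z.natAbs < 2 ^ (z.natAbs.size + 1) :=
    h.trans_le (Nat.pow_le_pow_right (by norm_num) (Nat.le_succ _))
  exact_mod_cast this

section

variable {n : ℕ} (B : Matrix (Fin n) (Fin n) ℤ) (ε : ℚ)

theorem abs_entry_le (i j : Fin n) : |B i j| ≤ 2 ^ inputSize B ε := by
  refine (abs_lt_two_pow_bitLen _).le.trans (pow_le_pow_right₀ (by norm_num) ?_)
  have h1 : bitLen (B i j) ≤ ∑ j, bitLen (B i j) :=
    Finset.single_le_sum (f := fun j => bitLen (B i j)) (fun _ _ => Nat.zero_le _)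
      (Finset.mem_univ j)
  have h2 : ∑ j, bitLen (B i j) ≤ ∑ i, ∑ j, bitLen (B i j) :=
    Finset.single_le_sum (f := fun i => ∑ j, bitLen (B i j)) (fun _ _ => Nat.zero_le _)
      (Finset.mem_univ i)
  unfold inputSize
  omega

theorem abs_num_le : |ε.num| ≤ 2 ^ inputSize B ε := by
  refine (abs_lt_two_pow_bitLen _).le.trans (pow_le_pow_right₀ (by norm_num) ?_)
  unfold inputSize
  omega

theorem abs_den_le : |(ε.den : ℤ)| ≤ 2 ^ inputSize B ε := by
  refine (abs_lt_two_pow_bitLen _).le.trans (pow_le_pow_right₀ (by norm_num) ?_)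
  unfold inputSize
  omega

/-- Each of the n² entries takes at least one bit, even if it is zero. -/
theorem dim_le_inputSize [NeZero n] : n ≤ inputSize B ε := by
  have h : ∑ _i : Fin n, ∑ _j : Fin n, 1 ≤ ∑ i, ∑ j, bitLen (B i j) :=
    Finset.sum_le_sum fun i _ => Finset.sum_le_sum fun j _ => Nat.succ_le_succ (Nat.zero_le _)
  simp only [Finset.sum_const, Finset.card_univ, Fintype.card_fin, smul_eq_mul, mul_one] at h
  have h2 := Nat.le_mul_self n
  unfold inputSize
  omega

end

/-- All numbers that occur are small enough. -/
theorem size_bounds {n S : ℕ} {D num den T b : ℤ} (hn1 : 1 ≤ n) (hnS : n ≤ S)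
    (hb : b = 2 ^ S) (hnum : num ≤ 2 ^ S) (hden : den ≤ 2 ^ S) (hden0 : 0 < den)
    (hnum0 : 0 < num) (hD0 : 0 ≤ D) (hD : D ≤ (2 * n ^ 2 * b) ^ n)
    (hT : T = scaleFactor n D den num) :
    2 * D ^ 2 < 2 ^ (10 * S ^ 2) ∧ num ≤ 2 ^ (30 * S ^ 3) ∧
    (2 * n ^ 2 * b) ^ (n + 1) ≤ 2 ^ (30 * S ^ 3) ∧ 2 * D ^ 2 ≤ 2 ^ (30 * S ^ 3) ∧
    n * (D * (D * (n * b))) + b ≤ 2 ^ (30 * S ^ 3) ∧ 2 * (n * D * den + 1) ≤ 2 ^ (30 * S ^ 3) ∧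
    (T * n * D) ^ (n + 1) + 2 ≤ 2 ^ (30 * S ^ 3) ∧
    T * b + 2 * (D * (n * b)) + 2 ≤ 2 ^ (30 * S ^ 3) := by
  have hS : 1 ≤ S := hn1.trans hnS
  have hS2 : S ≤ S ^ 2 := Nat.le_self_pow (by norm_num) S
  have hS3 : S ^ 2 ≤ S ^ 3 := Nat.pow_le_pow_right hS (by norm_num)
  have mono : ∀ {x y : ℕ}, x ≤ y → (2 : ℤ) ^ x ≤ 2 ^ y := fun h =>
    pow_le_pow_right₀ (by norm_num) h
  have hn2 : (n : ℤ) ≤ 2 ^ S := by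
    have : n < 2 ^ S := hnS.trans_lt Nat.lt_two_pow_self
    exact_mod_cast this.le
  have hb0 : 0 ≤ b := by rw [hb]; positivity
  have hbase : 2 * n ^ 2 * b ≤ 2 ^ (4 * S) := by
    calc 2 * (n : ℤ) ^ 2 * b ≤ 2 * (2 ^ S) ^ 2 * 2 ^ S := by rw [hb]; gcongr
      _ = 2 ^ (3 * S + 1) := by ring
      _ ≤ 2 ^ (4 * S) := mono (by omega)
  have hbase0 : 0 ≤ 2 * n ^ 2 * b := by positivity
  -- The base 2n²b has at most 3S + 1 ≤ 4S bits, and the exponent n is at most S.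
  have hDS : D ≤ 2 ^ (4 * S ^ 2) := by
    calc D ≤ (2 ^ (4 * S)) ^ n := hD.trans (pow_le_pow_left₀ hbase0 hbase n)
      _ = 2 ^ (4 * S * n) := by rw [← pow_mul]
      _ ≤ 2 ^ (4 * S ^ 2) := mono (by nlinarith)
  have hTS : 0 ≤ T ∧ T ≤ 2 * (n * D * den + 1) := by
    have h1 : 0 ≤ n * D * den / num := Int.ediv_nonneg (by positivity) hnum0.le
    have h2 : n * D * den / num ≤ n * D * den := Int.ediv_le_self _ (by positivity)
    rw [hT, scaleFactor]
    omega
  have hscale : 2 * (n * D * den + 1) ≤ 2 ^ (8 * S ^ 2) := by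
    calc 2 * (n * D * den + 1) ≤ 2 * (2 ^ S * 2 ^ (4 * S ^ 2) * 2 ^ S + 1) := by gcongr
      _ ≤ 2 * (2 * (2 ^ S * 2 ^ (4 * S ^ 2) * 2 ^ S)) := by
        have : (1 : ℤ) ≤ 2 ^ S * 2 ^ (4 * S ^ 2) * 2 ^ S := by
          have h1 : (1 : ℤ) ≤ 2 ^ (S + 4 * S ^ 2 + S) := one_le_pow₀ (by norm_num)
          calc (1 : ℤ) ≤ 2 ^ (S + 4 * S ^ 2 + S) := h1
            _ = _ := by ring
        omega
      _ = 2 ^ (4 * S ^ 2 + 2 * S + 2) := by ring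
      _ ≤ 2 ^ (8 * S ^ 2) := mono (by omega)
  have hTS' := hTS.2.trans hscale
  have hD2 : 2 * D ^ 2 ≤ 2 ^ (8 * S ^ 2 + 1) := by
    calc 2 * D ^ 2 ≤ 2 * (2 ^ (4 * S ^ 2)) ^ 2 := by gcongr
      _ = 2 ^ (8 * S ^ 2 + 1) := by ring
  have two_add : ∀ {x : ℤ} {k : ℕ}, x ≤ 2 ^ k → 1 ≤ k → x + 2 ≤ 2 ^ (k + 1) := fun {x k} hx hk => by
    have h1 : (2 : ℤ) ^ 1 ≤ 2 ^ k := mono hk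
    have h2 : (2 : ℤ) ^ (k + 1) = 2 * 2 ^ k := by ring
    omega
  refine ⟨?_, ?_, ?_, ?_, ?_, ?_, ?_, ?_⟩
  · refine hD2.trans_lt (pow_lt_pow_right₀ (by norm_num) (by omega))
  · exact hnum.trans (mono (by omega))
  · calc (2 * n ^ 2 * b) ^ (n + 1) ≤ (2 ^ (4 * S)) ^ (n + 1) := pow_le_pow_left₀ hbase0 hbase _
      _ = 2 ^ (4 * S * (n + 1)) := by rw [← pow_mul]
      _ ≤ 2 ^ (30 * S ^ 3) := mono (by nlinarith)
  · exact hD2.trans (mono (by omega))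
  · calc n * (D * (D * (n * b))) + b ≤
          2 ^ S * (2 ^ (4 * S ^ 2) * (2 ^ (4 * S ^ 2) * (2 ^ S * 2 ^ S))) + 2 ^ S := by
          rw [hb]
          gcongr
      _ = 2 ^ (8 * S ^ 2 + 3 * S) + 2 ^ S := by ring
      _ ≤ 2 ^ (8 * S ^ 2 + 3 * S) + 2 ^ (8 * S ^ 2 + 3 * S) := by
        have : (2 : ℤ) ^ S ≤ 2 ^ (8 * S ^ 2 + 3 * S) := mono (by omega)
        omega
      _ = 2 ^ (8 * S ^ 2 + 3 * S + 1) := by ring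
      _ ≤ 2 ^ (30 * S ^ 3) := mono (by omega)
  · exact hscale.trans (mono (by omega))
  -- The dual vector is the only quantity that needs a cubic exponent: a number of quadratic bit
  -- length is raised to the power n + 1 ≤ 2S.
  · have h1 : T * n * D ≤ 2 ^ (13 * S ^ 2) := by
      calc T * n * D ≤ 2 ^ (8 * S ^ 2) * 2 ^ S * 2 ^ (4 * S ^ 2) := by
            have := hTS.1
            gcongr
        _ = 2 ^ (12 * S ^ 2 + S) := by ring
        _ ≤ 2 ^ (13 * S ^ 2) := mono (by omega)
    have h0 : 0 ≤ T * n * D := mul_nonneg (mul_nonneg hTS.1 (by omega)) hD0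
    have h2 : (T * n * D) ^ (n + 1) ≤ 2 ^ (26 * S ^ 3) := by
      calc (T * n * D) ^ (n + 1) ≤ (2 ^ (13 * S ^ 2)) ^ (n + 1) := pow_le_pow_left₀ h0 h1 _
        _ = 2 ^ (13 * S ^ 2 * (n + 1)) := by rw [← pow_mul]
        _ ≤ 2 ^ (26 * S ^ 3) := mono (by
          calc 13 * S ^ 2 * (n + 1) ≤ 13 * S ^ 2 * (S + S) := Nat.mul_le_mul_left _ (by omega)
            _ = 26 * S ^ 3 := by ring)
    exact (two_add h2 (by omega)).trans (mono (by omega))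
  · have h1 : T * b + 2 * (D * (n * b)) ≤ 2 ^ (10 * S ^ 2) := by
      calc T * b + 2 * (D * (n * b)) ≤
            2 ^ (8 * S ^ 2) * 2 ^ S + 2 * (2 ^ (4 * S ^ 2) * (2 ^ S * 2 ^ S)) := by
            rw [hb]
            gcongr
        _ = 2 ^ (8 * S ^ 2 + S) + 2 ^ (4 * S ^ 2 + 2 * S + 1) := by ring
        _ ≤ 2 ^ (9 * S ^ 2) + 2 ^ (9 * S ^ 2) := add_le_add (mono (by omega)) (mono (by omega))
        _ = 2 ^ (9 * S ^ 2 + 1) := by ring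
        _ ≤ 2 ^ (10 * S ^ 2) := mono (by omega)
    exact (two_add h1 (by omega)).trans (mono (by omega))

/-- Rounding down and adding 1 exceeds nD/ε. The factor 2 serves twice: it absorbs the doubling by
the perturbation and makes T even. -/
theorem le_scaleFactor {n : ℕ} {D : ℤ} {ε : ℚ} (hε : 0 < ε) :
    n * (D / ε) * 2 ≤ (scaleFactor n D ε.den ε.num : ℚ) := by
  have hnum : (0 : ℚ) < ε.num := by exact_mod_cast Rat.num_pos.2 hε
  have hden : (0 : ℚ) < ε.den := by exact_mod_cast ε.den_pos
  have h1 : n * (D / ε) = (n * D * ε.den : ℤ) / (ε.num : ℚ) := by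
    conv_lhs => rw [← Rat.num_div_den ε]
    push_cast
    field_simp
  have h2 : ((n * D * ε.den : ℤ) : ℚ) / ε.num < ((n * D * ε.den / ε.num : ℤ) : ℚ) + 1 := by
    rw [div_lt_iff₀ hnum]
    exact_mod_cast Int.lt_ediv_add_one_mul_self _ (Rat.num_pos.2 hε)
  rw [h1, scaleFactor]
  push_cast at h2 ⊢
  linarith

theorem scaleFactor_le {n : ℕ} {D : ℤ} {ε : ℚ} (hε : 0 < ε) :
    (scaleFactor n D ε.den ε.num : ℚ) ≤ 2 * (n * (D / ε) + 1) := by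
  have hnum : (0 : ℚ) < ε.num := by exact_mod_cast Rat.num_pos.2 hε
  have hden : (0 : ℚ) < ε.den := by exact_mod_cast ε.den_pos
  have h1 : n * (D / ε) = (n * D * ε.den : ℤ) / (ε.num : ℚ) := by
    conv_lhs => rw [← Rat.num_div_den ε]
    push_cast
    field_simp
  have h2 : ((n * D * ε.den / ε.num : ℤ) : ℚ) ≤ ((n * D * ε.den : ℤ) : ℚ) / ε.num := by
    rw [le_div_iff₀ hnum]
    exact_mod_cast Int.ediv_mul_le _ (Rat.num_pos.2 hε).ne'
  rw [h1, scaleFactor]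
  push_cast at h2 ⊢
  linarith

end SysNF

-- The theorem

theorem lemma2 :
    ∃ (P : LogRAM.Program) (q : Polynomial ℕ) (C k : ℕ),
      ∀ (n : ℕ) [NeZero n] (B : Matrix (Fin n) (Fin n) ℤ) (ε : ℚ), B.det ≠ 0 → 0 < ε →
        ∃ (s : LogRAM.Store) (t : ℕ) (B' A : Matrix (Fin n) (Fin n) ℤ) (T : ℕ),
          -- the program halts in polynomial time with output `(B', A, T)`
          LogRAM.Exec P (SysNF.inputStore B ε) s t ∧
          t ≤ q.eval (SysNF.inputSize B ε) ∧
          SysNF.IsOutput s B' A T ∧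
          SysNF.IsSysNF B' ∧
          0 < T ∧
          (T : ℚ) ≤ C * ((n : ℚ) + |(B.det : ℚ)| / ε) ^ k ∧
          -- `A` is the matrix of images of the basis `B` under the linear bijection `σ`
          ∃ σ : SysNF.latticeOf B ≃ₗ[ℤ] SysNF.latticeOf B',
            (∀ j : Fin n, (σ ⟨SysNF.colVec B j, SysNF.colVec_mem B j⟩ :
              EuclideanSpace ℝ (Fin n)) = SysNF.colVec A j) ∧
            ∀ v : SysNF.latticeOf B,
              ‖(T : ℝ)⁻¹ • (σ v : EuclideanSpace ℝ (Fin n)) - (v : EuclideanSpace ℝ (Fin n))‖ ≤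
                (ε : ℝ) * ‖(v : EuclideanSpace ℝ (Fin n))‖ := by
  obtain ⟨p, hp⟩ := SysNF.sysNFProg.exists_steps_eq_eval
  -- The loops have at most 10S² rounds, and 2^(30S³) has 30S³ + 1 bits, which with the extra bit in
  -- the cost bound gives the factor 30S³ + 2. For T, the bound 2(n d + 1) with d = |det B|/ε is at
  -- most 2(n + d)².
  refine ⟨SysNF.sysNFProg, p.comp (10 * Polynomial.X ^ 2) * (30 * Polynomial.X ^ 3 + 2), 2, 2, ?_⟩
  intro n _ B ε hB hε
  set S := SysNF.inputSize B ε with hS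
  have hnS := SysNF.dim_le_inputSize B ε
  have hn1 : 1 ≤ n := NeZero.one_le
  have hnum := Rat.num_pos.2 hε
  have hden : (0 : ℤ) < ε.den := by exact_mod_cast ε.den_pos
  have hb1 : (1 : ℤ) ≤ 2 ^ S := one_le_pow₀ (by norm_num)
  have hBb : ∀ i j, |B i j| ≤ 2 ^ S := SysNF.abs_entry_le B ε
  have hD0 : 0 < |B.det| := abs_pos.2 hB
  set T := SysNF.scaleFactor n |B.det| ε.den ε.num with hT
  obtain ⟨b1, b2, b3, b4, b5, b6, b7, b8⟩ := SysNF.size_bounds hn1 hnS rfl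
    ((le_abs_self _).trans (SysNF.abs_num_le B ε)) ((le_abs_self _).trans (SysNF.abs_den_le B ε))
    hden hnum hD0.le (SysNF.abs_det_le hb1 hBb) hT
  have hnβ : n ≤ 10 * S ^ 2 := by
    have := Nat.le_self_pow (n := 2) (by norm_num) S
    omega
  have hcast : ((2 ^ (30 * S ^ 3) : ℕ) : ℤ) = 2 ^ (30 * S ^ 3) := by push_cast; rfl
  rw [← hcast] at b2 b3 b4 b5 b6 b7 b8
  obtain ⟨s, t, hexec, ht, H, U, c, hres⟩ := SysNF.runs_sysNFProg (β := 10 * S ^ 2)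
    (W := 2 ^ (30 * S ^ 3)) (s := SysNF.inputStore B ε) (B := B) (num := ε.num) (den := ε.den)
    (by simp [SysNF.inputStore]) (by simp [SysNF.inputStore]) (by simp [SysNF.inputStore])
    (by ext i j; simp [SysNF.inputStore, LogRAM.Store.mat])
    (fun a ha => by ext i j; simp [SysNF.inputStore, ha])
    hB hnum hden hb1 hBb rfl hT hnβ le_rfl b1 b2 b3 b4 b5 b6 b7 b8
  have hquot : 0 ≤ n * |B.det| * ε.den / ε.num :=
    Int.ediv_nonneg (by positivity) hnum.le
  have hT0 : 0 < T := by
    rw [hT, SysNF.scaleFactor]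
    omega
  have hTn : ((T.toNat : ℕ) : ℤ) = T := Int.toNat_of_nonneg hT0.le
  set δ := SysNF.cornerShift (c n) with hδ
  have hδ0 : 0 ≤ δ ∧ δ ≤ 2 := by
    rw [hδ]
    unfold SysNF.cornerShift
    split_ifs <;> simp
  obtain ⟨V, hV, hBV⟩ := hres.dual.exists_unimodular (δ := δ) rfl
  have hG : (T • H + SysNF.shiftMatrix n δ).det ≠ 0 := by
    rw [← hBV, Matrix.det_mul, SysNF.det_sysMatrix]
    exact mul_ne_zero (abs_pos.2 (SysNF.cornerShift_sub_ne_zero _)).ne' hV.ne_zero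
  have hspan : SysNF.colSpan (T • H + SysNF.shiftMatrix n δ) =
      SysNF.colSpan (SysNF.sysMatrix |δ - c n| (fun j : Fin n => c j)) := by
    rw [← hBV, SysNF.colSpan_mul_of_isUnit _ hV]
  -- The scaling factor is bounded in rational arithmetic, where ε lives, and the result is then
  -- cast to the reals.
  have hTε : 2 * (n * (|B.det| : ℤ)) ≤ (ε : ℝ) * T := by
    have h1 := SysNF.le_scaleFactor (n := n) (D := |B.det|) hε
    rw [← hT] at h1
    have h2 : 2 * (n * ((|B.det| : ℤ) : ℚ)) ≤ ε * T := by
      calc 2 * (n * ((|B.det| : ℤ) : ℚ)) = ε * (n * ((|B.det| : ℤ) / ε) * 2) := by field_simp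
        _ ≤ ε * T := mul_le_mul_of_nonneg_left h1 hε.le
    exact_mod_cast h2
  refine ⟨s, t, _, _, T.toNat, hexec, ?_, ⟨fun i j => congr_fun (congr_fun hres.sys i) j,
    fun i j => congr_fun (congr_fun hres.image i) j, hres.scale.trans hTn.symm⟩,
    hres.dual.isSysNF ?_ rfl, by omega, ?_, ?_⟩
  · rw [Nat.size_pow, hp] at ht
    simpa [add_assoc] using ht
  · rw [hT, SysNF.scaleFactor]
    exact even_two_mul _
  · have h1 := SysNF.scaleFactor_le (n := n) (D := |B.det|) hε
    rw [← hT, Int.cast_abs] at h1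
    have h2 : ((T.toNat : ℕ) : ℚ) = T := by exact_mod_cast hTn
    rw [h2]
    refine h1.trans ?_
    have h3 : (0 : ℚ) ≤ |(B.det : ℚ)| / ε := by positivity
    have h4 : (1 : ℚ) ≤ n := by exact_mod_cast hn1
    generalize |(B.det : ℚ)| / ε = d at *
    rw [Nat.cast_ofNat]
    -- Expanding the square, n² ≥ 1 takes care of the constant and 2nd ≥ nd of the mixed term.
    nlinarith [mul_nonneg (by linarith : (0 : ℚ) ≤ n) h3, sq_nonneg d]
  · obtain ⟨σ, h1, h2⟩ := SysNF.exists_latticeEquiv hB hT0 hres.basis.tri hres.basis.pos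
      hres.basis.nonneg hres.red hres.basis.span hres.mul hδ0.1 hδ0.2 hG hspan hTε
    refine ⟨σ, h1, fun v => ?_⟩
    have h3 : ((T.toNat : ℕ) : ℝ) = T := by exact_mod_cast hTn
    rw [h3]
    exact h2 v
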